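/- Let $p_1,p_2,q$ be primes with $p_1\ne p_2$ and $p_1\equiv p_2\equiv -q\equiv 1\pmod 4$, let $k=\mathbb{Q}(\sqrt{p_1p_2q},\,i)$, and put $K_1=k(\sqrt{p_1})$, $K_2=k(\sqrt{p_2})$, $K_3=k(\sqrt q)$. For $j=1,2,3$ let $\kappa_{K_j}$ be the capitulation kernel of $K_j/k$, that is, the kernel of the homomorphism $\mathrm{Cl}(k)\to\mathrm{Cl}(K_j)$ of ideal class groups induced by extension of ideals. For a square-free integer $m>1$ let $\varepsilon_m>1$ denote the fundamental unit of $\mathbb{Q}(\sqrt m)$, and write $\varepsilon_{p_1p_2q}=x+y\sqrt{p_1p_2q}$ with $x,y\in\mathbb{Q}$. For a positive integer $c$ and a rational number $z$, "$c(z\pm1)$ is a square" means that at least one of $c(z+1)$, $c(z-1)$ is the square of a natural number. 1. Write $\varepsilon_{p_2q}=a+b\sqrt{p_2q}$ with $a,b\in\mathbb{Q}$. (i) If $x\pm1$ is a square and neither $a+1$ nor $a-1$ is a square, then $|\kappa_{K_1}|=8$. (ii) If $a\pm1$ is a square and $p_1(x\pm1)$ or $2p_1(x\pm1)$ is a square,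 then $|\kappa_{K_1}|=2$. (iii) In all other cases $|\kappa_{K_1}|=4$. 2. Write $\varepsilon_{p_1q}=a+b\sqrt{p_1q}$ with $a,b\in\mathbb{Q}$. (i) If $x\pm1$ is a square and neither $a+1$ nor $a-1$ is a square, then $|\kappa_{K_2}|=8$. (ii) If $a\pm1$ is a square and $p_2(x\pm1)$ or $2p_2(x\pm1)$ is a square, then $|\kappa_{K_2}|=2$. (iii) In all other cases $|\kappa_{K_2}|=4$. 3. Let $N$ denote the norm from $\mathbb{Q}(\sqrt{p_1p_2})$ to $\mathbb{Q}$. (i) If $N(\varepsilon_{p_1p_2})=1$, then $|\kappa_{K_3}|=4$ if $x\pm1$ is a square, and $|\kappa_{K_3}|=2$ otherwise. (ii) If $N(\varepsilon_{p_1p_2})=-1$, then $|\kappa_{K_3}|=2$ if $q(x\pm1)$ or $2q(x\pm1)$ is a square, and $|\kappa_{K_3}|=4$ otherwise. -/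

import Mathlib

open scoped NumberField

namespace Capitulation

/-- The real quadratic field `ℚ(√m)`, as a subfield of `ℝ`. -/
noncomputable abbrev realQuadratic (m : ℕ) : IntermediateField ℚ ℝ :=
  IntermediateField.adjoin ℚ {√(m : ℝ)}

/-- `ε` is the fundamental unit of `ℚ(√m)`, normalised by `ε > 1`: every unit of the ring of
integers is `± ε ^ n` for some integer `n`. -/
def IsFundamentalUnit {m : ℕ} (ε : (𝓞 (realQuadratic m))ˣ) : Prop :=
  1 < (((ε : 𝓞 (realQuadratic m)) : realQuadratic m) : ℝ) ∧
    ∀ η : (𝓞 (realQuadratic m))ˣ, ∃ n : ℤ, η = ε ^ n ∨ η = -ε ^ n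

/-- `ε = x + y√m` with rational `x` and `y`. -/
def HasCoords {m : ℕ} (ε : (𝓞 (realQuadratic m))ˣ) (x y : ℚ) : Prop :=
  (((ε : 𝓞 (realQuadratic m)) : realQuadratic m) : ℝ) = x + y * √(m : ℝ)

/-- The rational number `r` is the square of a natural number. -/
def IsNatSquare (r : ℚ) : Prop := ∃ n : ℕ, r = (n : ℚ) ^ 2

/-- "`c(x ± 1)` is a square in `ℕ`": at least one of `c(x + 1)`, `c(x - 1)` is one. -/
def PMSquare (c : ℕ) (x : ℚ) : Prop :=
  IsNatSquare (c * (x + 1)) ∨ IsNatSquare (c * (x - 1))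

/-- The field `ℚ(√d, i)`, as a subfield of `ℂ`. -/
noncomputable abbrev baseField (d : ℕ) : IntermediateField ℚ ℂ :=
  IntermediateField.adjoin ℚ {((√(d : ℝ) : ℝ) : ℂ), Complex.I}

/-- The extension `k(√m)` of `k = ℚ(√d, i)` inside `ℂ`. -/
noncomputable abbrev extField (d m : ℕ) : IntermediateField (baseField d) ℂ :=
  IntermediateField.adjoin (baseField d) {((√(m : ℝ) : ℝ) : ℂ)}

/-- The capitulation kernel of `K/k`: the kernel of the homomorphism `Cl(k) → Cl(K)` induced by
extension of ideals. -/
noncomputable def capitulationKernel (k K : Type*) [Field k] [Field K] [Algebra k K] :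
    Subgroup (ClassGroup (𝓞 k)) :=
  (ClassGroup.extendedHom (𝓞 k) (𝓞 K)).ker

end Capitulation

open scoped NumberField nonZeroDivisors

namespace Capitulation

/-! ### An index formula for an involution on a commutative group. -/

section Involution

variable {E : Type*} [CommGroup E] (s : E ≃* E)

/-! Let `K` be one of the three extensions of `k`, `σ` the generator of its Galois group, and `N u =
u · σ u` on units. Write `d = p₁p₂q = mn` with `m ≡ 1` and `n ≡ 3` modulo 4 coprime, so that `K =
k(√m) = k(√n)`. Since `(1 + √m)/2` and `(1 + √(-n))/2` are integral, `K/k` is unramified. If an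
ideal of `k` becomes `(α)` in `K`, the unit `α/σα` has norm 1, and this identifies the capitulation
kernel `κ` with `ker N / (1 - σ)E_K` (`card_ker_extendedHom`). The kernel of `N` has rank 2 and
2-torsion `±1`, so an index count gives `|κ| · [N E_K : E_k²] = 8` (`relIndex_invDiff_mul`,
`card_capitulationKernel_mul`).

It remains to see which units are norms. For a unit `u` of `K` some odd power satisfies `u^(2M) = J
v₁ v₂ v₃` and `(N u)^M = J v₃`, where `J` is `1` or `i` and the `vⱼ` are units of `ℚ(√m)`, `ℚ(√n)`,
`ℚ(√d)` (`unit_decomposition`). Hence every norm is `i^e ε^t` modulo `E_k²`, with `e` and `t` at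
most 1, and `i^e ε^t` is a norm exactly when `i^e ε^t v₁ v₂` is a square in `K` for some `v₁`, `v₂`
of norm 1 (`isAllowed_of_norm`, `exists_unit_of_class`).

The identities `2i = (1 + i)²` and `(2r + 2)v = (1 + v)²`, for `v = r + t√c` of norm 1, replace all
these units by positive rationals, and a positive rational is a square in `K` only if it is one in
`ℚ` after multiplication by `1`, `m`, `n` or `mn` (`rat_sq`). So everything becomes linear algebra
over the field with two elements, in the parities of the valuations at `2`, `p₁`, `p₂`, `q`. Only
fundamental units matter there (`FundCoords.isUnitClass_cases`, `FundCoords.isUnitClass_of_neg`),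
and the conditions on `c(x ± 1)` have the same shape (`FundCoords.pmSquare_iff`), so that a finite
check finishes each case. -/

/-- The norm of an involution on a commutative group. -/
def invNorm : E →* E := MonoidHom.id E * s.toMonoidHom

/-- The map `u ↦ u / s u`. -/
def invDiff : E →* E := MonoidHom.id E / s.toMonoidHom

theorem invNorm_apply (u : E) : invNorm s u = u * s u := rfl
theorem invDiff_apply (u : E) : invDiff s u = u / s u := rfl

/-- `[ker N : (1-s)E] * [N E : (E^s)²] = [ker N : (ker N)²]`. -/
theorem relIndex_invDiff_mul (hs : ∀ x, s (s x) = x) :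
    (invDiff s).range.relIndex (invNorm s).ker *
      ((invDiff s).ker.map (powMonoidHom 2)).relIndex (invNorm s).range =
    ((invNorm s).ker.map (powMonoidHom 2)).relIndex (invNorm s).ker := by
  -- The norm is squaring on the fixed group, and `1 - s` is squaring on `ker N`. Hence the preimage
  -- of the squares of fixed elements under `N` and that of the squares of `ker N` under `1 - s` are
  -- one and the same group, and the two indices agree.
  have hN : ((invDiff s).ker.map (powMonoidHom 2)).comap (invNorm s) =
      (invNorm s).ker ⊔ (invDiff s).ker := by
    ext u
    rw [Subgroup.mem_comap, Subgroup.mem_sup]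
    constructor
    · rintro ⟨z, hz, hzu⟩
      have hz' : s z = z := by
        have := MonoidHom.mem_ker.mp hz
        rw [invDiff_apply, div_eq_one] at this
        exact this.symm
      refine ⟨u / z, ?_, z, hz, by simp⟩
      rw [MonoidHom.mem_ker, map_div, ← hzu, invNorm_apply, hz']
      simp [pow_two]
    · rintro ⟨v, hv, z, hz, rfl⟩
      have hz' : s z = z := by
        have := MonoidHom.mem_ker.mp hz
        rw [invDiff_apply, div_eq_one] at this
        exact this.symm
      refine ⟨z, hz, ?_⟩
      rw [map_mul, MonoidHom.mem_ker.mp hv, one_mul, invNorm_apply, hz']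
      simp [pow_two]
  have hker : ∀ g, g ∈ (invNorm s).ker → invDiff s g = g ^ 2 := by
    intro g hg
    have := MonoidHom.mem_ker.mp hg
    rw [invNorm_apply] at this
    rw [invDiff_apply, eq_inv_of_mul_eq_one_right this, div_inv_eq_mul, pow_two]
  have hD : ((invNorm s).ker.map (powMonoidHom 2)).comap (invDiff s) =
      (invNorm s).ker ⊔ (invDiff s).ker := by
    ext u
    rw [Subgroup.mem_comap, Subgroup.mem_sup]
    constructor
    · rintro ⟨g, hg, hgu⟩
      refine ⟨g, hg, u / g, ?_, by simp⟩
      rw [MonoidHom.mem_ker, map_div, ← hgu, hker g hg]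
      simp
    · rintro ⟨v, hv, z, hz, rfl⟩
      refine ⟨v, hv, ?_⟩
      rw [map_mul, MonoidHom.mem_ker.mp hz, mul_one, hker v hv]
      simp
  have hle1 : (invNorm s).ker.map (powMonoidHom 2) ≤ (invDiff s).range := by
    rintro _ ⟨g, hg, rfl⟩
    exact ⟨g, hker g hg⟩
  have hle2 : (invDiff s).range ≤ (invNorm s).ker := by
    rintro _ ⟨u, rfl⟩
    rw [MonoidHom.mem_ker, invNorm_apply, invDiff_apply, map_div, hs]
    simp
  rw [← Subgroup.relIndex_mul_relIndex _ _ _ hle1 hle2, mul_comm]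
  congr 1
  rw [← Subgroup.index_comap, hN, ← hD, Subgroup.index_comap]

end Involution

/-! ### Descent of stable ideals in an unramified quadratic extension. -/

section Descent

variable {A B : Type*} [CommRing A] [CommRing B] [Algebra A B] (S : B ≃ₐ[A] B)

/-- The norm `u ↦ u * S u` on units, for an involution `S`. -/
abbrev unitNorm : Bˣ →* Bˣ := invNorm (Units.mapEquiv (S : B ≃* B))

/-- The map `u ↦ u / S u` on units. -/
abbrev unitDiff : Bˣ →* Bˣ := invDiff (Units.mapEquiv (S : B ≃* B))

theorem unitNorm_apply (u : Bˣ) : ((unitNorm S u : Bˣ) : B) = u * S u := rfl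

theorem unitDiff_mul (u : Bˣ) : ((unitDiff S u : Bˣ) : B) * S u = u := by
  have : unitDiff S u * Units.mapEquiv (S : B ≃* B) u = u := by simp [unitDiff, invDiff_apply]
  exact congrArg Units.val this

/-- Descent: if the differences `b - S b` generate the unit ideal, every `S`-stable ideal is
extended from the ring of invariants. -/
theorem map_comap_of_stable (hS : ∀ x, S (S x) = x)
    (hfix : ∀ x, S x = x → ∃ y, algebraMap A B y = x)
    (hunr : Ideal.span (Set.range fun b : B => b - S b) = ⊤)
    (J : Ideal B) (hJ : ∀ z ∈ J, S z ∈ J) :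
    (J.comap (algebraMap A B)).map (algebraMap A B) = J := by
  refine le_antisymm Ideal.map_comap_le fun z hz => ?_
  have htr : ∀ w ∈ J, w + S w ∈ (J.comap (algebraMap A B)).map (algebraMap A B) := by
    intro w hw
    obtain ⟨y, hy⟩ := hfix (w + S w) (by rw [map_add, hS, add_comm])
    rw [← hy]
    exact Ideal.mem_map_of_mem _ (by rw [Ideal.mem_comap, hy]; exact J.add_mem hw (hJ w hw))
  -- With `Tr w = w + S w`, one has `(b - S b) z = Tr (b z) - S b · Tr z`, and traces of elements of
  -- `J` come from the base ring.
  have hdiff : ∀ b, (b - S b) * z ∈ (J.comap (algebraMap A B)).map (algebraMap A B) := by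
    intro b
    have h1 := htr (b * z) (J.mul_mem_left b hz)
    have h2 := Ideal.mul_mem_left _ (S b) (htr z hz)
    have := Ideal.sub_mem _ h1 h2
    convert this using 1
    rw [map_mul]; ring
  have h1 : (1 : B) ∈ Ideal.span (Set.range fun b : B => b - S b) := by rw [hunr]; trivial
  have hall : ∀ c ∈ Ideal.span (Set.range fun b : B => b - S b),
      c * z ∈ (J.comap (algebraMap A B)).map (algebraMap A B) := by
    intro c hc
    induction hc using Submodule.span_induction with
    | mem x hx => obtain ⟨b, rfl⟩ := hx; exact hdiff b
    | zero => simp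
    | add x y _ _ hx hy => rw [add_mul]; exact Ideal.add_mem _ hx hy
    | smul a x _ hx => rw [smul_eq_mul, mul_assoc]; exact Ideal.mul_mem_left _ a hx
  simpa using hall 1 h1

end Descent

/-! ### The capitulation kernel in terms of units of norm one. -/

section Kernel

variable {A B : Type*} [CommRing A] [IsDedekindDomain A] [CommRing B] [IsDedekindDomain B]
  [Algebra A B] [Module.IsTorsionFree A B] (S : B ≃ₐ[A] B)

theorem ideal_map_injective [Algebra.IsIntegral A B] :
    Function.Injective (fun I : Ideal A => I.map (algebraMap A B)) := by
  intro I J h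
  let _ := FractionRing.liftAlgebra A (FractionRing B)
  have key := FractionalIdeal.extendedHom_injective A (FractionRing A) (FractionRing B) B
  refine FractionalIdeal.coeIdeal_injective (K := FractionRing A) (key ?_)
  simp only [FractionalIdeal.extendedHom_coeIdeal_eq_map]
  exact congrArg _ h

/-- The ideal class `c` becomes trivial through a generator `α` with `α = u * S α`. -/
def Represents (c : ClassGroup A) (u : Bˣ) : Prop :=
  ∃ (I : (Ideal A)⁰) (α : B), ClassGroup.mk0 I = c ∧
    (I : Ideal A).map (algebraMap A B) = Ideal.span {α} ∧ α ≠ 0 ∧ α = u * S α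

/-- The extended ideal is `S`-stable, so a generator `α` and its conjugate differ by a unit `u`.
Applying `S` to `α = u · S α` shows that `u` has norm 1. -/
theorem exists_represents (hS : ∀ x, S (S x) = x) {c : ClassGroup A}
    (hc : c ∈ (ClassGroup.extendedHom A B).ker) :
    ∃ u ∈ (unitNorm S).ker, Represents S c u := by
  obtain ⟨I, rfl⟩ := ClassGroup.mk0_surjective c
  rw [MonoidHom.mem_ker, ClassGroup.extendedHom_mk0, ClassGroup.mk0_eq_one_iff] at hc
  obtain ⟨α, hα⟩ := hc
  have hα' : (I : Ideal A).map (algebraMap A B) = Ideal.span {α} := hα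
  have hI0 : (I : Ideal A) ≠ ⊥ := nonZeroDivisors.coe_ne_zero I
  have hα0 : α ≠ 0 := by
    rintro rfl
    rw [Ideal.span_singleton_eq_bot.mpr rfl,
      Ideal.map_eq_bot_iff_of_injective (FaithfulSMul.algebraMap_injective A B)] at hα'
    exact hI0 hα'
  have hst : Ideal.span {S α} = Ideal.span {α} := by
    have h1 : (Ideal.span {α}).map (S : B →+* B) = Ideal.span {S α} := by
      rw [Ideal.map_span]; simp
    rw [← h1, ← hα', Ideal.map_map]
    congr 1
    ext x
    simp
  obtain ⟨u, hu⟩ := Ideal.span_singleton_eq_span_singleton.mp hst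
  have hu' : α = u * S α := by rw [mul_comm, hu]
  refine ⟨u, ?_, I, α, rfl, hα', hα0, hu'⟩
  rw [MonoidHom.mem_ker]
  ext
  rw [unitNorm_apply, Units.val_one]
  have h2 : S α = S u * α := by
    have := congrArg S hu'
    rwa [map_mul, hS] at this
  have h3 : (u * S u) * α = 1 * α := by rw [mul_assoc, ← h2, ← hu', one_mul]
  exact mul_right_cancel₀ hα0 h3

/-- Hilbert 90 writes a unit of norm 1 as `α / S α` with `α` integral. The ideal `(α)` is then
stable, hence extended from `A` by descent, and its contraction gives the class. -/
theorem exists_of_mem_ker (hS : ∀ x, S (S x) = x)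
    (hfix : ∀ x, S x = x → ∃ y, algebraMap A B y = x)
    (hunr : Ideal.span (Set.range fun b : B => b - S b) = ⊤) {u : Bˣ}
    (hu : u ∈ (unitNorm S).ker) :
    ∃ c ∈ (ClassGroup.extendedHom A B).ker, Represents S c u := by
  have hu1 : (u : B) * S u = 1 := by
    rw [← unitNorm_apply, MonoidHom.mem_ker.mp hu, Units.val_one]
  obtain ⟨α, hα0, hα⟩ : ∃ α : B, α ≠ 0 ∧ α = u * S α := by
    -- The Hilbert 90 element `1 + u` vanishes only for `u = -1`. There any nonzero difference `b -
    -- S b` serves, and one exists because the differences generate the unit ideal.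
    by_cases h : (1 : B) + u = 0
    · have hu' : (u : B) = -1 := by linear_combination h
      have : ∃ b : B, b - S b ≠ 0 := by
        by_contra! hcon
        have : Ideal.span (Set.range fun b : B => b - S b) = ⊥ := by
          rw [Ideal.span_eq_bot]
          rintro x ⟨b, rfl⟩
          exact hcon b
        rw [hunr] at this
        exact top_ne_bot this
      obtain ⟨b, hb⟩ := this
      exact ⟨b - S b, hb, by rw [hu', map_sub, hS]; ring⟩
    · exact ⟨1 + u, h, by rw [map_add, map_one, mul_add, mul_one, hu1, add_comm]⟩
  have hmap := map_comap_of_stable S hS hfix hunr (Ideal.span {α}) (by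
    intro z hz
    obtain ⟨w, rfl⟩ := Ideal.mem_span_singleton'.mp hz
    refine Ideal.mem_span_singleton'.mpr ⟨S w * S u, ?_⟩
    have := congrArg S hα
    rw [map_mul, hS] at this
    rw [map_mul, this, mul_assoc])
  have hI0 : (Ideal.span {α}).comap (algebraMap A B) ∈ (Ideal A)⁰ := by
    rw [mem_nonZeroDivisors_iff_ne_zero]
    intro h0
    rw [h0, Ideal.zero_eq_bot, Ideal.map_bot] at hmap
    exact hα0 (Ideal.span_singleton_eq_bot.mp hmap.symm)
  refine ⟨ClassGroup.mk0 ⟨_, hI0⟩, ?_, ⟨_, hI0⟩, α, rfl, hmap, hα0, hα⟩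
  rw [MonoidHom.mem_ker, ClassGroup.extendedHom_mk0, ClassGroup.mk0_eq_one_iff]
  exact ⟨α, hmap⟩

/-- Two classes agree when their generators agree up to a unit `w` and a factor from the fraction
field of `A`. The factor is invariant and disappears from `α / S α`, which leaves only `w / S w`. -/
theorem Represents.eq_iff [Algebra.IsIntegral A B] (hfix : ∀ x, S x = x → ∃ y, algebraMap A B y = x)
    (hS : ∀ x, S (S x) = x) {c c' : ClassGroup A} {u u' : Bˣ}
    (h : Represents S c u) (h' : Represents S c' u') :
    c = c' ↔ ∃ w : Bˣ, (u : B) * w = u' * S w := by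
  obtain ⟨I, α, rfl, hI, hα0, hα⟩ := h
  obtain ⟨I', α', rfl, hI', hα0', hα'⟩ := h'
  have hinj : Function.Injective (algebraMap A B) := FaithfulSMul.algebraMap_injective A B
  have hspan : ∀ (x y : A), Ideal.span {x} * (I : Ideal A) = Ideal.span {y} * I' ↔
      Ideal.span {algebraMap A B x * α} = Ideal.span {algebraMap A B y * α'} := by
    intro x y
    rw [← (ideal_map_injective (A := A) (B := B)).eq_iff]
    simp only [Ideal.map_mul, Ideal.map_span, Set.image_singleton, hI, hI',
      Ideal.span_singleton_mul_span_singleton]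
  rw [ClassGroup.mk0_eq_mk0_iff]
  constructor
  · rintro ⟨x, y, hx, hy, hxy⟩
    rw [hspan, Ideal.span_singleton_eq_span_singleton] at hxy
    obtain ⟨w, hw⟩ := hxy
    have hw' := congrArg S hw
    simp only [map_mul, AlgEquiv.commutes] at hw'
    have hx0 : algebraMap A B x ≠ 0 := (map_ne_zero_iff _ hinj).mpr hx
    have hSα : S α ≠ 0 := (map_ne_zero_iff _ S.injective).mpr hα0
    refine ⟨w, ?_⟩
    apply mul_left_cancel₀ (mul_ne_zero hx0 hSα)
    linear_combination (-(algebraMap A B x) * w) * hα + hw - u' * hw' + algebraMap A B y * hα'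
  · rintro ⟨w, hw⟩
    -- The quotient `α w / α'` is invariant. Multiplying numerator and denominator by `S α'` turns
    -- it into a quotient of two invariant integral elements.
    obtain ⟨x, hx⟩ := hfix (α' * S α') (by rw [map_mul, hS, mul_comm])
    have hswap : S α * S w * α' = α * w * S α' := by
      linear_combination (S α * S w) * hα' - w * S α' * hα - S α * S α' * hw
    obtain ⟨y, hy⟩ := hfix (α * w * S α') (by rw [map_mul, map_mul, hS, hswap])
    have hSα' : S α' ≠ 0 := (map_ne_zero_iff _ S.injective).mpr hα0'
    refine ⟨x, y, ?_, ?_, ?_⟩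
    · rintro rfl
      rw [map_zero] at hx
      exact mul_ne_zero hα0' hSα' hx.symm
    · rintro rfl
      rw [map_zero] at hy
      exact mul_ne_zero (mul_ne_zero hα0 w.ne_zero) hSα' hy.symm
    · rw [hspan, Ideal.span_singleton_eq_span_singleton]
      exact ⟨w, by rw [hx, hy]; ring⟩

/-- For an unramified quadratic extension of Dedekind domains, the capitulation kernel has the
same order as `ker N / (1 - S)` on units. -/
theorem card_ker_extendedHom [Algebra.IsIntegral A B] (hS : ∀ x, S (S x) = x)
    (hfix : ∀ x, S x = x → ∃ y, algebraMap A B y = x)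
    (hunr : Ideal.span (Set.range fun b : B => b - S b) = ⊤) :
    Nat.card (ClassGroup.extendedHom A B).ker =
      (unitDiff S).range.relIndex (unitNorm S).ker := by
  choose f hf hfR using fun c : (ClassGroup.extendedHom A B).ker => exists_represents S hS c.2
  rw [Subgroup.relIndex, Subgroup.index]
  refine Nat.card_congr (Equiv.ofBijective (fun c => QuotientGroup.mk ⟨f c, hf c⟩) ⟨?_, ?_⟩)
  · intro c c' h
    rw [QuotientGroup.eq, Subgroup.mem_subgroupOf] at h
    obtain ⟨w, hw⟩ := h
    refine Subtype.ext ((Represents.eq_iff S hfix hS (hfR c) (hfR c')).mpr ⟨w, ?_⟩)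
    have h1 := unitDiff_mul S w
    have h2 : (f c : B) * unitDiff S w = f c' := by
      rw [← Units.val_mul, hw]; simp
    linear_combination S w * h2 - (f c : B) * h1
  · intro z
    obtain ⟨⟨u, hu⟩, rfl⟩ := QuotientGroup.mk_surjective z
    obtain ⟨c, hc, hcu⟩ := exists_of_mem_ker S hS hfix hunr hu
    refine ⟨⟨c, hc⟩, ?_⟩
    obtain ⟨w, hw⟩ := (Represents.eq_iff S hfix hS (hfR ⟨c, hc⟩) hcu).mp rfl
    rw [QuotientGroup.eq, Subgroup.mem_subgroupOf]
    refine ⟨w, ?_⟩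
    have h1 := unitDiff_mul S w
    have h2 : f ⟨c, hc⟩ * unitDiff S w = u := by
      ext
      have hSw : IsUnit (S (w : B)) := w.isUnit.map S
      refine hSw.mul_right_cancel ?_
      rw [Units.val_mul]
      linear_combination (f ⟨c, hc⟩ : B) * h1 + hw
    simp [← h2]

end Kernel

/-! ### The index of the doubles in a finitely generated abelian group. -/

section TwoRank

open Module

/-- For a finitely generated abelian group, `[M : 2M] = 2 ^ rank * #M[2]`. -/
theorem index_range_two_nsmul (M : Type*) [AddCommGroup M] [Module.Finite ℤ M] :
    (nsmulAddMonoidHom (α := M) 2).range.index =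
      2 ^ finrank ℤ M * Nat.card (nsmulAddMonoidHom (α := M) 2).ker := by
  set T : Submodule ℤ M := Submodule.torsion ℤ M with hT
  set R := (nsmulAddMonoidHom (α := M) 2).range with hR
  have hfin : Finite T :=
    Module.finite_of_fg_torsion T (Submodule.torsion_isTorsion (R := ℤ) (M := M))
  have hTmem : ∀ m : M, 2 • m ∈ T → m ∈ T := by
    intro m hm
    obtain ⟨c, hc⟩ := (Submodule.mem_torsion_iff _).mp hm
    refine (Submodule.mem_torsion_iff _).mpr ⟨c * ⟨2, by simp⟩, ?_⟩
    rw [mul_smul]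
    convert hc using 2
    exact ofNat_smul_eq_nsmul ℤ 2 m
  -- The chain `2M ≤ 2M + T ≤ M` separates the two factors: the upper index is computed in the
  -- torsion-free quotient `M / T`, the lower one inside the finite group `T`.
  have h1 : (R ⊔ T.toAddSubgroup).index = 2 ^ finrank ℤ M := by
    have : R ⊔ T.toAddSubgroup =
        (nsmulAddMonoidHom (α := M ⧸ T) 2).range.comap T.mkQ.toAddMonoidHom := by
      ext x
      simp only [AddSubgroup.mem_sup, AddSubgroup.mem_comap, AddMonoidHom.mem_range]
      constructor
      · rintro ⟨_, ⟨m, rfl⟩, t, ht, rfl⟩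
        refine ⟨T.mkQ m, ?_⟩
        have : T.mkQ t = 0 := by simpa using ht
        simp [nsmulAddMonoidHom] at this ⊢
        exact ht
      · rintro ⟨z, hz⟩
        obtain ⟨m, rfl⟩ := T.mkQ_surjective z
        refine ⟨2 • m, ⟨m, rfl⟩, x - 2 • m, ?_, by abel⟩
        have : T.mkQ (x - 2 • m) = 0 := by
          rw [map_sub, map_nsmul, sub_eq_zero]; exact hz.symm
        exact (Submodule.Quotient.mk_eq_zero T).mp this
    rw [this, AddSubgroup.index_comap_of_surjective _ T.mkQ_surjective, AddSubgroup.index_range_nsmul]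
    congr 1
    have h := T.finrank_quotient_add_finrank
    have h0 : finrank ℤ T = 0 := by
      rw [Module.finrank_eq_zero_iff_isTorsion]
      exact Submodule.torsion_isTorsion
    omega
  have h2 : R.relIndex T.toAddSubgroup = Nat.card (nsmulAddMonoidHom (α := M) 2).ker := by
    have h3 : R.addSubgroupOf T.toAddSubgroup =
        (nsmulAddMonoidHom (α := T.toAddSubgroup) 2).range := by
      ext ⟨x, hx⟩
      simp only [AddSubgroup.mem_addSubgroupOf, AddMonoidHom.mem_range, hR]
      constructor
      · rintro ⟨m, hm⟩
        refine ⟨⟨m, hTmem m ?_⟩, Subtype.ext hm⟩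
        have : 2 • m = x := hm
        rw [this]; exact hx
      · rintro ⟨⟨m, hm⟩, h⟩
        exact ⟨m, congrArg Subtype.val h⟩
    have : Finite T.toAddSubgroup := hfin
    rw [AddSubgroup.relIndex, h3, AddSubgroup.index_range]
    refine Nat.card_congr ⟨fun x => ⟨x.1.1, congrArg Subtype.val x.2⟩,
      fun x => ⟨⟨x.1, hTmem _ ?_⟩, Subtype.ext x.2⟩, fun x => rfl, fun x => rfl⟩
    have : 2 • x.1 = 0 := x.2
    rw [this]; exact T.zero_mem
  rw [← AddSubgroup.relIndex_mul_index (le_sup_left : R ≤ R ⊔ T.toAddSubgroup), h1,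
    sup_comm, AddSubgroup.relIndex_sup_right, h2, mul_comm]

theorem index_range_sq (G : Type*) [CommGroup G] [Module.Finite ℤ (Additive G)] :
    (powMonoidHom (α := G) 2).range.index =
      2 ^ finrank ℤ (Additive G) * Nat.card (powMonoidHom (α := G) 2).ker :=
  index_range_two_nsmul (Additive G)

end TwoRank

/-! ### Unit ranks and the order formula for the capitulation kernel. -/

section Rank

open Module

variable {A B : Type*} [CommRing A] [CommRing B] [Algebra A B]
  (S : B ≃ₐ[A] B)

/-- The map on units induced by the structure map of an algebra. -/
abbrev unitIncl (A B : Type*) [CommRing A] [CommRing B] [Algebra A B] : Aˣ →* Bˣ :=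
  Units.map (algebraMap A B : A →* B)

theorem ker_unitDiff (hinj : Function.Injective (algebraMap A B))
    (hfix : ∀ x, S x = x → ∃ y, algebraMap A B y = x) :
    (unitDiff S).ker = (unitIncl A B).range := by
  ext u
  rw [MonoidHom.mem_ker, invDiff_apply, div_eq_one]
  constructor
  · intro h
    have h1 : S (u : B) = u := (congrArg Units.val h).symm
    have h2 : S ((u⁻¹ : Bˣ) : B) = (u⁻¹ : Bˣ) := by
      have : (u⁻¹ : Bˣ) = Units.mapEquiv (S : B ≃* B) u⁻¹ := by rw [map_inv, ← h]
      exact (congrArg Units.val this).symm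
    obtain ⟨y, hy⟩ := hfix _ h1
    obtain ⟨y', hy'⟩ := hfix _ h2
    refine ⟨⟨y, y', hinj ?_, hinj ?_⟩, Units.ext hy⟩
    · rw [map_mul, hy, hy', map_one, Units.mul_inv]
    · rw [map_mul, hy, hy', map_one, Units.inv_mul]
  · rintro ⟨v, rfl⟩
    ext
    exact (S.commutes (v : A)).symm

theorem unitNorm_unitIncl (v : Aˣ) : unitNorm S (unitIncl A B v) = (unitIncl A B v) ^ 2 := by
  ext
  simp [unitNorm_apply, pow_two]

theorem range_unitNorm_le (hS : ∀ x, S (S x) = x) (hinj : Function.Injective (algebraMap A B))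
    (hfix : ∀ x, S x = x → ∃ y, algebraMap A B y = x) :
    (unitNorm S).range ≤ (unitIncl A B).range := by
  rw [← ker_unitDiff S hinj hfix]
  rintro _ ⟨u, rfl⟩
  rw [MonoidHom.mem_ker, invDiff_apply, div_eq_one]
  ext
  change (u : B) * S u = S (u * S u)
  rw [map_mul, hS, mul_comm]

theorem card_two_torsion_ker_unitNorm [IsDomain B] (h2 : (-1 : B) ≠ 1) :
    Nat.card (powMonoidHom (α := (unitNorm S).ker) 2).ker = 2 := by
  have hmem : (-1 : Bˣ) ∈ (unitNorm S).ker := by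
    rw [MonoidHom.mem_ker]; ext; simp [unitNorm_apply]
  rw [Nat.card_eq_two_iff]
  refine ⟨1, ⟨⟨-1, hmem⟩, by rw [MonoidHom.mem_ker]; ext; simp⟩, ?_, ?_⟩
  · intro h
    have : (1 : Bˣ) = -1 := congrArg (fun x => x.1.1) h
    exact h2 (congrArg Units.val this).symm
  · rw [Set.eq_univ_iff_forall]
    rintro ⟨⟨u, hu⟩, h⟩
    have h' : (u : B) ^ 2 = 1 := by
      have := congrArg (fun x => ((x.1 : Bˣ) : B)) (MonoidHom.mem_ker.mp h)
      simpa using this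
    rcases eq_or_eq_neg_of_sq_eq_sq (u : B) 1 (by rw [h', one_pow]) with h' | h'
    · left; ext; exact h'
    · right; ext; exact h'

/-- The image of the norm lies in the units of `A` and contains their squares, so it has the rank of
the units of `A`. Rank and nullity do the rest. -/
theorem finrank_ker_unitNorm [Module.Finite ℤ (Additive Aˣ)] [Module.Finite ℤ (Additive Bˣ)]
    (hS : ∀ x, S (S x) = x) (hinj : Function.Injective (algebraMap A B))
    (hfix : ∀ x, S x = x → ∃ y, algebraMap A B y = x) :
    finrank ℤ (Additive (unitNorm S).ker) + finrank ℤ (Additive Aˣ) = finrank ℤ (Additive Bˣ) := by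
  let N : Additive Bˣ →ₗ[ℤ] Additive Bˣ := (MonoidHom.toAdditive (unitNorm S)).toIntLinearMap
  let φ : Additive Aˣ →ₗ[ℤ] Additive Bˣ := (MonoidHom.toAdditive (unitIncl A B)).toIntLinearMap
  have hφ : Function.Injective φ := by
    intro x y h
    exact Units.map_injective (f := (algebraMap A B : A →* B)) hinj h
  have h1 : finrank ℤ (LinearMap.range N) = finrank ℤ (Additive Aˣ) := by
    apply le_antisymm
    · rw [← LinearMap.finrank_range_of_inj hφ]
      apply Submodule.finrank_mono
      rintro _ ⟨u, rfl⟩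
      obtain ⟨v, hv⟩ := range_unitNorm_le S hS hinj hfix ⟨u.toMul, rfl⟩
      exact ⟨Additive.ofMul v, hv⟩
    · have h3 := (LinearMap.ker (N ∘ₗ φ)).finrank_quotient_add_finrank
      have h4 : finrank ℤ (LinearMap.ker (N ∘ₗ φ)) = 0 := by
        rw [Module.finrank_eq_zero_iff_isTorsion]
        rintro ⟨x, hx⟩
        refine ⟨⟨2, by simp⟩, Subtype.ext (hφ ?_)⟩
        have : unitNorm S (unitIncl A B x.toMul) = 1 := hx
        rw [unitNorm_unitIncl] at this
        have h5 : (2 : ℤ) • φ x = 0 := by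
          have h6 : (2 : ℕ) • φ x = 0 := this
          rw [← h6]; exact ofNat_zsmul _ 2
        have h7 : φ ((2 : ℤ) • x) = φ 0 := by rw [map_zsmul, h5, map_zero]
        exact h7
      rw [← h3, h4, add_zero, (N ∘ₗ φ).quotKerEquivRange.finrank_eq]
      apply Submodule.finrank_mono
      exact LinearMap.range_comp_le_range φ N
  have h2 := (LinearMap.ker N).finrank_quotient_add_finrank
  rw [N.quotKerEquivRange.finrank_eq, h1] at h2
  rw [← h2, add_comm]
  congr 1

/-- The capitulation kernel times the index of squares in norms of units. -/
theorem card_capitulationKernel_mul {k K : Type*} [Field k] [Field K] [NumberField k]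
    [NumberField K] [Algebra k K] (S : 𝓞 K ≃ₐ[𝓞 k] 𝓞 K) (hS : ∀ x, S (S x) = x)
    (hfix : ∀ x, S x = x → ∃ y, algebraMap (𝓞 k) (𝓞 K) y = x)
    (hunr : Ideal.span (Set.range fun b : 𝓞 K => b - S b) = ⊤) :
    Nat.card (capitulationKernel k K) *
      ((unitIncl (𝓞 k) (𝓞 K)).range.map (powMonoidHom 2)).relIndex (unitNorm S).range =
      2 ^ (NumberField.Units.rank K - NumberField.Units.rank k + 1) := by
  have hinj : Function.Injective (algebraMap (𝓞 k) (𝓞 K)) :=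
    FaithfulSMul.algebraMap_injective _ _
  have h1 := relIndex_invDiff_mul (Units.mapEquiv (S : 𝓞 K ≃* 𝓞 K))
    (fun x => Units.ext (hS (x : 𝓞 K)))
  rw [ker_unitDiff S hinj hfix, ← card_ker_extendedHom S hS hfix hunr] at h1
  rw [capitulationKernel, h1]
  have : Module.Finite ℤ (Additive (unitNorm S).ker) :=
    Module.Finite.of_injective
      (MonoidHom.toAdditive (unitNorm S).ker.subtype).toIntLinearMap Subtype.val_injective
  have h2 := index_range_sq (unitNorm S).ker
  -- The summand 1 in the exponent is the contribution of the torsion `±1` of `ker N`.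
  rw [card_two_torsion_ker_unitNorm S (by norm_num), ← pow_succ] at h2
  have h3 := finrank_ker_unitNorm S hS hinj hfix
  rw [NumberField.Units.finrank_eq, NumberField.Units.finrank_eq] at h3
  rw [← h3, Nat.add_sub_cancel, ← h2, Subgroup.relIndex]
  congr 1
  ext ⟨x, hx⟩
  rw [Subgroup.mem_subgroupOf]
  constructor
  · rintro ⟨g, hg, h⟩
    exact ⟨⟨g, hg⟩, Subtype.ext h⟩
  · rintro ⟨⟨g, hg⟩, h⟩
    exact ⟨g, hg, congrArg Subtype.val h⟩

end Rank

/-! ### Triquadratic fields and their sign automorphisms. -/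

/-- `K = ℚ(I, a, b)` is a triquadratic field, with `I² = -1`, `a² = m`, `b² = n`. -/
structure IsTriquadratic (K : Type*) [Field K] [NumberField K] (m n : ℕ) (I a b : K) : Prop where
  I_sq : I ^ 2 = -1
  a_sq : a ^ 2 = m
  b_sq : b ^ 2 = n
  m_pos : 0 < m
  n_pos : 0 < n
  gen : IntermediateField.adjoin ℚ {I, a, b} = ⊤
  finrank_eq : Module.finrank ℚ K = 8

theorem apply_eq_or {F L : Type*} [Field F] [Field L] (f : F →+* L) {z : F} {w : L}
    (h : f (z ^ 2) = w ^ 2) : f z = w ∨ f z = -w := by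
  rw [map_pow] at h
  exact sq_eq_sq_iff_eq_or_eq_neg.mp h

/-- The automorphisms of `ℚ(I, a, b)` changing exactly one of the three signs. -/
structure Signs (K : Type*) [Field K] [CharZero K] (I a b : K) where
  s₁ : K ≃ₐ[ℚ] K
  s₂ : K ≃ₐ[ℚ] K
  s₃ : K ≃ₐ[ℚ] K
  s₁I : s₁ I = -I
  s₁a : s₁ a = a
  s₁b : s₁ b = b
  s₂I : s₂ I = I
  s₂a : s₂ a = -a
  s₂b : s₂ b = b
  s₃I : s₃ I = I
  s₃a : s₃ a = a
  s₃b : s₃ b = -b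
  s₁s₁ : ∀ x, s₁ (s₁ x) = x
  s₂s₂ : ∀ x, s₂ (s₂ x) = x
  s₃s₃ : ∀ x, s₃ (s₃ x) = x
  s₂s₁ : ∀ x, s₂ (s₁ x) = s₁ (s₂ x)
  s₃s₁ : ∀ x, s₃ (s₁ x) = s₁ (s₃ x)
  s₃s₂ : ∀ x, s₃ (s₂ x) = s₂ (s₃ x)
  rational : ∀ x, s₁ x = x → s₂ x = x → s₃ x = x → ∃ r : ℚ, x = r

namespace IsTriquadratic

variable {K : Type*} [Field K] [NumberField K] {m n : ℕ} {I a b : K}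

theorem ringHom_ext (h : IsTriquadratic K m n I a b) {L : Type*} [Field L] {f g : K →+* L}
    (hI : f I = g I) (ha : f a = g a) (hb : f b = g b) : f = g := by
  ext x
  have hx : x ∈ IntermediateField.adjoin ℚ {I, a, b} := by rw [h.gen]; trivial
  induction hx using IntermediateField.adjoin_induction with
  | mem x hx =>
    rcases hx with rfl | rfl | rfl
    · exact hI
    · exact ha
    · exact hb
  | algebraMap r => simp
  | add x y _ _ hx hy => rw [map_add, map_add, hx, hy]
  | inv x _ hx => rw [map_inv₀, map_inv₀, hx]
  | mul x y _ _ hx hy => rw [map_mul, map_mul, hx, hy]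

theorem algEquiv_ext (h : IsTriquadratic K m n I a b) {f g : K ≃ₐ[ℚ] K}
    (hI : f I = g I) (ha : f a = g a) (hb : f b = g b) : f = g := by
  have := h.ringHom_ext (f := (f : K →+* K)) (g := (g : K →+* K)) hI ha hb
  ext x
  exact congrArg (fun φ : K →+* K => φ x) this

theorem I_ne (h : IsTriquadratic K m n I a b) : I ≠ 0 := by
  rintro rfl
  have := h.I_sq
  norm_num at this

theorem a_ne (h : IsTriquadratic K m n I a b) : a ≠ 0 := by
  rintro rfl
  have := h.a_sq
  have h2 := h.m_pos
  rw [zero_pow two_ne_zero] at this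
  have : (m : K) ≠ 0 := by exact_mod_cast h2.ne'
  simp_all

theorem b_ne (h : IsTriquadratic K m n I a b) : b ≠ 0 := by
  rintro rfl
  have := h.b_sq
  have h2 := h.n_pos
  rw [zero_pow two_ne_zero] at this
  have : (n : K) ≠ 0 := by exact_mod_cast h2.ne'
  simp_all

theorem splits_minpoly_of_sq {z : K} {c : ℚ} (hz : z ^ 2 = algebraMap ℚ K c) :
    ((minpoly ℚ z).map (algebraMap ℚ K)).Splits := by
  have hdvd : minpoly ℚ z ∣ Polynomial.X ^ 2 - Polynomial.C c :=
    minpoly.dvd _ _ (by simp [hz])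
  have hp : (Polynomial.X ^ 2 - Polynomial.C c : Polynomial ℚ).map (algebraMap ℚ K) =
      (Polynomial.X - Polynomial.C z) * (Polynomial.X - Polynomial.C (-z)) := by
    simp only [Polynomial.map_sub, Polynomial.map_pow, Polynomial.map_X, Polynomial.map_C, ← hz,
      map_neg, map_pow]
    ring
  refine Polynomial.Splits.of_dvd (g := (Polynomial.X ^ 2 - Polynomial.C c).map (algebraMap ℚ K))
    ?_ ?_ (Polynomial.map_dvd _ hdvd)
  · rw [hp]
    exact (Polynomial.Splits.X_sub_C z).mul (Polynomial.Splits.X_sub_C (-z))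
  · rw [hp]
    exact mul_ne_zero (Polynomial.X_sub_C_ne_zero _) (Polynomial.X_sub_C_ne_zero _)

theorem isGalois (h : IsTriquadratic K m n I a b) : IsGalois ℚ K := by
  have : Normal ℚ K :=
    { splits' := fun x => by
        refine IntermediateField.splits_of_mem_adjoin ℚ K (S := {I, a, b}) ?_
          (by rw [h.gen]; trivial)
        intro y hy
        refine ⟨Algebra.IsIntegral.isIntegral y, ?_⟩
        rcases hy with rfl | rfl | rfl
        · exact splits_minpoly_of_sq (c := -1) (by simp [h.I_sq])
        · exact splits_minpoly_of_sq (c := m) (by simp [h.a_sq])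
        · exact splits_minpoly_of_sq (c := n) (by simp [h.b_sq]) }
  exact ⟨⟩

theorem aut_I (h : IsTriquadratic K m n I a b) (g : K ≃ₐ[ℚ] K) : g I = I ∨ g I = -I :=
  apply_eq_or (g : K →+* K) (by simp [h.I_sq])

theorem aut_a (h : IsTriquadratic K m n I a b) (g : K ≃ₐ[ℚ] K) : g a = a ∨ g a = -a :=
  apply_eq_or (g : K →+* K) (by simp [h.a_sq])

theorem aut_b (h : IsTriquadratic K m n I a b) (g : K ≃ₐ[ℚ] K) : g b = b ∨ g b = -b :=
  apply_eq_or (g : K →+* K) (by simp [h.b_sq])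

-- An automorphism is determined by its three signs. There are eight automorphisms because the
-- Galois degree is 8, so every sign pattern occurs.
open Classical in
theorem exists_aut (h : IsTriquadratic K m n I a b) (p : Bool × Bool × Bool) :
    ∃ g : K ≃ₐ[ℚ] K, g I = (if p.1 then I else -I) ∧ g a = (if p.2.1 then a else -a) ∧
      g b = (if p.2.2 then b else -b) := by
  have := h.isGalois
  let f : (K ≃ₐ[ℚ] K) → Bool × Bool × Bool := fun g =>
    (decide (g I = I), decide (g a = a), decide (g b = b))
  have hI : ∀ g : K ≃ₐ[ℚ] K, g I = if (f g).1 then I else -I := fun g => by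
    by_cases hg : g I = I
    · simp [f, hg]
    · simpa [f, hg] using (h.aut_I g).resolve_left hg
  have ha : ∀ g : K ≃ₐ[ℚ] K, g a = if (f g).2.1 then a else -a := fun g => by
    by_cases hg : g a = a
    · simp [f, hg]
    · simpa [f, hg] using (h.aut_a g).resolve_left hg
  have hb : ∀ g : K ≃ₐ[ℚ] K, g b = if (f g).2.2 then b else -b := fun g => by
    by_cases hg : g b = b
    · simp [f, hg]
    · simpa [f, hg] using (h.aut_b g).resolve_left hg
  have hinj : Function.Injective f := by
    intro g g' hgg
    apply h.algEquiv_ext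
    · rw [hI g, hI g', hgg]
    · rw [ha g, ha g', hgg]
    · rw [hb g, hb g', hgg]
  have hcard : Nat.card (K ≃ₐ[ℚ] K) = Nat.card (Bool × Bool × Bool) := by
    rw [IsGalois.card_aut_eq_finrank, h.finrank_eq]; simp
  obtain ⟨g, rfl⟩ := ((Nat.bijective_iff_injective_and_card f).mpr ⟨hinj, hcard⟩).2 p
  exact ⟨g, hI g, ha g, hb g⟩

open Classical in
/-- The sign changes exist. -/
theorem nonempty_signs (h : IsTriquadratic K m n I a b) : Nonempty (Signs K I a b) := by
  obtain ⟨s₁, h1⟩ := h.exists_aut (false, true, true)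
  obtain ⟨s₂, h2⟩ := h.exists_aut (true, false, true)
  obtain ⟨s₃, h3⟩ := h.exists_aut (true, true, false)
  simp only [if_true, Bool.false_eq_true, if_false] at h1 h2 h3
  obtain ⟨s₁I, s₁a, s₁b⟩ := h1
  obtain ⟨s₂I, s₂a, s₂b⟩ := h2
  obtain ⟨s₃I, s₃a, s₃b⟩ := h3
  have hmul : ∀ {f g : K ≃ₐ[ℚ] K}, f = g → ∀ x, f x = g x := by rintro f g rfl x; rfl
  refine ⟨⟨s₁, s₂, s₃, s₁I, s₁a, s₁b, s₂I, s₂a, s₂b, s₃I, s₃a, s₃b,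
    hmul (f := s₁ * s₁) (g := 1) (h.algEquiv_ext ?_ ?_ ?_),
    hmul (f := s₂ * s₂) (g := 1) (h.algEquiv_ext ?_ ?_ ?_),
    hmul (f := s₃ * s₃) (g := 1) (h.algEquiv_ext ?_ ?_ ?_),
    hmul (f := s₂ * s₁) (g := s₁ * s₂) (h.algEquiv_ext ?_ ?_ ?_),
    hmul (f := s₃ * s₁) (g := s₁ * s₃) (h.algEquiv_ext ?_ ?_ ?_),
    hmul (f := s₃ * s₂) (g := s₂ * s₃) (h.algEquiv_ext ?_ ?_ ?_), fun x hx1 hx2 hx3 => ?_⟩⟩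
  all_goals try simp [s₁I, s₁a, s₁b, s₂I, s₂a, s₂b, s₃I, s₃a, s₃b]
  have := h.isGalois
  have hx : x ∈ (⊥ : IntermediateField ℚ K) := by
    rw [IsGalois.mem_bot_iff_fixed]
    intro g
    -- The three sign changes generate the Galois group, so being fixed by them already means being
    -- rational.
    have key : ∃ t₁ ∈ ({1, s₁} : Set (K ≃ₐ[ℚ] K)), ∃ t₂ ∈ ({1, s₂} : Set (K ≃ₐ[ℚ] K)),
        ∃ t₃ ∈ ({1, s₃} : Set (K ≃ₐ[ℚ] K)), g = t₁ * t₂ * t₃ := by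
      refine ⟨if g I = I then 1 else s₁, ?_, if g a = a then 1 else s₂, ?_,
        if g b = b then 1 else s₃, ?_, ?_⟩
      · split_ifs <;> simp
      · split_ifs <;> simp
      · split_ifs <;> simp
      · have hI := h.aut_I g
        have ha := h.aut_a g
        have hb := h.aut_b g
        apply h.algEquiv_ext <;> split_ifs <;> simp_all
    obtain ⟨t₁, ht1, t₂, ht2, t₃, ht3, rfl⟩ := key
    have e1 : t₁ x = x := by rcases ht1 with rfl | rfl <;> simp [hx1]
    have e2 : t₂ x = x := by rcases ht2 with rfl | rfl <;> simp [hx2]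
    have e3 : t₃ x = x := by rcases ht3 with rfl | rfl <;> simp [hx3]
    rw [AlgEquiv.mul_apply, AlgEquiv.mul_apply, e3, e2, e1]
  obtain ⟨r, hr⟩ := IntermediateField.mem_bot.mp hx
  exact ⟨r, by rw [← hr]; simp⟩

end IsTriquadratic

/-! ### Algebraic units in arbitrary fields, and coordinates of quadratic units. -/

/-- `x` is a unit of the ring of algebraic integers of the field `F`. -/
structure IsAlgUnit {F : Type*} [Field F] (x : F) : Prop where
  ne_zero : x ≠ 0
  isIntegral : IsIntegral ℤ x
  isIntegral_inv : IsIntegral ℤ x⁻¹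

namespace IsAlgUnit

variable {F L : Type*} [Field F] [Field L] {x y : F}

theorem one : IsAlgUnit (1 : F) := ⟨one_ne_zero, isIntegral_one, by simpa using isIntegral_one⟩

theorem neg (hx : IsAlgUnit x) : IsAlgUnit (-x) :=
  ⟨neg_ne_zero.mpr hx.1, hx.2.neg, by rw [inv_neg]; exact hx.3.neg⟩

theorem mul (hx : IsAlgUnit x) (hy : IsAlgUnit y) : IsAlgUnit (x * y) :=
  ⟨mul_ne_zero hx.1 hy.1, hx.2.mul hy.2, by rw [mul_inv]; exact hx.3.mul hy.3⟩

theorem inv (hx : IsAlgUnit x) : IsAlgUnit x⁻¹ :=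
  ⟨inv_ne_zero hx.1, hx.3, by rw [inv_inv]; exact hx.2⟩

theorem div (hx : IsAlgUnit x) (hy : IsAlgUnit y) : IsAlgUnit (x / y) := by
  rw [div_eq_mul_inv]; exact hx.mul hy.inv

theorem pow (hx : IsAlgUnit x) (n : ℕ) : IsAlgUnit (x ^ n) :=
  ⟨pow_ne_zero n hx.1, hx.2.pow n, by rw [← inv_pow]; exact hx.3.pow n⟩

theorem zpow (hx : IsAlgUnit x) (n : ℤ) : IsAlgUnit (x ^ n) := by
  cases n with
  | ofNat n => simpa using hx.pow n
  | negSucc n => rw [zpow_negSucc]; exact (hx.pow _).inv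

theorem map (f : F →+* L) (hx : IsAlgUnit x) : IsAlgUnit (f x) :=
  ⟨(map_ne_zero f).mpr hx.1, map_isIntegral_int f hx.2, by
    rw [← map_inv₀]; exact map_isIntegral_int f hx.3⟩

theorem of_map (f : F →+* L) (hx : IsAlgUnit (f x)) : IsAlgUnit x := by
  have key : ∀ y : F, IsIntegral ℤ (f y) → IsIntegral ℤ y := by
    rintro y ⟨p, hp, hpy⟩
    refine ⟨p, hp, f.injective ?_⟩
    rw [map_zero, ← hpy, Polynomial.hom_eval₂]
    congr 1
    exact RingHom.ext_int _ _
  exact ⟨(map_ne_zero f).mp hx.1, key _ hx.2, key _ (by rw [map_inv₀]; exact hx.3)⟩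

theorem of_sq (hx : IsAlgUnit (x ^ 2)) : IsAlgUnit x :=
  ⟨fun h => hx.1 (by rw [h]; simp), IsIntegral.of_pow two_pos hx.2,
    IsIntegral.of_pow two_pos (by rw [inv_pow]; exact hx.3)⟩

theorem of_quadratic {X N : ℤ} (h : x ^ 2 - X * x + N = 0) (hN : N = 1 ∨ N = -1) :
    IsAlgUnit x := by
  have h_int : ∀ (y : F) (X N : ℤ), y ^ 2 - X * y + N = 0 → IsIntegral ℤ y := by
    intro y X N h
    refine ⟨Polynomial.X ^ 2 - Polynomial.C X * Polynomial.X + Polynomial.C N, ?_, ?_⟩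
    · monicity!
    · rw [Polynomial.eval₂_add, Polynomial.eval₂_sub, Polynomial.eval₂_mul, Polynomial.eval₂_pow,
        Polynomial.eval₂_X, Polynomial.eval₂_C, Polynomial.eval₂_C]
      simpa using h
  have hx0 : x ≠ 0 := by
    rintro rfl
    rcases hN with rfl | rfl <;> simp at h
  refine ⟨hx0, h_int x X N h, ?_⟩
  rcases hN with rfl | rfl
  · refine h_int _ X 1 ?_
    field_simp
    push_cast at h ⊢
    linear_combination h
  · refine h_int _ (-X) (-1) ?_
    field_simp
    push_cast at h ⊢
    linear_combination -h

theorem unit_coe {K : Type*} [Field K] [NumberField K] (u : (𝓞 K)ˣ) :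
    IsAlgUnit ((u : 𝓞 K) : K) := by
  refine ⟨?_, (u : 𝓞 K).isIntegral_coe, ?_⟩
  · exact (NumberField.RingOfIntegers.coe_ne_zero_iff).mpr u.ne_zero
  · have : (((u : 𝓞 K) : K))⁻¹ = ((u⁻¹ : (𝓞 K)ˣ) : 𝓞 K) := by
      apply inv_eq_of_mul_eq_one_right
      rw [← map_mul, Units.mul_inv, map_one]
    rw [this]
    exact NumberField.RingOfIntegers.isIntegral_coe _

theorem exists_unit {K : Type*} [Field K] [NumberField K] {x : K} (hx : IsAlgUnit x) :
    ∃ u : (𝓞 K)ˣ, ((u : 𝓞 K) : K) = x := by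
  refine ⟨⟨⟨x, hx.2⟩, ⟨x⁻¹, hx.3⟩, ?_, ?_⟩, rfl⟩
  · apply NumberField.RingOfIntegers.ext
    exact mul_inv_cancel₀ hx.1
  · apply NumberField.RingOfIntegers.ext
    exact inv_mul_cancel₀ hx.1

theorem rat_int [CharZero F] {r : ℚ} (h : IsIntegral ℤ (r : F)) : ∃ X : ℤ, r = X := by
  have h' : IsIntegral ℤ (algebraMap ℚ F r) := by simpa using h
  rw [isIntegral_algebraMap_iff (algebraMap ℚ F).injective] at h'
  obtain ⟨X, hX⟩ := IsIntegrallyClosed.isIntegral_iff.mp h'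
  exact ⟨X, by simpa using hX.symm⟩

theorem rat [CharZero F] {r : ℚ} (h : IsAlgUnit (r : F)) : r = 1 ∨ r = -1 := by
  obtain ⟨X, hX⟩ := rat_int h.2
  obtain ⟨Y, hY⟩ := rat_int (F := F) (r := r⁻¹) (by push_cast; exact h.3)
  have hr : r ≠ 0 := by
    rintro rfl
    exact h.1 (by simp)
  have hXY : X * Y = 1 := by
    have : (X : ℚ) * Y = 1 := by rw [← hX, ← hY, mul_inv_cancel₀ hr]
    exact_mod_cast this
  rcases Int.eq_one_or_neg_one_of_mul_eq_one hXY with h1 | h1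
  · left; rw [hX, h1]; simp
  · right; rw [hX, h1]; simp

end IsAlgUnit

/-- `r + t√c` is a unit of norm `1` or `-1`, in terms of trace and norm. -/
def UnitCoords (c : ℕ) (r t : ℚ) : Prop :=
  (∃ X : ℤ, 2 * r = X) ∧ (r ^ 2 - c * t ^ 2 = 1 ∨ r ^ 2 - c * t ^ 2 = -1)

theorem UnitCoords.of_conj {F : Type*} [Field F] [CharZero F] {c : ℕ} {r t : ℚ} {z : F}
    (hz : z ^ 2 = c) (h : IsAlgUnit (r + t * z)) (h' : IsAlgUnit (r - t * z)) :
    UnitCoords c r t := by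
  constructor
  · apply IsAlgUnit.rat_int (F := F)
    have e : ((2 * r : ℚ) : F) = (r + t * z) + (r - t * z) := by push_cast; ring
    rw [e]
    exact h.2.add h'.2
  · apply IsAlgUnit.rat (F := F)
    have e : ((r ^ 2 - c * t ^ 2 : ℚ) : F) = (r + t * z) * (r - t * z) := by
      push_cast
      linear_combination (t : F) ^ 2 * hz
    rw [e]
    exact h.mul h'

theorem UnitCoords.isAlgUnit {F : Type*} [Field F] [CharZero F] {c : ℕ} {r t : ℚ} {z : F}
    (hz : z ^ 2 = c) (h : UnitCoords c r t) : IsAlgUnit (r + t * z) := by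
  obtain ⟨⟨X, hX⟩, hN⟩ := h
  have hXF : 2 * (r : F) = X := by exact_mod_cast congrArg (fun q : ℚ => (q : F)) hX
  rcases hN with hN | hN
  · have hNF : (r : F) ^ 2 - c * t ^ 2 = 1 := by
      exact_mod_cast congrArg (fun q : ℚ => (q : F)) hN
    refine IsAlgUnit.of_quadratic (X := X) (N := 1) ?_ (Or.inl rfl)
    rw [← hXF]; push_cast
    linear_combination t ^ 2 * hz - hNF
  · have hNF : (r : F) ^ 2 - c * t ^ 2 = -1 := by
      exact_mod_cast congrArg (fun q : ℚ => (q : F)) hN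
    refine IsAlgUnit.of_quadratic (X := X) (N := -1) ?_ (Or.inr rfl)
    rw [← hXF]; push_cast
    linear_combination t ^ 2 * hz - hNF

/-- The square of the denominator of `T` is prime to the numerator, hence divides `c`. -/
theorem exists_int_of_squarefree {c : ℕ} (hc : Squarefree c) {T : ℚ} {Z : ℤ}
    (h : (c : ℚ) * T ^ 2 = Z) : ∃ Y : ℤ, T = Y := by
  have h1 : (c : ℤ) * T.num ^ 2 = Z * (T.den : ℤ) ^ 2 := by
    have hd : (T.den : ℚ) ≠ 0 := by exact_mod_cast T.den_ne_zero
    have : (c : ℚ) * T.num ^ 2 = Z * (T.den : ℚ) ^ 2 := by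
      rw [← h]
      have h2 : T * T.den = T.num := Rat.mul_den_eq_num T
      rw [← h2]; ring
    exact_mod_cast this
  have hcop : IsCoprime ((T.den : ℤ) ^ 2) (T.num ^ 2) := by
    have := T.reduced
    exact (Int.isCoprime_iff_gcd_eq_one.mpr (by rw [Int.gcd_comm]; exact this)).pow
  have hdvd : (T.den : ℤ) ^ 2 ∣ c := by
    apply hcop.dvd_of_dvd_mul_right
    rw [h1]; exact dvd_mul_left _ _
  have hdvd' : T.den * T.den ∣ c := by
    have : ((T.den * T.den : ℕ) : ℤ) ∣ c := by push_cast; rw [← pow_two]; exact hdvd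
    exact_mod_cast this
  have h1 := Nat.isUnit_iff.mp (hc _ hdvd')
  exact ⟨T.num, (Rat.den_eq_one_iff T).mp h1 |>.symm⟩

theorem UnitCoords.norm_eq_one {c : ℕ} (hc : Squarefree c) (hc4 : c % 4 = 3) {r t : ℚ}
    (h : UnitCoords c r t) : r ^ 2 - c * t ^ 2 = 1 := by
  obtain ⟨⟨X, hX⟩, hN | hN⟩ := h
  · exact hN
  · exfalso
    have h1 : (c : ℚ) * (2 * t) ^ 2 = ((X ^ 2 + 4 : ℤ) : ℚ) := by
      push_cast
      rw [← hX]
      linear_combination (-4) * hN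
    obtain ⟨Y, hY⟩ := exists_int_of_squarefree hc h1
    rw [hY] at h1
    have h2 : (c : ℤ) * Y ^ 2 = X ^ 2 + 4 := by exact_mod_cast h1
    -- Modulus 4 would not suffice: when `X` and `Y` are even, the contradiction modulo 4 appears
    -- only after division by 4.
    have key : ∀ c X Y : ZMod 16, (c = 3 ∨ c = 7 ∨ c = 11 ∨ c = 15) → c * Y ^ 2 ≠ X ^ 2 + 4 := by
      decide
    refine key (c : ZMod 16) X Y ?_ ?_
    · have h16 : c % 16 = 3 ∨ c % 16 = 7 ∨ c % 16 = 11 ∨ c % 16 = 15 := by omega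
      rw [← ZMod.natCast_mod c 16]
      rcases h16 with h | h | h | h <;> rw [h] <;> decide
    · have := congrArg (fun z : ℤ => (z : ZMod 16)) h2
      push_cast at this
      exact this

/-! ### Rational squares, roots of unity and units in a triquadratic field. -/

section Decomposition

variable {K : Type*} [Field K] [NumberField K] {m n : ℕ} {I a b : K}

/-- Here `f` plays the conjugation of `ℚ(c)`: both `x + f x` and `(x - f x) / c` are fixed by all
sign changes, hence rational. -/
theorem Signs.exists_coords (s : Signs K I a b) {c x : K} (hc : c ≠ 0) (f : K ≃ₐ[ℚ] K)
    (hf : ∀ x, f (f x) = x)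
    (h₁ : s.s₁ c = c) (hx₁ : s.s₁ x = x)
    (h₂ : (s.s₂ c = c ∧ s.s₂ x = x) ∨ (s.s₂ c = -c ∧ s.s₂ x = f x))
    (h₃ : (s.s₃ c = c ∧ s.s₃ x = x) ∨ (s.s₃ c = -c ∧ s.s₃ x = f x))
    (hf1 : ∀ x, f (s.s₁ x) = s.s₁ (f x)) (hf2 : ∀ x, f (s.s₂ x) = s.s₂ (f x))
    (hf3 : ∀ x, f (s.s₃ x) = s.s₃ (f x)) :
    ∃ r t : ℚ, x = r + t * c := by
  have key : ∀ g : K ≃ₐ[ℚ] K, ((g c = c ∧ g x = x) ∨ (g c = -c ∧ g x = f x)) →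
      (∀ x, f (g x) = g (f x)) →
      g (x + f x) = x + f x ∧ g ((x - f x) / c) = (x - f x) / c := by
    intro g hg hfg
    rcases hg with ⟨hgc, hgx⟩ | ⟨hgc, hgx⟩
    · have : g (f x) = f x := by rw [← hfg, hgx]
      simp [hgx, this, hgc]
    · have : g (f x) = x := by rw [← hfg, hgx, hf]
      simp only [map_add, map_div₀, map_sub, hgx, this, hgc]
      constructor
      · ring
      · field_simp; ring
  obtain ⟨a2, b2⟩ := key s.s₂ h₂ hf2
  obtain ⟨a3, b3⟩ := key s.s₃ h₃ hf3
  obtain ⟨a1, b1⟩ := key s.s₁ (Or.inl ⟨h₁, hx₁⟩) hf1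
  obtain ⟨r, hr⟩ := s.rational _ a1 a2 a3
  obtain ⟨t, ht⟩ := s.rational _ b1 b2 b3
  refine ⟨r / 2, t / 2, ?_⟩
  push_cast
  rw [← hr, ← ht]
  field_simp
  ring

theorem exists_coords_a (h : IsTriquadratic K m n I a b) (s : Signs K I a b) {x : K}
    (h₁ : s.s₁ x = x) (h₃ : s.s₃ x = x) : ∃ r t : ℚ, x = r + t * a :=
  s.exists_coords h.a_ne s.s₂ s.s₂s₂ s.s₁a h₁ (Or.inr ⟨s.s₂a, rfl⟩) (Or.inl ⟨s.s₃a, h₃⟩)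
    s.s₂s₁ (fun _ => rfl) (fun x => (s.s₃s₂ x).symm)

theorem exists_coords_b (h : IsTriquadratic K m n I a b) (s : Signs K I a b) {x : K}
    (h₁ : s.s₁ x = x) (h₂ : s.s₂ x = x) : ∃ r t : ℚ, x = r + t * b :=
  s.exists_coords h.b_ne s.s₃ s.s₃s₃ s.s₁b h₁ (Or.inl ⟨s.s₂b, h₂⟩) (Or.inr ⟨s.s₃b, rfl⟩)
    s.s₃s₁ s.s₃s₂ (fun _ => rfl)

theorem exists_coords_ab (h : IsTriquadratic K m n I a b) (s : Signs K I a b) {x : K}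
    (h₁ : s.s₁ x = x) (h₂₃ : s.s₂ (s.s₃ x) = x) : ∃ r t : ℚ, x = r + t * (a * b) := by
  have e2 : s.s₂ (a * b) = -(a * b) := by rw [map_mul, s.s₂a, s.s₂b]; ring
  have e3 : s.s₃ (a * b) = -(a * b) := by rw [map_mul, s.s₃a, s.s₃b]; ring
  refine s.exists_coords (mul_ne_zero h.a_ne h.b_ne) s.s₂ s.s₂s₂ (by rw [map_mul, s.s₁a, s.s₁b])
    h₁ (Or.inr ⟨e2, rfl⟩) (Or.inr ⟨e3, ?_⟩) s.s₂s₁ (fun _ => rfl) (fun x => (s.s₃s₂ x).symm)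
  have := congrArg s.s₂ h₂₃
  rwa [s.s₂s₂] at this

/-- A positive rational which is a square in `K` is a rational square up to `m` and `n`. -/
theorem rat_sq (h : IsTriquadratic K m n I a b) (s : Signs K I a b)
    {r : ℚ} (hr : 0 < r) {z : K} (hz : z ^ 2 = r) :
    (IsSquare r ∨ IsSquare (r * (m * n : ℕ))) ∨
      (s.s₂ (s.s₃ z) = -z ∧ (IsSquare (r * m) ∨ IsSquare (r * n))) := by
  have hsg : ∀ g : K ≃ₐ[ℚ] K, g z = z ∨ g z = -z := fun g =>
    apply_eq_or (g : K →+* K) (by simp [hz])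
  -- Choose `g` among the products of `I`, `a`, `b` with the signs of `z`, so that `z * g` is
  -- rational. A factor `I` in `g` would make its square negative.
  have hrat : ∀ g : K, s.s₁ (z * g) = z * g → s.s₂ (z * g) = z * g → s.s₃ (z * g) = z * g →
      ∀ j : ℚ, 0 < j → (g ^ 2 = j ∨ g ^ 2 = -j) → IsSquare (r * j) := by
    intro g g1 g2 g3 j hj hg
    obtain ⟨y, hy⟩ := s.rational _ g1 g2 g3
    rcases hg with hg | hg
    · refine ⟨y, ?_⟩
      have : ((r * j : ℚ) : K) = ((y * y : ℚ) : K) := by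
        push_cast
        rw [← hy, ← hz, ← hg]; ring
      exact_mod_cast this
    · exfalso
      have : ((r * j : ℚ) : K) = ((-(y * y) : ℚ) : K) := by
        push_cast
        rw [← hy, ← hz]
        have : (j : K) = -g ^ 2 := by rw [hg, neg_neg]
        rw [this]; ring
      have h2 : r * j = -(y * y) := by exact_mod_cast this
      nlinarith [mul_pos hr hj, mul_self_nonneg y]
  have hm : (0 : ℚ) < m := by exact_mod_cast h.m_pos
  have hn : (0 : ℚ) < n := by exact_mod_cast h.n_pos
  have hI := h.I_sq
  have ha := h.a_sq
  have hb := h.b_sq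
  rcases hsg s.s₂ with h2 | h2 <;> rcases hsg s.s₃ with h3 | h3
  · left; left
    rw [← mul_one r]
    rcases hsg s.s₁ with h1 | h1
    · exact hrat 1 (by simp [h1]) (by simp [h2]) (by simp [h3]) 1 one_pos (Or.inl (by simp))
    · exact hrat I (by simp [h1, s.s₁I]) (by simp [h2, s.s₂I]) (by simp [h3, s.s₃I]) 1 one_pos
        (Or.inr (by simp [hI]))
  · right
    refine ⟨by rw [h3, map_neg, h2], Or.inr ?_⟩
    rcases hsg s.s₁ with h1 | h1
    · exact hrat b (by simp [h1, s.s₁b]) (by simp [h2, s.s₂b]) (by simp [h3, s.s₃b]) n hn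
        (Or.inl (by simp [hb]))
    · exact hrat (I * b) (by simp [h1, s.s₁I, s.s₁b]) (by simp [h2, s.s₂I, s.s₂b])
        (by simp [h3, s.s₃I, s.s₃b]) n hn (Or.inr (by simp [mul_pow, hI, hb]))
  · right
    refine ⟨by rw [h3, h2], Or.inl ?_⟩
    rcases hsg s.s₁ with h1 | h1
    · exact hrat a (by simp [h1, s.s₁a]) (by simp [h2, s.s₂a]) (by simp [h3, s.s₃a]) m hm
        (Or.inl (by simp [ha]))
    · exact hrat (I * a) (by simp [h1, s.s₁I, s.s₁a]) (by simp [h2, s.s₂I, s.s₂a])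
        (by simp [h3, s.s₃I, s.s₃a]) m hm (Or.inr (by simp [mul_pow, hI, ha]))
  · left; right
    push_cast
    rcases hsg s.s₁ with h1 | h1
    · exact hrat (a * b) (by simp [h1, s.s₁a, s.s₁b]) (by simp [h2, s.s₂a, s.s₂b])
        (by simp [h3, s.s₃a, s.s₃b]) (m * n) (mul_pos hm hn) (Or.inl (by simp [mul_pow, ha, hb]))
    · exact hrat (I * (a * b)) (by simp [h1, s.s₁I, s.s₁a, s.s₁b])
        (by simp [h2, s.s₂I, s.s₂a, s.s₂b])
        (by simp [h3, s.s₃I, s.s₃a, s.s₃b]) (m * n) (mul_pos hm hn)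
        (Or.inr (by simp [mul_pow, hI, ha, hb]))

/-- With `m` and `n` odd, none of `2`, `2m`, `2n`, `2mn` is a square. This keeps primitive eighth
roots of unity out of `K`, and prevents `I` from being a square. -/
theorem two_ne_sq (h : IsTriquadratic K m n I a b) (hm : m % 2 = 1) (hn : n % 2 = 1)
    (z : K) : z ^ 2 ≠ 2 := by
  obtain ⟨s⟩ := h.nonempty_signs
  intro hz
  have hodd : ∀ c : ℕ, c % 2 = 1 → ¬ IsSquare ((2 : ℚ) * c) := by
    rintro c hc hsq
    have h1 : IsSquare ((2 * c : ℕ) : ℚ) := by push_cast; exact hsq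
    rw [Rat.isSquare_natCast_iff] at h1
    obtain ⟨k, hk⟩ := h1
    have : k % 2 = 0 ∨ k % 2 = 1 := by omega
    rcases this with h | h
    · obtain ⟨j, rfl⟩ : ∃ j, k = 2 * j := ⟨k / 2, by omega⟩
      have : 2 * c = 4 * (j * j) := by rw [hk]; ring
      omega
    · obtain ⟨j, rfl⟩ : ∃ j, k = 2 * j + 1 := ⟨k / 2, by omega⟩
      have : 2 * c = 2 * (2 * j * j + 2 * j) + 1 := by rw [hk]; ring
      omega
  rcases rat_sq h s (r := 2) two_pos (z := z) (by simpa using hz) with (h1 | h1) | ⟨-, h1 | h1⟩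
  · exact hodd 1 (by norm_num) (by simpa using h1)
  · exact hodd (m * n) (by rw [Nat.mul_mod, hm, hn]) h1
  · exact hodd m hm h1
  · exact hodd n hn h1

/-- Every embedding sends `a` and `b` to real numbers and `I` to `±i`: `K` is a CM field with
complex conjugation `s₁`. -/
theorem embedding_conj (h : IsTriquadratic K m n I a b) (s : Signs K I a b)
    (φ : K →+* ℂ) (x : K) : φ (s.s₁ x) = starRingEnd ℂ (φ x) := by
  have hreal : ∀ (w : ℂ) (c : ℕ), w ^ 2 = c → starRingEnd ℂ w = w := by
    intro w c hw
    have : w = (√(c : ℝ) : ℝ) ∨ w = -(√(c : ℝ) : ℝ) := by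
      apply sq_eq_sq_iff_eq_or_eq_neg.mp
      rw [hw, ← Complex.ofReal_pow, Real.sq_sqrt (Nat.cast_nonneg c)]
      simp
    rcases this with rfl | rfl <;> simp
  have hI : starRingEnd ℂ (φ I) = -φ I := by
    have : φ I = Complex.I ∨ φ I = -Complex.I := apply_eq_or φ (by simp [h.I_sq])
    rcases this with h | h <;> simp [h]
  have := h.ringHom_ext (f := φ.comp (s.s₁ : K →+* K)) (g := (starRingEnd ℂ).comp φ)
    (by simp [s.s₁I, hI]) (by simp [s.s₁a, hreal (φ a) m (by rw [← map_pow, h.a_sq]; simp)])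
    (by simp [s.s₁b, hreal (φ b) n (by rw [← map_pow, h.b_sq]; simp)])
  exact congrArg (fun f : K →+* ℂ => f x) this

/-- All absolute values of `s₁ u / u` are 1, so it is a root of unity by Kronecker. The odd exponent
`M` removes the part of odd order, and the absence of `√2` bounds the remaining 2-power order by 4.
-/
theorem exists_odd_pow (h : IsTriquadratic K m n I a b) (s : Signs K I a b)
    (hm : m % 2 = 1) (hn : n % 2 = 1) {u : K} (hu : IsAlgUnit u) :
    ∃ M : ℕ, M % 2 = 1 ∧ ((s.s₁ u / u) ^ M) ^ 4 = 1 := by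
  have hζ : IsAlgUnit (s.s₁ u / u) := (hu.map (s.s₁ : K →+* K)).div hu
  obtain ⟨N, hN, hpow⟩ := NumberField.Embeddings.pow_eq_one_of_norm_eq_one K ℂ hζ.2 (by
    intro φ
    rw [map_div₀, embedding_conj h s, norm_div, RCLike.norm_conj, div_self]
    simp [hu.1])
  obtain ⟨k, M, hM, rfl⟩ := Nat.exists_eq_two_pow_mul_odd hN.ne'
  refine ⟨M, Nat.odd_iff.mp hM, ?_⟩
  generalize s.s₁ u / u = ζ at hpow ⊢
  have hy : (ζ ^ M) ^ 2 ^ k = 1 := by rw [← pow_mul, mul_comm]; exact hpow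
  generalize ζ ^ M = y at hy ⊢
  clear hpow hN
  induction k with
  | zero => simp only [pow_zero, pow_one] at hy; rw [hy]; simp
  | succ k ih =>
    by_cases hk : k ≤ 1
    · interval_cases k
      · have : y ^ 2 = 1 := by simpa using hy
        rw [show y ^ 4 = (y ^ 2) ^ 2 by ring, this, one_pow]
      · simpa using hy
    · obtain ⟨j, rfl⟩ : ∃ j, k = j + 2 := ⟨k - 2, by omega⟩
      have h1 : (y ^ 2 ^ (j + 2)) ^ 2 = 1 ^ 2 := by
        rw [← pow_mul, ← pow_succ, hy, one_pow]
      rcases sq_eq_sq_iff_eq_or_eq_neg.mp h1 with h2 | h2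
      · exact ih h2
      · exfalso
        set w := y ^ 2 ^ j with hw
        have h4 : w ^ 4 = -1 := by rw [hw, ← pow_mul, ← h2, pow_add]; norm_num
        have hw0 : w ≠ 0 := by rintro h0; rw [h0] at h4; norm_num at h4
        -- For a primitive eighth root of unity `w`, the element `w + w⁻¹` is a square root of 2.
        refine two_ne_sq h hm hn (w + w⁻¹) ?_
        field_simp
        linear_combination h4

end Decomposition

/-! ### Rational classes of units, and norms from `K` to its subfield fixed by `s₂s₃`. -/

/-- `D = 2r + 2` for a unit `r + t√c` of norm one with `r > 0`; up to squares of `ℚ(√c)`, this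
rational number is the unit itself. -/
def IsUnitClass (c : ℕ) (D : ℚ) : Prop :=
  ∃ r t : ℚ, (∃ X : ℤ, 2 * r = X) ∧ r ^ 2 - c * t ^ 2 = 1 ∧ 0 < r ∧ D = 2 * r + 2

theorem IsUnitClass.pos {c : ℕ} {D : ℚ} (h : IsUnitClass c D) : 0 < D := by
  obtain ⟨r, t, -, -, hr, rfl⟩ := h
  linarith

/-- A unit `v` of norm 1 and trace `2r` satisfies `v² + 1 = 2r v`; adding `2v` completes the square.
-/
theorem mul_eq_sq_of_norm_one {F : Type*} [Field F] [CharZero F] {c : ℕ} {r t : ℚ} {z : F}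
    (hz : z ^ 2 = c) (hN : r ^ 2 - c * t ^ 2 = 1) :
    ((2 * r + 2 : ℚ) : F) * (r + t * z) = (1 + (r + t * z)) ^ 2 := by
  have hNF : (r : F) ^ 2 - c * t ^ 2 = 1 := by
    exact_mod_cast congrArg (fun q : ℚ => (q : F)) hN
  push_cast
  linear_combination hNF - (t : F) ^ 2 * hz

theorem exists_isUnitClass {F : Type*} [Field F] [CharZero F] {c : ℕ} {r t : ℚ} {z : F}
    (hz : z ^ 2 = c) (hX : ∃ X : ℤ, 2 * r = X) (hN : r ^ 2 - c * t ^ 2 = 1) :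
    ∃ D, IsUnitClass c D ∧ ∃ w : F, D * (r + t * z) = w ^ 2 ∨ D * (r + t * z) = -w ^ 2 := by
  rcases lt_trichotomy r 0 with hr | hr | hr
  · refine ⟨2 * (-r) + 2, ⟨-r, -t, ?_, ?_, by linarith, rfl⟩, 1 + ((-r : ℚ) + (-t : ℚ) * z), ?_⟩
    · obtain ⟨X, hX⟩ := hX
      exact ⟨-X, by push_cast; linarith⟩
    · linear_combination hN
    · right
      rw [← mul_eq_sq_of_norm_one hz (r := -r) (t := -t) (by linear_combination hN)]
      push_cast; ring
  · exfalso
    rw [hr] at hN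
    have : 0 ≤ (c : ℚ) * t ^ 2 := by positivity
    linarith
  · exact ⟨2 * r + 2, ⟨r, t, hX, hN, hr, rfl⟩, _, Or.inl (mul_eq_sq_of_norm_one hz hN)⟩

section

variable {K : Type*} [Field K] [NumberField K] {m n : ℕ} {I a b : K}

theorem pow_four_fixed (h : IsTriquadratic K m n I a b) (g : K ≃ₐ[ℚ] K) (hg : g I = I) {c : K}
    (hc : c ^ 4 = 1) : g c = c := by
  have h1 : (c ^ 2) ^ 2 = 1 ^ 2 := by rw [← pow_mul, hc, one_pow]
  rcases sq_eq_sq_iff_eq_or_eq_neg.mp h1 with h2 | h2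
  · rcases sq_eq_sq_iff_eq_or_eq_neg.mp (h2.trans (one_pow 2).symm) with rfl | rfl <;> simp
  · rcases sq_eq_sq_iff_eq_or_eq_neg.mp (h2.trans h.I_sq.symm) with rfl | rfl <;> simp [hg]

/-- An odd power of a unit of `K` is, up to squares, a product of units of norm one in the three
real quadratic subfields and possibly `I`. -/
theorem unit_decomposition (h : IsTriquadratic K m n I a b) (s : Signs K I a b)
    (hm : m % 2 = 1) (hn : n % 4 = 3) (hn' : Squarefree n) {u : K} (hu : IsAlgUnit u) :
    ∃ (M : ℕ) (J : K) (r₁ t₁ r₂ t₂ r₃ t₃ : ℚ), M % 2 = 1 ∧ (J = 1 ∨ J = I) ∧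
      UnitCoords m r₁ t₁ ∧ r₁ ^ 2 - m * t₁ ^ 2 = 1 ∧
      UnitCoords n r₂ t₂ ∧ r₂ ^ 2 - n * t₂ ^ 2 = 1 ∧
      UnitCoords (m * n) r₃ t₃ ∧
      (u * s.s₂ (s.s₃ u)) ^ M = J * (r₃ + t₃ * (a * b)) ∧
      (u ^ M) ^ 2 = J * (r₁ + t₁ * a) * (r₂ + t₂ * b) * (r₃ + t₃ * (a * b)) := by
  obtain ⟨M, hM, hζ⟩ := exists_odd_pow h s hm (by omega) hu
  set c := (s.s₁ u / u) ^ M with hc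
  have hc2 := pow_four_fixed h s.s₂ s.s₂I hζ
  have hc3 := pow_four_fixed h s.s₃ s.s₃I hζ
  set U := u ^ M with hU
  have hUu : IsAlgUnit U := hu.pow M
  have hU0 : U ≠ 0 := hUu.1
  have h1U : s.s₁ U = c * U := by
    rw [hc, hU, map_pow, ← mul_pow, div_mul_cancel₀ _ hu.1]
  obtain ⟨J, hJ, hJ1⟩ : ∃ J : K, (J = 1 ∨ J = I) ∧ c ^ 2 * J = s.s₁ J := by
    have h1 : (c ^ 2) ^ 2 = 1 ^ 2 := by rw [← pow_mul, hζ, one_pow]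
    rcases sq_eq_sq_iff_eq_or_eq_neg.mp h1 with h2 | h2
    · exact ⟨1, Or.inl rfl, by simp [h2]⟩
    · exact ⟨I, Or.inr rfl, by simp [h2, s.s₁I]⟩
  have hJ0 : J ≠ 0 := by
    rcases hJ with rfl | rfl
    · exact one_ne_zero
    · exact h.I_ne
  have hJ2 : s.s₂ J = J := by rcases hJ with rfl | rfl <;> simp [s.s₂I]
  have hJ3 : s.s₃ J = J := by rcases hJ with rfl | rfl <;> simp [s.s₃I]
  have hIu : IsAlgUnit I := IsAlgUnit.of_sq (by rw [h.I_sq]; exact IsAlgUnit.one.neg)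
  have hJu : IsAlgUnit J := by
    rcases hJ with rfl | rfl
    · exact IsAlgUnit.one
    · exact hIu
  have hs2u : IsAlgUnit (s.s₂ U) := hUu.map (s.s₂ : K →+* K)
  have hs3u : IsAlgUnit (s.s₃ U) := hUu.map (s.s₃ : K →+* K)
  have hs23u : IsAlgUnit (s.s₂ (s.s₃ U)) := hs3u.map (s.s₂ : K →+* K)
  have h12 : s.s₁ (s.s₂ U) = c * s.s₂ U := by rw [← s.s₂s₁, h1U, map_mul, hc2]
  have h13 : s.s₁ (s.s₃ U) = c * s.s₃ U := by rw [← s.s₃s₁, h1U, map_mul, hc3]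
  have h123 : s.s₁ (s.s₂ (s.s₃ U)) = c * s.s₂ (s.s₃ U) := by rw [← s.s₂s₁, h13, map_mul, hc2]
  have hfix : ∀ V, s.s₁ V = c * V → s.s₁ (U * V / J) = U * V / J := by
    intro V hV
    have hsJ : s.s₁ J ≠ 0 := (map_ne_zero s.s₁).mpr hJ0
    rw [map_div₀, map_mul, h1U, hV, div_eq_div_iff hsJ hJ0, ← hJ1]
    ring
  obtain ⟨r₁, t₁, hv1⟩ := exists_coords_a h s (hfix _ h13)
    (by rw [map_div₀, map_mul, s.s₃s₃, hJ3, mul_comm])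
  obtain ⟨r₂, t₂, hv2⟩ := exists_coords_b h s (hfix _ h12)
    (by rw [map_div₀, map_mul, s.s₂s₂, hJ2, mul_comm])
  obtain ⟨r₃, t₃, hv3⟩ := exists_coords_ab h s (hfix _ h123) (by
    rw [map_div₀, map_div₀, map_mul, map_mul, s.s₃s₂, s.s₃s₃, s.s₂s₂, hJ3, hJ2, mul_comm])
  have hu1 : IsAlgUnit (U * s.s₃ U / J) := (hUu.mul hs3u).div hJu
  have hu2 : IsAlgUnit (U * s.s₂ U / J) := (hUu.mul hs2u).div hJu
  have hu3 : IsAlgUnit (U * s.s₂ (s.s₃ U) / J) := (hUu.mul hs23u).div hJu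
  have e1 : s.s₂ (U * s.s₃ U / J) = r₁ - t₁ * a := by rw [hv1]; simp [s.s₂a]; ring
  have e2 : s.s₃ (U * s.s₂ U / J) = r₂ - t₂ * b := by rw [hv2]; simp [s.s₃b]; ring
  have e3 : s.s₂ (U * s.s₂ (s.s₃ U) / J) = r₃ - t₃ * (a * b) := by
    rw [hv3]; simp [s.s₂a, s.s₂b]; ring
  have c1 : UnitCoords m r₁ t₁ := UnitCoords.of_conj (z := a) h.a_sq (by rw [← hv1]; exact hu1)
    (by rw [← e1]; exact hu1.map (s.s₂ : K →+* K))
  have c2 : UnitCoords n r₂ t₂ := UnitCoords.of_conj (z := b) h.b_sq (by rw [← hv2]; exact hu2)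
    (by rw [← e2]; exact hu2.map (s.s₃ : K →+* K))
  have c3 : UnitCoords (m * n) r₃ t₃ := UnitCoords.of_conj (z := a * b)
    (by rw [mul_pow, h.a_sq, h.b_sq]; simp) (by rw [← hv3]; exact hu3)
    (by rw [← e3]; exact hu3.map (s.s₂ : K →+* K))
  -- Because `n ≡ 3` modulo 4, no unit of `ℚ(√n)` has norm `-1`. So the product of the four
  -- conjugates of `U` under `s₂`, `s₃` is `J²`, which forces norm 1 on the unit of `ℚ(√m)` too.
  have n2 := c2.norm_eq_one hn' hn
  have n2K : (r₂ + t₂ * b) * (r₂ - t₂ * b) = (1 : K) := by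
    have : ((r₂ ^ 2 - n * t₂ ^ 2 : ℚ) : K) = 1 := by rw [n2]; simp
    push_cast at this
    linear_combination this - (t₂ : K) ^ 2 * h.b_sq
  have hP : U * s.s₂ U * (s.s₃ U * s.s₂ (s.s₃ U)) = J ^ 2 := by
    rw [← hv2, ← e2, map_div₀, map_mul, s.s₃s₂, hJ3] at n2K
    field_simp at n2K
    linear_combination n2K
  have n1 : r₁ ^ 2 - m * t₁ ^ 2 = 1 := by
    have n1K : (r₁ + t₁ * a) * (r₁ - t₁ * a) = (1 : K) := by
      rw [← hv1, ← e1, map_div₀, map_mul, hJ2]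
      field_simp
      linear_combination hP
    have : ((r₁ ^ 2 - m * t₁ ^ 2 : ℚ) : K) = ((1 : ℚ) : K) := by
      push_cast
      linear_combination n1K + (t₁ : K) ^ 2 * h.a_sq
    exact_mod_cast this
  refine ⟨M, J, r₁, t₁, r₂, t₂, r₃, t₃, hM, hJ, c1, n1, c2, n2, c3, ?_, ?_⟩
  · rw [← hv3, mul_pow, ← map_pow, ← map_pow, ← hU, map_pow, map_pow, ← map_pow, ← map_pow, ← hU]
    field_simp
  · rw [← hv1, ← hv2, ← hv3]
    field_simp
    linear_combination (-U ^ 2) * hP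

end

/-- `r` is a square up to the factors `m` and `n`. -/
def IsSquareUpTo (m n : ℕ) (r : ℚ) : Prop :=
  IsSquare r ∨ IsSquare (r * m) ∨ IsSquare (r * n) ∨ IsSquare (r * (m * n : ℕ))

section

variable {K : Type*} [Field K] [NumberField K] {m n : ℕ} {I a b : K}

theorem IsTriquadratic.isAlgUnit_I (h : IsTriquadratic K m n I a b) : IsAlgUnit I :=
  IsAlgUnit.of_sq (by rw [h.I_sq]; exact IsAlgUnit.one.neg)

theorem IsTriquadratic.ab_sq (h : IsTriquadratic K m n I a b) : (a * b) ^ 2 = ((m * n : ℕ) : K) := by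
  rw [mul_pow, h.a_sq, h.b_sq]; simp

theorem IsTriquadratic.sq_of_pm (h : IsTriquadratic K m n I a b) {x : K}
    (hx : ∃ w : K, x = w ^ 2 ∨ x = -w ^ 2) : ∃ w : K, x = w ^ 2 := by
  obtain ⟨w, hw | hw⟩ := hx
  · exact ⟨w, hw⟩
  · exact ⟨I * w, by rw [mul_pow, h.I_sq, hw]; ring⟩

theorem two_mul_I (h : IsTriquadratic K m n I a b) : 2 * I = (1 + I) ^ 2 := by
  linear_combination -h.I_sq

theorem Signs.fix_ab (s : Signs K I a b) : s.s₂ (s.s₃ (a * b)) = a * b := by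
  simp [s.s₃a, s.s₃b, s.s₂a, s.s₂b]

/-- The factor in `ℚ(√(mn))` is `±ε^j`. Only the parity of `j` survives modulo squares, and a sign
is absorbed as `I²`. Passing to rational classes in the decomposition turns the square `u^(2M)` into
a rational number that is a square in `K`. -/
theorem norm_unit_class (h : IsTriquadratic K m n I a b) (s : Signs K I a b)
    (hm : m % 2 = 1) (hn : n % 4 = 3) (hn' : Squarefree n) {x y : ℚ}
    (hN : x ^ 2 - (m * n : ℕ) * y ^ 2 = 1) (hε : IsAlgUnit (x + y * (a * b) : K))
    (hfund : ∀ r t, UnitCoords (m * n) r t → ∃ j : ℤ,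
      (r + t * (a * b) : K) = (x + y * (a * b)) ^ j ∨
        (r + t * (a * b) : K) = -(x + y * (a * b)) ^ j)
    (hx : 0 < x) {u : K} (hu : IsAlgUnit u) :
    ∃ M e t : ℕ, M % 2 = 1 ∧ e < 2 ∧ t < 2 ∧
      (∃ w : K, IsAlgUnit w ∧ s.s₂ (s.s₃ w) = w ∧
        (u * s.s₂ (s.s₃ u)) ^ M = I ^ e * (x + y * (a * b)) ^ t * w ^ 2) ∧
      ∃ D₁ D₂, IsUnitClass m D₁ ∧ IsUnitClass n D₂ ∧
        IsSquareUpTo m n (2 ^ e * (2 * x + 2) ^ t * D₁ * D₂) := by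
  obtain ⟨M, J, r₁, t₁, r₂, t₂, r₃, t₃, hM, hJ, c1, n1, c2, n2, c3, hNu, hU⟩ :=
    unit_decomposition h s hm hn hn' hu
  obtain ⟨e, he, hJe⟩ : ∃ e : ℕ, e < 2 ∧ J = I ^ e := by
    rcases hJ with rfl | rfl
    · exact ⟨0, by norm_num, by simp⟩
    · exact ⟨1, by norm_num, by simp⟩
  set ε : K := x + y * (a * b) with hεdef
  have hσε : s.s₂ (s.s₃ ε) = ε := by
    rw [hεdef]; simp only [map_add, map_mul, map_ratCast, s.s₃a, s.s₃b, map_neg, s.s₂a, s.s₂b]; ring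
  obtain ⟨j, hj⟩ := hfund r₃ t₃ c3
  obtain ⟨t, l, ht, rfl⟩ : ∃ (t : ℕ) (l : ℤ), t < 2 ∧ j = t + 2 * l :=
    ⟨(j % 2).toNat, j / 2, by omega, by omega⟩
  have hεj : ε ^ ((t : ℤ) + 2 * l) = ε ^ t * (ε ^ l) ^ 2 := by
    rw [zpow_add₀ hε.1, zpow_natCast, mul_comm 2 l, zpow_mul, zpow_ofNat]
  obtain ⟨w, hw, hσw, hv3⟩ : ∃ w : K, IsAlgUnit w ∧ s.s₂ (s.s₃ w) = w ∧
      (r₃ + t₃ * (a * b) : K) = ε ^ t * w ^ 2 := by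
    rcases hj with hj | hj
    · exact ⟨ε ^ l, hε.zpow l, by rw [map_zpow₀, map_zpow₀, hσε], by rw [hj, hεj]⟩
    · refine ⟨I * ε ^ l, h.isAlgUnit_I.mul (hε.zpow l), ?_, ?_⟩
      · rw [map_mul, map_mul, s.s₃I, s.s₂I, map_zpow₀, map_zpow₀, hσε]
      · rw [hj, hεj, mul_pow I, h.I_sq]; ring
  refine ⟨M, e, t, hM, he, ht, ⟨w, hw, hσw, by rw [hNu, hv3, hJe]; ring⟩, ?_⟩
  obtain ⟨D₁, hD1, hw1⟩ := exists_isUnitClass h.a_sq c1.1 n1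
  obtain ⟨D₂, hD2, hw2⟩ := exists_isUnitClass h.b_sq c2.1 n2
  obtain ⟨w₁, hw1⟩ := h.sq_of_pm hw1
  obtain ⟨w₂, hw2⟩ := h.sq_of_pm hw2
  refine ⟨D₁, D₂, hD1, hD2, ?_⟩
  have hε2 : ((2 * x + 2 : ℚ) : K) * ε = (1 + ε) ^ 2 := mul_eq_sq_of_norm_one h.ab_sq hN
  have hpos : 0 < 2 ^ e * (2 * x + 2) ^ t * D₁ * D₂ := by
    have := hD1.pos
    have := hD2.pos
    positivity
  have hU0 : u ^ M ≠ 0 := (hu.pow M).1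
  -- Each unit in the decomposition of `u^(2M)` is exchanged for its rational class: `2` for `I`,
  -- `2x + 2` for `ε`, and the `Dⱼ` for the remaining two.
  have hsq : ((1 + I) ^ e * (1 + ε) ^ t * w₁ * w₂ * w / u ^ M) ^ 2 =
      ((2 ^ e * (2 * x + 2) ^ t * D₁ * D₂ : ℚ) : K) := by
    rw [div_pow, div_eq_iff (pow_ne_zero 2 hU0), hU, hv3, hJe]
    have h1 : ((1 + I) ^ e) ^ 2 = 2 ^ e * I ^ e := by
      rw [← pow_mul, mul_comm e 2, pow_mul, ← two_mul_I h, mul_pow]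
    have h2 : ((1 + ε) ^ t) ^ 2 = (((2 * x + 2 : ℚ) : K)) ^ t * ε ^ t := by
      rw [← pow_mul, mul_comm t 2, pow_mul, ← hε2, mul_pow]
    simp only [mul_pow, h1, h2, ← hw1, ← hw2]
    push_cast
    ring
  rcases rat_sq h s hpos hsq with (h1 | h1) | ⟨-, h1 | h1⟩
  · exact Or.inl h1
  · exact Or.inr (Or.inr (Or.inr h1))
  · exact Or.inr (Or.inl h1)
  · exact Or.inr (Or.inr (Or.inl h1))

theorem IsSquareUpTo.exists_sq (h : IsTriquadratic K m n I a b) {r : ℚ}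
    (hr : IsSquareUpTo m n r) : ∃ z : K, z ^ 2 = r := by
  have key : ∀ (c : ℚ) (g : K), c ≠ 0 → g ^ 2 = c → IsSquare (r * c) → ∃ z : K, z ^ 2 = r := by
    rintro c g hc hg ⟨q, hq⟩
    have hg0 : g ≠ 0 := by
      rintro rfl
      apply hc
      have : ((c : ℚ) : K) = ((0 : ℚ) : K) := by rw [← hg]; simp
      exact_mod_cast this
    refine ⟨q / g, ?_⟩
    rw [div_pow, div_eq_iff (pow_ne_zero 2 hg0), hg]
    have : ((q * q : ℚ) : K) = ((r * c : ℚ) : K) := by rw [hq]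
    push_cast at this
    rw [← this]; ring
  have hm : (m : ℚ) ≠ 0 := by exact_mod_cast h.m_pos.ne'
  have hn : (n : ℚ) ≠ 0 := by exact_mod_cast h.n_pos.ne'
  rcases hr with hr | hr | hr | hr
  · exact key 1 1 one_ne_zero (by simp) (by simpa using hr)
  · exact key m a hm (by simp [h.a_sq]) hr
  · exact key n b hn (by simp [h.b_sq]) hr
  · exact key (m * n : ℕ) (a * b) (by push_cast; exact mul_ne_zero hm hn)
      (by simp [mul_pow, h.a_sq, h.b_sq]) hr

/-- The hypothesis makes `I^e ε^t v₁ v₂` a square `u²` in `K`. The automorphism `s₂s₃` inverts `v₁`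
and `v₂` and fixes `I` and `ε`, so the norm of `u` is `I^e ε^t` up to sign. -/
theorem exists_unit_of_class (h : IsTriquadratic K m n I a b) (s : Signs K I a b) {x y : ℚ}
    (hN : x ^ 2 - (m * n : ℕ) * y ^ 2 = 1) (hε : IsAlgUnit (x + y * (a * b) : K))
    (hx : 0 < x) {e t : ℕ} {D₁ D₂ : ℚ} (hD1 : IsUnitClass m D₁) (hD2 : IsUnitClass n D₂)
    (hsq : IsSquareUpTo m n (2 ^ e * (2 * x + 2) ^ t * D₁ * D₂)) :
    ∃ u : K, IsAlgUnit u ∧ u * s.s₂ (s.s₃ u) = I ^ e * (x + y * (a * b)) ^ t := by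
  set ε : K := x + y * (a * b) with hεdef
  have hσε : s.s₂ (s.s₃ ε) = ε := by
    rw [hεdef]; simp only [map_add, map_mul, map_ratCast, s.s₃a, s.s₃b, map_neg, s.s₂a, s.s₂b]; ring
  have hpos : 0 < 2 ^ e * (2 * x + 2) ^ t * D₁ * D₂ := by
    have := hD1.pos
    have := hD2.pos
    positivity
  obtain ⟨r₁, t₁, hX1, n1, hr1, rfl⟩ := hD1
  obtain ⟨r₂, t₂, hX2, n2, hr2, rfl⟩ := hD2
  obtain ⟨z, hz⟩ := hsq.exists_sq h
  have hz0 : z ≠ 0 := by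
    rintro rfl
    have : ((0 : ℚ) : K) = ((2 ^ e * (2 * x + 2) ^ t * (2 * r₁ + 2) * (2 * r₂ + 2) : ℚ) : K) := by
      rw [← hz]; simp
    exact hpos.ne (by exact_mod_cast this)
  have hε2 : ((2 * x + 2 : ℚ) : K) * ε = (1 + ε) ^ 2 := mul_eq_sq_of_norm_one h.ab_sq hN
  have e1 := mul_eq_sq_of_norm_one h.a_sq n1
  have e2 := mul_eq_sq_of_norm_one h.b_sq n2
  have u1 : IsAlgUnit (r₁ + t₁ * a : K) := UnitCoords.isAlgUnit h.a_sq ⟨hX1, Or.inl n1⟩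
  have u2 : IsAlgUnit (r₂ + t₂ * b : K) := UnitCoords.isAlgUnit h.b_sq ⟨hX2, Or.inl n2⟩
  set v₁ : K := r₁ + t₁ * a with hv1
  set v₂ : K := r₂ + t₂ * b with hv2
  have m1 : v₁ * s.s₂ (s.s₃ v₁) = 1 := by
    have : ((r₁ ^ 2 - m * t₁ ^ 2 : ℚ) : K) = 1 := by rw [n1]; simp
    push_cast at this
    rw [hv1]
    simp only [map_add, map_mul, map_ratCast, s.s₃a, s.s₂a]
    linear_combination this - (t₁ : K) ^ 2 * h.a_sq
  have m2 : v₂ * s.s₂ (s.s₃ v₂) = 1 := by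
    have : ((r₂ ^ 2 - n * t₂ ^ 2 : ℚ) : K) = 1 := by rw [n2]; simp
    push_cast at this
    rw [hv2]
    simp only [map_add, map_mul, map_ratCast, s.s₃b, map_neg, s.s₂b]
    linear_combination this - (t₂ : K) ^ 2 * h.b_sq
  set u : K := (1 + I) ^ e * (1 + ε) ^ t * (1 + v₁) * (1 + v₂) / z with hu
  have husq : u ^ 2 = I ^ e * ε ^ t * v₁ * v₂ := by
    rw [hu, div_pow, div_eq_iff (pow_ne_zero 2 hz0), hz]
    have h1 : ((1 + I) ^ e) ^ 2 = 2 ^ e * I ^ e := by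
      rw [← pow_mul, mul_comm e 2, pow_mul, ← two_mul_I h, mul_pow]
    have h2 : ((1 + ε) ^ t) ^ 2 = (((2 * x + 2 : ℚ) : K)) ^ t * ε ^ t := by
      rw [← pow_mul, mul_comm t 2, pow_mul, ← hε2, mul_pow]
    simp only [mul_pow, h1, h2, ← e1, ← e2]
    push_cast
    ring
  have huU : IsAlgUnit u := IsAlgUnit.of_sq (by
    rw [husq]
    exact (((h.isAlgUnit_I.pow e).mul (hε.pow t)).mul u1).mul u2)
  have hnorm : (u * s.s₂ (s.s₃ u)) ^ 2 = (I ^ e * ε ^ t) ^ 2 := by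
    rw [mul_pow, ← map_pow, ← map_pow, husq]
    simp only [map_mul, map_pow, s.s₃I, s.s₂I, hσε]
    linear_combination (I ^ e * ε ^ t) ^ 2 * (v₂ * s.s₂ (s.s₃ v₂)) * m1 + (I ^ e * ε ^ t) ^ 2 * m2
  rcases sq_eq_sq_iff_eq_or_eq_neg.mp hnorm with h1 | h1
  · exact ⟨u, huU, h1⟩
  -- The norm of `I` is `I² = -1`, which repairs the sign.
  · refine ⟨I * u, h.isAlgUnit_I.mul huU, ?_⟩
    rw [map_mul, map_mul, s.s₃I, s.s₂I]
    linear_combination u * s.s₂ (s.s₃ u) * h.I_sq - h1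

/-- Passing to rational classes works already inside the fixed field of `s₂s₃`. A root of a rational
that is a square only up to `m` or `n` is moved by `s₂s₃`, so only the factors `1` and `mn` remain.
-/
theorem exists_sqrt_fixed_iff (h : IsTriquadratic K m n I a b) (s : Signs K I a b) {x y : ℚ}
    (hN : x ^ 2 - (m * n : ℕ) * y ^ 2 = 1) (hε : IsAlgUnit (x + y * (a * b) : K))
    (hx : 0 < x) (e t : ℕ) :
    (∃ w : K, IsAlgUnit w ∧ s.s₂ (s.s₃ w) = w ∧ w ^ 2 = I ^ e * (x + y * (a * b)) ^ t) ↔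
      (IsSquare (2 ^ e * (2 * x + 2) ^ t) ∨ IsSquare (2 ^ e * (2 * x + 2) ^ t * (m * n : ℕ))) := by
  set ε : K := x + y * (a * b) with hεdef
  have hσε : s.s₂ (s.s₃ ε) = ε := by
    rw [hεdef]; simp only [map_add, map_mul, map_ratCast, s.s₃a, s.s₃b, map_neg, s.s₂a, s.s₂b]; ring
  have hpos : 0 < 2 ^ e * (2 * x + 2) ^ t := by positivity
  have hε2 : ((2 * x + 2 : ℚ) : K) * ε = (1 + ε) ^ 2 := mul_eq_sq_of_norm_one h.ab_sq hN
  have h1 : ((1 + I) ^ e) ^ 2 = 2 ^ e * I ^ e := by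
    rw [← pow_mul, mul_comm e 2, pow_mul, ← two_mul_I h, mul_pow]
  have h2 : ((1 + ε) ^ t) ^ 2 = (((2 * x + 2 : ℚ) : K)) ^ t * ε ^ t := by
    rw [← pow_mul, mul_comm t 2, pow_mul, ← hε2, mul_pow]
  set g : K := (1 + I) ^ e * (1 + ε) ^ t with hg
  have hgsq : g ^ 2 = ((2 ^ e * (2 * x + 2) ^ t : ℚ) : K) * (I ^ e * ε ^ t) := by
    rw [hg, mul_pow, h1, h2]; push_cast; ring
  have hσg : s.s₂ (s.s₃ g) = g := by
    rw [hg]; simp only [map_mul, map_pow, map_add, map_one, s.s₃I, s.s₂I, hσε]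
  have hr0 : ((2 ^ e * (2 * x + 2) ^ t : ℚ) : K) ≠ 0 := by exact_mod_cast hpos.ne'
  have hIε : I ^ e * ε ^ t ≠ 0 := mul_ne_zero (pow_ne_zero _ h.I_ne) (pow_ne_zero _ hε.1)
  constructor
  · rintro ⟨w, hw, hσw, hwsq⟩
    have hz : (g / w) ^ 2 = ((2 ^ e * (2 * x + 2) ^ t : ℚ) : K) := by
      rw [div_pow, hgsq, hwsq, mul_div_cancel_right₀ _ hIε]
    rcases rat_sq h s hpos hz with h3 | ⟨h3, -⟩
    · exact h3
    · exfalso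
      rw [map_div₀, map_div₀, hσg, hσw] at h3
      have : (2 : K) * (g / w) = 0 := by linear_combination h3
      have hz0 : g / w = 0 := by simpa using this
      rw [hz0] at hz
      exact hr0 (by rw [← hz]; simp)
  · intro hsq
    obtain ⟨z, hσz, hz⟩ : ∃ z : K, s.s₂ (s.s₃ z) = z ∧
        z ^ 2 = ((2 ^ e * (2 * x + 2) ^ t : ℚ) : K) := by
      rcases hsq with ⟨q, hq⟩ | ⟨q, hq⟩
      · exact ⟨q, by simp, by rw [hq]; push_cast; ring⟩
      · refine ⟨q / (a * b), by rw [map_div₀, map_div₀, s.fix_ab]; simp, ?_⟩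
        have hab : (a * b) ^ 2 ≠ 0 := pow_ne_zero 2 (mul_ne_zero h.a_ne h.b_ne)
        rw [div_pow, div_eq_iff hab, h.ab_sq]
        have : ((q * q : ℚ) : K) = ((2 ^ e * (2 * x + 2) ^ t * (m * n : ℕ) : ℚ) : K) := by rw [hq]
        push_cast at this ⊢
        rw [← this]; ring
    have hz0 : z ≠ 0 := by
      rintro rfl
      exact hr0 (by rw [← hz]; simp)
    have hsq' : (g / z) ^ 2 = I ^ e * ε ^ t := by
      rw [div_pow, hz, hgsq, mul_div_cancel_left₀ _ hr0]
    refine ⟨g / z, IsAlgUnit.of_sq ?_, by rw [map_div₀, map_div₀, hσg, hσz], hsq'⟩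
    rw [hsq']
    exact (h.isAlgUnit_I.pow e).mul (hε.pow t)

end

/-! ### Indices of subgroups covered by the cosets of `1`, `α`, `β`, `αβ`. -/

section Index

variable {P : Type*} [CommGroup P] {H G : Subgroup P} {α β : P}

theorem relIndex_eq_one_of_cosets (hHG : H ≤ G) (hαβ : α * β ∈ H) (hα : α ∉ G)
    (hcov : ∀ g ∈ G, ∃ e t : ℕ, e < 2 ∧ t < 2 ∧ g * (α ^ e * β ^ t) ∈ H) :
    H.relIndex G = 1 := by
  rw [Subgroup.relIndex_eq_one]
  intro g hg
  obtain ⟨e, t, he, ht, hm⟩ := hcov g hg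
  interval_cases e <;> interval_cases t
  · simpa using hm
  · exfalso
    simp only [pow_zero, pow_one, one_mul] at hm
    have hβ : β ∈ G := (Subgroup.mul_mem_cancel_left G hg).mp (hHG hm)
    exact hα ((Subgroup.mul_mem_cancel_right G hβ).mp (hHG hαβ))
  · exfalso
    simp only [pow_zero, pow_one, mul_one] at hm
    exact hα ((Subgroup.mul_mem_cancel_left G hg).mp (hHG hm))
  · simp only [pow_one] at hm
    exact (Subgroup.mul_mem_cancel_right H hαβ).mp hm

theorem relIndex_eq_two_of_cosets (hα2 : α ^ 2 ∈ H) (hα : α ∉ H) (hαβ : α * β ∈ H)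
    (hαG : α ∈ G) (hcov : ∀ g ∈ G, ∃ e t : ℕ, e < 2 ∧ t < 2 ∧ g * (α ^ e * β ^ t) ∈ H) :
    H.relIndex G = 2 := by
  rw [Subgroup.relIndex_eq_two_iff_exists_notMem_and]
  refine ⟨α, hαG, hα, fun g hg => ?_⟩
  obtain ⟨e, t, he, ht, hm⟩ := hcov g hg
  interval_cases e <;> interval_cases t
  · right; simpa using hm
  · left
    simp only [pow_zero, pow_one, one_mul] at hm
    have h1 := H.mul_mem (H.mul_mem hm hα2) (H.inv_mem hαβ)
    convert h1 using 1
    rw [pow_two, mul_inv]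
    calc g * α = g * α * (β * β⁻¹) * (α * α⁻¹) := by simp
      _ = _ := by ac_rfl
  · left; simpa using hm
  · right
    simp only [pow_one] at hm
    exact (Subgroup.mul_mem_cancel_right H hαβ).mp hm

/-- Any two of `α`, `β`, `αβ` generate the third, so exactly one of them lies in `G`. -/
theorem relIndex_eq_two_of_single (hHG : H ≤ G) (hα : α ∉ H) (hβ : β ∉ H)
    (hαβ : α * β ∉ H) (hex : α ∈ G ∨ β ∈ G ∨ α * β ∈ G) (hnot : ¬ (α ∈ G ∧ β ∈ G))
    (hcov : ∀ g ∈ G, ∃ e t : ℕ, e < 2 ∧ t < 2 ∧ g * (α ^ e * β ^ t) ∈ H) :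
    H.relIndex G = 2 := by
  rw [Subgroup.relIndex_eq_two_iff_exists_notMem_and]
  have hcov' : ∀ g ∈ G, g ∈ H ∨ (α ∈ G ∧ g * α ∈ H) ∨ (β ∈ G ∧ g * β ∈ H) ∨
      (α * β ∈ G ∧ g * (α * β) ∈ H) := by
    intro g hg
    obtain ⟨e, t, he, ht, hm⟩ := hcov g hg
    have hG : α ^ e * β ^ t ∈ G := (Subgroup.mul_mem_cancel_left G hg).mp (hHG hm)
    interval_cases e <;> interval_cases t <;> simp_all
  have h1 : α ∈ G → α * β ∉ G := fun h h' => hnot ⟨h, (Subgroup.mul_mem_cancel_left G h).mp h'⟩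
  have h2 : β ∈ G → α * β ∉ G := fun h h' => hnot ⟨(Subgroup.mul_mem_cancel_right G h).mp h', h⟩
  rcases hex with hG | hG | hG
  · refine ⟨α, hG, hα, fun g hg => ?_⟩
    rcases hcov' g hg with h | h | h | h <;> tauto
  · refine ⟨β, hG, hβ, fun g hg => ?_⟩
    rcases hcov' g hg with h | h | h | h <;> tauto
  · refine ⟨α * β, hG, hαβ, fun g hg => ?_⟩
    rcases hcov' g hg with h | h | h | h <;> tauto

theorem relIndex_eq_four_of_cosets (hHG : H ≤ G) (hα2 : α ^ 2 ∈ H) (hα : α ∉ H) (hβ : β ∉ H)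
    (hαβ : α * β ∉ H) (hαG : α ∈ G) (hβG : β ∈ G)
    (hcov : ∀ g ∈ G, ∃ e t : ℕ, e < 2 ∧ t < 2 ∧ g * (α ^ e * β ^ t) ∈ H) :
    H.relIndex G = 4 := by
  -- The intermediate group is `H ∪ αH`; both steps of the resulting chain have index 2.
  let H' : Subgroup P :=
    { carrier := {g | g ∈ H ∨ g * α ∈ H}
      one_mem' := Or.inl H.one_mem
      mul_mem' := by
        rintro x y (hx | hx) (hy | hy)
        · exact Or.inl (H.mul_mem hx hy)
        · right; rw [mul_assoc]; exact H.mul_mem hx hy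
        · right; rw [mul_right_comm]; exact H.mul_mem hx hy
        · left
          have := H.mul_mem (H.mul_mem hx hy) (H.inv_mem hα2)
          convert this using 1
          rw [pow_two, mul_inv]
          calc x * y = x * y * (α * α⁻¹) * (α * α⁻¹) := by simp
            _ = _ := by ac_rfl
      inv_mem' := by
        rintro x (hx | hx)
        · exact Or.inl (H.inv_mem hx)
        · right
          have := H.mul_mem (H.inv_mem hx) hα2
          convert this using 1
          rw [pow_two, mul_inv]
          calc x⁻¹ * α = x⁻¹ * α * (α⁻¹ * α) := by simp
            _ = _ := by ac_rfl }
  have hHH' : H ≤ H' := fun g hg => Or.inl hg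
  have hH'G : H' ≤ G := by
    rintro g (hg | hg)
    · exact hHG hg
    · exact (Subgroup.mul_mem_cancel_right G hαG).mp (hHG hg)
  have h1 : H.relIndex H' = 2 := by
    rw [Subgroup.relIndex_eq_two_iff_exists_notMem_and]
    refine ⟨α, Or.inr (by rw [← pow_two]; exact hα2), hα, ?_⟩
    rintro g (hg | hg)
    · exact Or.inr hg
    · exact Or.inl hg
  have h2 : H'.relIndex G = 2 := by
    rw [Subgroup.relIndex_eq_two_iff_exists_notMem_and]
    refine ⟨β, hβG, ?_, fun g hg => ?_⟩
    · rintro (h | h)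
      · exact hβ h
      · exact hαβ (by rw [mul_comm]; exact h)
    · obtain ⟨e, t, he, ht, hm⟩ := hcov g hg
      interval_cases e <;> interval_cases t
      · right; left; simpa using hm
      · left; left; simpa using hm
      · right; right; simpa using hm
      · left; right
        rw [mul_assoc, mul_comm β]
        simpa using hm
  rw [← Subgroup.relIndex_mul_relIndex _ _ _ hHH' hH'G, h1, h2]

end Index

/-! ### The order of the capitulation kernel from the norms among `I`, `ε`, `Iε`. -/

open NumberField in
theorem rank_eq_of_I {k : Type*} [Field k] [NumberField k] {J : k} (hJ : J ^ 2 = -1) :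
    Units.rank k = Module.finrank ℚ k / 2 - 1 := by
  have hc : IsTotallyComplex k := by
    constructor
    intro v
    by_contra hv
    rw [InfinitePlace.not_isComplex_iff_isReal] at hv
    have h1 := congrArg (InfinitePlace.embedding_of_isReal hv) hJ
    simp only [map_pow, map_neg, map_one] at h1
    nlinarith [sq_nonneg (InfinitePlace.embedding_of_isReal hv J)]
  rw [Units.rank, InfinitePlace.card_eq_nrRealPlaces_add_nrComplexPlaces,
    IsTotallyComplex.nrRealPlaces_eq_zero, IsTotallyComplex.finrank]
  omega

/-- `2 ^ e * D ^ t` is, up to `m`, `n` and squares, a product of classes of units of norm one. -/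
def IsAllowed (m n : ℕ) (D : ℚ) (e t : ℕ) : Prop :=
  ∃ D₁ D₂, IsUnitClass m D₁ ∧ IsUnitClass n D₂ ∧ IsSquareUpTo m n (2 ^ e * D ^ t * D₁ * D₂)

section

variable {k K : Type*} [Field k] [Field K] [NumberField K] [Algebra k K]
  {m n : ℕ} {I a b : K}

/-- The automorphism `s₂s₃` as an automorphism over its fixed field. -/
def conjOver (s : Signs K I a b) (hk : ∀ x, s.s₂ (s.s₃ x) = x ↔ x ∈ Set.range (algebraMap k K)) :
    K ≃ₐ[k] K :=
  AlgEquiv.ofRingEquiv (f := ((s.s₃.trans s.s₂ : K ≃ₐ[ℚ] K) : K ≃+* K))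
    (fun y => (hk _).mpr ⟨y, rfl⟩)

/-- The restriction of `conjOver` to the ring of integers. -/
noncomputable def intConj (s : Signs K I a b)
    (hk : ∀ x, s.s₂ (s.s₃ x) = x ↔ x ∈ Set.range (algebraMap k K)) : 𝓞 K ≃ₐ[𝓞 k] 𝓞 K :=
  NumberField.RingOfIntegers.mapAlgEquiv (conjOver s hk)

theorem coe_intConj (s : Signs K I a b)
    (hk : ∀ x, s.s₂ (s.s₃ x) = x ↔ x ∈ Set.range (algebraMap k K)) (x : 𝓞 K) :
    ((intConj s hk x : 𝓞 K) : K) = s.s₂ (s.s₃ x) := rfl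

theorem intConj_intConj (s : Signs K I a b)
    (hk : ∀ x, s.s₂ (s.s₃ x) = x ↔ x ∈ Set.range (algebraMap k K)) (x : 𝓞 K) :
    intConj s hk (intConj s hk x) = x := by
  apply NumberField.RingOfIntegers.ext
  rw [coe_intConj, coe_intConj, s.s₃s₂, s.s₃s₃, s.s₂s₂]

theorem exists_of_intConj_eq [NumberField k] (s : Signs K I a b)
    (hk : ∀ x, s.s₂ (s.s₃ x) = x ↔ x ∈ Set.range (algebraMap k K)) (x : 𝓞 K)
    (hx : intConj s hk x = x) : ∃ y, algebraMap (𝓞 k) (𝓞 K) y = x := by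
  have h1 : s.s₂ (s.s₃ (x : K)) = x := by rw [← coe_intConj s hk, hx]
  obtain ⟨y, hy⟩ := (hk _).mp h1
  have h_int : IsIntegral ℤ (algebraMap k K y) := by rw [hy]; exact x.isIntegral_coe
  rw [isIntegral_algebraMap_iff (algebraMap k K).injective] at h_int
  refine ⟨⟨y, h_int⟩, ?_⟩
  apply NumberField.RingOfIntegers.ext
  rw [← hy]
  rfl

/-- This is where the extension is seen to be unramified: the integers `(1 + a)/2` and `(1 + Ib)/2`
have differences `a` and `Ib`, whose squares are the coprime numbers `m` and `-n`. -/
theorem span_intConj (h : IsTriquadratic K m n I a b) (s : Signs K I a b)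
    (hk : ∀ x, s.s₂ (s.s₃ x) = x ↔ x ∈ Set.range (algebraMap k K))
    (hm : m % 4 = 1) (hn : n % 4 = 3) (hmn : m.Coprime n) :
    Ideal.span (Set.range fun z : 𝓞 K => z - intConj s hk z) = ⊤ := by
  have h_int : ∀ (z : K) (N : ℤ), z ^ 2 - z + N = 0 → IsIntegral ℤ z := by
    intro z N hz
    refine ⟨Polynomial.X ^ 2 - Polynomial.X + Polynomial.C N, ?_, ?_⟩
    · monicity!
    · rw [Polynomial.eval₂_add, Polynomial.eval₂_sub, Polynomial.eval₂_pow,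
        Polynomial.eval₂_X, Polynomial.eval₂_C]
      simpa using hz
  obtain ⟨m', hm'⟩ : ∃ m' : ℕ, m = 4 * m' + 1 := ⟨m / 4, by omega⟩
  obtain ⟨n', hn'⟩ : ∃ n' : ℕ, n + 1 = 4 * n' := ⟨(n + 1) / 4, by omega⟩
  have hmK : (m : K) = 4 * m' + 1 := by rw [hm']; push_cast; ring
  have hnK : (n : K) + 1 = 4 * n' := by exact_mod_cast congrArg (fun z : ℕ => (z : K)) hn'
  have i1 : IsIntegral ℤ ((1 + a) / 2) := by
    apply h_int _ (-(m' : ℤ))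
    have := h.a_sq
    push_cast
    linear_combination (1 / 4) * this + (1 / 4) * hmK
  have i2 : IsIntegral ℤ ((1 + I * b) / 2) := by
    apply h_int _ (n' : ℤ)
    have h1 := h.I_sq
    have h2 := h.b_sq
    push_cast
    linear_combination (b ^ 2 / 4) * h1 - (1 / 4) * h2 - (1 / 4) * hnK
  set J := Ideal.span (Set.range fun z : 𝓞 K => z - intConj s hk z) with hJ
  let ω : 𝓞 K := ⟨_, i1⟩
  let ω' : 𝓞 K := ⟨_, i2⟩
  have h1 : ω - intConj s hk ω ∈ J := Ideal.subset_span ⟨ω, rfl⟩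
  have h2 : ω' - intConj s hk ω' ∈ J := Ideal.subset_span ⟨ω', rfl⟩
  have e1 : (ω - intConj s hk ω) ^ 2 = (m : 𝓞 K) := by
    apply NumberField.RingOfIntegers.ext
    have : (((ω - intConj s hk ω) ^ 2 : 𝓞 K) : K) = ((1 + a) / 2 - s.s₂ (s.s₃ ((1 + a) / 2))) ^ 2 :=
      rfl
    rw [this]
    simp only [map_div₀, map_add, map_one, map_ofNat, s.s₃a, s.s₂a]
    push_cast
    linear_combination h.a_sq
  have e2 : (ω' - intConj s hk ω') ^ 2 = -(n : 𝓞 K) := by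
    apply NumberField.RingOfIntegers.ext
    have : (((ω' - intConj s hk ω') ^ 2 : 𝓞 K) : K) =
      ((1 + I * b) / 2 - s.s₂ (s.s₃ ((1 + I * b) / 2))) ^ 2 := rfl
    rw [this]
    simp only [map_div₀, map_add, map_one, map_ofNat, map_mul, s.s₃I, s.s₂I, s.s₃b, map_neg, s.s₂b]
    push_cast
    linear_combination b ^ 2 * h.I_sq - h.b_sq
  have m1 : (m : 𝓞 K) ∈ J := by rw [← e1, pow_two]; exact J.mul_mem_left _ h1
  have m2 : (n : 𝓞 K) ∈ J := by
    rw [← neg_neg (n : 𝓞 K), ← e2, pow_two]; exact J.neg_mem (J.mul_mem_left _ h2)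
  rw [Ideal.eq_top_iff_one]
  obtain ⟨p, q, hpq⟩ := Nat.isCoprime_iff_coprime.mpr hmn
  have : (1 : 𝓞 K) = p * m + q * n := by
    exact_mod_cast congrArg (fun z : ℤ => (z : 𝓞 K)) hpq.symm
  rw [this]
  exact J.add_mem (J.mul_mem_left _ m1) (J.mul_mem_left _ m2)

theorem mem_range_unitNorm_iff (s : Signs K I a b)
    (hk : ∀ x, s.s₂ (s.s₃ x) = x ↔ x ∈ Set.range (algebraMap k K)) (g : (𝓞 K)ˣ) :
    g ∈ (unitNorm (intConj s hk)).range ↔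
      ∃ u : K, IsAlgUnit u ∧ u * s.s₂ (s.s₃ u) = ((g : 𝓞 K) : K) := by
  constructor
  · rintro ⟨u, rfl⟩
    exact ⟨u, IsAlgUnit.unit_coe u, rfl⟩
  · rintro ⟨u, hu, hg⟩
    obtain ⟨v, rfl⟩ := hu.exists_unit
    refine ⟨v, Units.ext (NumberField.RingOfIntegers.ext ?_)⟩
    rw [← hg]
    rfl

theorem mem_squares_iff [NumberField k] (s : Signs K I a b)
    (hk : ∀ x, s.s₂ (s.s₃ x) = x ↔ x ∈ Set.range (algebraMap k K)) (g : (𝓞 K)ˣ) :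
    g ∈ (unitIncl (𝓞 k) (𝓞 K)).range.map (powMonoidHom 2) ↔
      ∃ w : K, IsAlgUnit w ∧ s.s₂ (s.s₃ w) = w ∧ w ^ 2 = ((g : 𝓞 K) : K) := by
  have hinj : Function.Injective (algebraMap (𝓞 k) (𝓞 K)) :=
    FaithfulSMul.algebraMap_injective _ _
  rw [← ker_unitDiff (intConj s hk) hinj (exists_of_intConj_eq s hk)]
  constructor
  · rintro ⟨w, hw, rfl⟩
    refine ⟨w, IsAlgUnit.unit_coe w, ?_, rfl⟩
    have h1 : unitDiff (intConj s hk) w = 1 := hw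
    rw [invDiff_apply, div_eq_one] at h1
    have h2 := congrArg (fun z : (𝓞 K)ˣ => ((z : 𝓞 K) : K)) h1
    exact h2.symm
  · rintro ⟨w, hw, hσ, hg⟩
    obtain ⟨v, rfl⟩ := hw.exists_unit
    refine ⟨v, ?_, Units.ext (NumberField.RingOfIntegers.ext ?_)⟩
    · have : unitDiff (intConj s hk) v = 1 := by
        rw [invDiff_apply, div_eq_one]
        exact Units.ext (NumberField.RingOfIntegers.ext hσ.symm)
      exact this
    · rw [← hg]
      rfl

/-- The general description of norms yields exponents `e'`, `t'` that may differ from `e`, `t`. As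
`M` is odd, `I^(e+e') ε^(t+t')` is a square in `k`, so both pairs have the same rational class up to
squares in `K`. -/
theorem isAllowed_of_norm (h : IsTriquadratic K m n I a b) (s : Signs K I a b)
    (hm : m % 4 = 1) (hn : n % 4 = 3) (hn' : Squarefree n) {x y : ℚ}
    (hN : x ^ 2 - (m * n : ℕ) * y ^ 2 = 1) (hε : IsAlgUnit (x + y * (a * b) : K))
    (hfund : ∀ r t, UnitCoords (m * n) r t → ∃ j : ℤ,
      (r + t * (a * b) : K) = (x + y * (a * b)) ^ j ∨
        (r + t * (a * b) : K) = -(x + y * (a * b)) ^ j)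
    (hx : 0 < x) {e t : ℕ} {u : K} (hu : IsAlgUnit u)
    (hue : u * s.s₂ (s.s₃ u) = I ^ e * (x + y * (a * b)) ^ t) :
    IsAllowed m n (2 * x + 2) e t := by
  obtain ⟨M, e', t', hM, -, -, ⟨w, hw, hσw, hw2⟩, D₁, D₂, hD1, hD2, hsq⟩ :=
    norm_unit_class h s (by omega) hn hn' hN hε hfund hx hu
  refine ⟨D₁, D₂, hD1, hD2, ?_⟩
  set ε : K := x + y * (a * b) with hεdef
  have hσε : s.s₂ (s.s₃ ε) = ε := by
    rw [hεdef]; simp only [map_add, map_mul, map_ratCast, s.s₃a, s.s₃b, map_neg, s.s₂a, s.s₂b]; ring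
  set g := I ^ e * ε ^ t with hg
  have hgu : IsAlgUnit g := (h.isAlgUnit_I.pow e).mul (hε.pow t)
  have hσg : s.s₂ (s.s₃ g) = g := by
    rw [hg]; simp only [map_mul, map_pow, s.s₃I, s.s₂I, hσε]
  obtain ⟨N, rfl⟩ : ∃ N, M = 2 * N + 1 := ⟨M / 2, by omega⟩
  have hfix : ∃ w : K, IsAlgUnit w ∧ s.s₂ (s.s₃ w) = w ∧
      w ^ 2 = I ^ (e + e') * ε ^ (t + t') := by
    refine ⟨g ^ (N + 1) / w, (hgu.pow _).div hw, by
      rw [map_div₀, map_div₀, map_pow, map_pow, hσg, hσw], ?_⟩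
    rw [hue] at hw2
    rw [div_pow, div_eq_iff (pow_ne_zero 2 hw.1)]
    calc (g ^ (N + 1)) ^ 2 = g * g ^ (2 * N + 1) := by ring
      _ = _ := by rw [hw2, hg]; ring
  have hq := (exists_sqrt_fixed_iff h s hN hε hx (e + e') (t + t')).mp hfix
  have hq' : IsSquareUpTo m n (2 ^ (e + e') * (2 * x + 2) ^ (t + t')) := by
    rcases hq with hq | hq
    · exact Or.inl hq
    · exact Or.inr (Or.inr (Or.inr hq))
  obtain ⟨z, hz⟩ := hsq.exists_sq h
  obtain ⟨z', hz'⟩ := hq'.exists_sq h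
  have hp1 := hD1.pos
  have hp2 := hD2.pos
  have hr : 0 < 2 ^ e * (2 * x + 2) ^ t * D₁ * D₂ := by positivity
  have hr' : 0 < 2 ^ e' * (2 * x + 2) ^ t' * D₁ * D₂ := by positivity
  have hr0 : ((2 ^ e' * (2 * x + 2) ^ t' * D₁ * D₂ : ℚ) : K) ≠ 0 := by exact_mod_cast hr'.ne'
  have key : (z' * D₁ * D₂ / z) ^ 2 = ((2 ^ e * (2 * x + 2) ^ t * D₁ * D₂ : ℚ) : K) := by
    rw [div_pow, hz, div_eq_iff hr0, mul_pow, mul_pow, hz']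
    push_cast
    ring
  rcases rat_sq h s hr key with (h1 | h1) | ⟨-, h1 | h1⟩
  · exact Or.inl h1
  · exact Or.inr (Or.inr (Or.inr h1))
  · exact Or.inr (Or.inl h1)
  · exact Or.inr (Or.inr (Or.inl h1))

/-- The kernel has order `8 / [G : H]`, with `G` the norms and `H` the squares of units of `k`.
Neither `I` nor `ε` is in `H`, and `sq` tells whether `Iε` is. -/
theorem card_capitulationKernel_cases [NumberField k] (h : IsTriquadratic K m n I a b) (s : Signs K I a b)
    (hk : ∀ x, s.s₂ (s.s₃ x) = x ↔ x ∈ Set.range (algebraMap k K))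
    (hk4 : Module.finrank ℚ k = 4)
    (hm : m % 4 = 1) (hn : n % 4 = 3) (hn' : Squarefree n) (hmn : m.Coprime n) {x y : ℚ}
    (hN : x ^ 2 - (m * n : ℕ) * y ^ 2 = 1) (hε : IsAlgUnit (x + y * (a * b) : K))
    (hfund : ∀ r t, UnitCoords (m * n) r t → ∃ j : ℤ,
      (r + t * (a * b) : K) = (x + y * (a * b)) ^ j ∨
        (r + t * (a * b) : K) = -(x + y * (a * b)) ^ j)
    (hx : 0 < x) (hD : ¬ (IsSquare (2 * x + 2) ∨ IsSquare ((2 * x + 2) * (m * n : ℕ)))) :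
    let sq := IsSquare (2 * (2 * x + 2)) ∨ IsSquare (2 * (2 * x + 2) * (m * n : ℕ))
    (IsAllowed m n (2 * x + 2) 1 0 → IsAllowed m n (2 * x + 2) 0 1 → ¬ sq →
      Nat.card (capitulationKernel k K) = 2) ∧
    (IsAllowed m n (2 * x + 2) 1 0 → sq → Nat.card (capitulationKernel k K) = 4) ∧
    (¬ IsAllowed m n (2 * x + 2) 1 0 → sq → Nat.card (capitulationKernel k K) = 8) ∧
    ((IsAllowed m n (2 * x + 2) 1 0 ∨ IsAllowed m n (2 * x + 2) 0 1 ∨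
        IsAllowed m n (2 * x + 2) 1 1) →
      ¬ (IsAllowed m n (2 * x + 2) 1 0 ∧ IsAllowed m n (2 * x + 2) 0 1) → ¬ sq →
      Nat.card (capitulationKernel k K) = 4) := by
  intro sq
  set H := (unitIncl (𝓞 k) (𝓞 K)).range.map (powMonoidHom 2) with hH
  set G := (unitNorm (intConj s hk)).range with hG
  have hcard : Nat.card (capitulationKernel k K) * H.relIndex G = 8 := by
    have h1 := card_capitulationKernel_mul (intConj s hk) (intConj_intConj s hk)
      (exists_of_intConj_eq s hk) (span_intConj h s hk hm hn hmn)
    obtain ⟨J, hJ⟩ := (hk I).mp (by rw [s.s₃I, s.s₂I])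
    have hJ2 : J ^ 2 = -1 := by
      apply (algebraMap k K).injective
      rw [map_pow, hJ, h.I_sq, map_neg, map_one]
    rw [rank_eq_of_I h.I_sq, rank_eq_of_I hJ2, h.finrank_eq, hk4] at h1
    exact h1
  obtain ⟨α, hα⟩ := h.isAlgUnit_I.exists_unit
  obtain ⟨β, hβ⟩ := hε.exists_unit
  have hcoe : ∀ e t : ℕ, (((α ^ e * β ^ t : (𝓞 K)ˣ) : 𝓞 K) : K) =
      I ^ e * (x + y * (a * b)) ^ t := by
    intro e t
    rw [← hα, ← hβ]
    push_cast
    rfl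
  have hGiff : ∀ e t : ℕ, α ^ e * β ^ t ∈ G ↔ IsAllowed m n (2 * x + 2) e t := by
    intro e t
    rw [hG, mem_range_unitNorm_iff, hcoe]
    constructor
    · rintro ⟨u, hu, hue⟩
      exact isAllowed_of_norm h s hm hn hn' hN hε hfund hx hu hue
    · rintro ⟨D₁, D₂, hD1, hD2, hsq⟩
      exact exists_unit_of_class h s hN hε hx hD1 hD2 hsq
  have hHiff : ∀ e t : ℕ, α ^ e * β ^ t ∈ H ↔
      (IsSquare (2 ^ e * (2 * x + 2) ^ t) ∨
        IsSquare (2 ^ e * (2 * x + 2) ^ t * (m * n : ℕ))) := by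
    intro e t
    rw [hH, mem_squares_iff s hk, hcoe]
    exact exists_sqrt_fixed_iff h s hN hε hx e t
  have hHG : H ≤ G := by
    intro g hg
    rw [hH, mem_squares_iff s hk] at hg
    obtain ⟨w, hw, hσ, hwg⟩ := hg
    rw [hG, mem_range_unitNorm_iff]
    exact ⟨w, hw, by rw [hσ, ← hwg, pow_two]⟩
  have hα2 : α ^ 2 ∈ H := by
    have := (hHiff 2 0).mpr (Or.inl ⟨2, by norm_num⟩)
    simpa using this
  have hαH : α ∉ H := by
    intro h0
    rw [hH, mem_squares_iff s hk, hα] at h0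
    obtain ⟨w, hw, -, hw2⟩ := h0
    -- If `w² = I`, then `(1 + I) / w` is a square root of 2.
    refine two_ne_sq h (by omega) (by omega) ((1 + I) / w) ?_
    rw [div_pow, ← two_mul_I h, hw2, mul_div_cancel_right₀ _ h.I_ne]
  have hβH : β ∉ H := by
    have := hHiff 0 1
    simp only [pow_zero, pow_one, one_mul] at this
    rw [this]; exact hD
  have hαβH : α * β ∈ H ↔ sq := by
    have := hHiff 1 1
    simp only [pow_one] at this
    exact this
  have hαG : α ∈ G ↔ IsAllowed m n (2 * x + 2) 1 0 := by
    have := hGiff 1 0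
    simpa only [pow_zero, pow_one, mul_one] using this
  have hβG : β ∈ G ↔ IsAllowed m n (2 * x + 2) 0 1 := by
    have := hGiff 0 1
    simpa only [pow_zero, pow_one, one_mul] using this
  have hαβG : α * β ∈ G ↔ IsAllowed m n (2 * x + 2) 1 1 := by
    have := hGiff 1 1
    simpa only [pow_one] using this
  -- This holds for norms but can fail for units of `k`: when `Iε` is a square, its root is a unit
  -- of `k` outside these cosets.
  have hcov : ∀ g ∈ G, ∃ e t : ℕ, e < 2 ∧ t < 2 ∧ g * (α ^ e * β ^ t) ∈ H := by
    intro g hg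
    rw [hG, mem_range_unitNorm_iff] at hg
    obtain ⟨u, hu, hug⟩ := hg
    obtain ⟨M, e, t, hM, he, ht, ⟨w, hw, hσw, hw2⟩, -⟩ :=
      norm_unit_class h s (by omega) hn hn' hN hε hfund hx hu
    refine ⟨e, t, he, ht, ?_⟩
    rw [hH, mem_squares_iff s hk]
    obtain ⟨N, rfl⟩ : ∃ N, M = 2 * N + 1 := ⟨M / 2, by omega⟩
    have hgu := IsAlgUnit.unit_coe g
    have hσg : s.s₂ (s.s₃ ((g : 𝓞 K) : K)) = ((g : 𝓞 K) : K) := by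
      rw [← hug, map_mul, map_mul, s.s₃s₂, s.s₃s₃, s.s₂s₂, mul_comm]
    rw [hug] at hw2
    refine ⟨((g : 𝓞 K) : K) ^ (N + 1) / w, (hgu.pow _).div hw, ?_, ?_⟩
    · rw [map_div₀, map_div₀, map_pow, map_pow, hσg, hσw]
    · have hprod : (((g * (α ^ e * β ^ t) : (𝓞 K)ˣ) : 𝓞 K) : K) =
          ((g : 𝓞 K) : K) * (I ^ e * (x + y * (a * b)) ^ t) := by rw [← hcoe]; rfl
      rw [div_pow, div_eq_iff (pow_ne_zero 2 hw.1), hprod]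
      calc (((g : 𝓞 K) : K) ^ (N + 1)) ^ 2 =
          ((g : 𝓞 K) : K) * ((g : 𝓞 K) : K) ^ (2 * N + 1) := by ring
        _ = _ := by rw [hw2]; ring
  refine ⟨fun h1 h2 h3 => ?_, fun h1 h2 => ?_, fun h1 h2 => ?_, fun h1 h2 h3 => ?_⟩
  · rw [relIndex_eq_four_of_cosets hHG hα2 hαH hβH (by rwa [hαβH]) (hαG.mpr h1) (hβG.mpr h2)
      hcov] at hcard
    omega
  · rw [relIndex_eq_two_of_cosets hα2 hαH (hαβH.mpr h2) (hαG.mpr h1) hcov] at hcard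
    omega
  · rw [relIndex_eq_one_of_cosets hHG (hαβH.mpr h2) (by rwa [hαG]) hcov] at hcard
    omega
  · rw [relIndex_eq_two_of_single hHG hαH hβH (by rwa [hαβH]) (by rwa [hαG, hβG, hαβG])
      (by rwa [hαG, hβG]) hcov] at hcard
    omega

end

/-! ### Parities of valuations of rational numbers and of unit classes. -/

/-- The parity of the `ℓ`-adic valuation of a rational number. -/
def par (ℓ : ℕ) (r : ℚ) : ZMod 2 := (padicValRat ℓ r : ZMod 2)

section Parity

variable {ℓ : ℕ}

theorem par_mul [Fact ℓ.Prime] {r s : ℚ} (hr : r ≠ 0) (hs : s ≠ 0) :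
    par ℓ (r * s) = par ℓ r + par ℓ s := by
  rw [par, padicValRat.mul hr hs]; push_cast; rfl

theorem par_pow [Fact ℓ.Prime] {r : ℚ} (e : ℕ) : par ℓ (r ^ e) = e * par ℓ r := by
  rw [par, padicValRat.pow]; push_cast; rfl

theorem par_sq [Fact ℓ.Prime] (r : ℚ) : par ℓ (r ^ 2) = 0 := by
  rw [par_pow]
  have : ((2 : ℕ) : ZMod 2) = 0 := rfl
  rw [this, zero_mul]

theorem par_self [Fact ℓ.Prime] : par ℓ (ℓ : ℚ) = 1 := by
  rw [par, padicValRat.self (Nat.Prime.one_lt Fact.out)]; rfl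

theorem par_int_of_not_dvd {z : ℤ} (h : ¬ (ℓ : ℤ) ∣ z) : par ℓ (z : ℚ) = 0 := by
  rw [par, padicValRat.of_int, padicValInt.eq_zero_of_not_dvd h]; rfl

theorem par_nat_of_not_dvd {c : ℕ} (h : ¬ ℓ ∣ c) : par ℓ (c : ℚ) = 0 := by
  have := par_int_of_not_dvd (ℓ := ℓ) (z := (c : ℤ)) (by exact_mod_cast h)
  simpa using this

theorem par_prime_of_ne [Fact ℓ.Prime] {p : ℕ} (hp : p.Prime) (h : ℓ ≠ p) :
    par ℓ (p : ℚ) = 0 :=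
  par_nat_of_not_dvd fun hd => h ((Nat.prime_dvd_prime_iff_eq Fact.out hp).mp hd)

theorem nat_isSquare_of_par {N : ℕ} (hN : N ≠ 0)
    (h : ∀ ℓ : ℕ, ℓ.Prime → par ℓ (N : ℚ) = 0) : IsSquare N := by
  obtain ⟨a, b, hab, ha⟩ := Nat.sq_mul_squarefree N
  have hb0 : b ≠ 0 := by rintro rfl; simp at hab; exact hN hab.symm
  have ha0 : a ≠ 0 := by rintro rfl; simp at hab; exact hN hab.symm
  have ha1 : a = 1 := by
    by_contra hne
    obtain ⟨ℓ, hℓ, c, rfl⟩ := Nat.exists_prime_and_dvd hne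
    have : Fact ℓ.Prime := ⟨hℓ⟩
    have hc : ¬ ℓ ∣ c := by
      rintro ⟨c', rfl⟩
      have := ha ℓ ⟨c', by ring⟩
      exact hℓ.one_lt.ne' (Nat.isUnit_iff.mp this)
    have hc0 : (c : ℚ) ≠ 0 := by
      have : c ≠ 0 := by rintro rfl; simp at ha0
      exact_mod_cast this
    have h1 := h ℓ hℓ
    rw [← hab] at h1
    push_cast at h1
    rw [par_mul (by positivity) (mul_ne_zero (by exact_mod_cast hℓ.ne_zero) hc0), par_sq,
      par_mul (by exact_mod_cast hℓ.ne_zero) hc0, par_self, par_nat_of_not_dvd hc] at h1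
    exact absurd h1 (by decide)
  exact ⟨b, by rw [← hab, ha1]; ring⟩

theorem isSquare_iff_par {r : ℚ} (hr : 0 < r) :
    IsSquare r ↔ ∀ ℓ : ℕ, ℓ.Prime → par ℓ r = 0 := by
  constructor
  · rintro ⟨s, rfl⟩ ℓ hℓ
    have : Fact ℓ.Prime := ⟨hℓ⟩
    rw [← pow_two, par_sq]
  · intro h
    have hden : (r.den : ℚ) ≠ 0 := by exact_mod_cast r.den_ne_zero
    have hnum : 0 < r.num := Rat.num_pos.mpr hr
    have hN : (r.num.natAbs * r.den : ℕ) ≠ 0 :=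
      mul_ne_zero (Int.natAbs_ne_zero.mpr hnum.ne') r.den_ne_zero
    have hcast : ((r.num.natAbs * r.den : ℕ) : ℚ) = r * (r.den : ℚ) ^ 2 := by
      have h1 : ((r.num.natAbs : ℕ) : ℚ) = r.num := by
        rw [Nat.cast_natAbs, abs_of_pos hnum]
      have h2 : r * r.den = r.num := Rat.mul_den_eq_num r
      rw [Nat.cast_mul, h1, ← h2]; ring
    obtain ⟨k, hk⟩ := nat_isSquare_of_par hN (by
      intro ℓ hℓ
      have : Fact ℓ.Prime := ⟨hℓ⟩
      rw [hcast, par_mul hr.ne' (pow_ne_zero 2 hden), par_sq, h ℓ hℓ, add_zero])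
    refine ⟨k / r.den, ?_⟩
    rw [hk] at hcast
    push_cast at hcast
    field_simp
    linear_combination -hcast

end Parity

/-- `2 r + 2` for a unit of norm one has even valuation away from `2` and `c`. -/
theorem IsUnitClass.par_eq_zero {c ℓ : ℕ} [hℓ : Fact ℓ.Prime] {D : ℚ} (h : IsUnitClass c D)
    (h2 : ℓ ≠ 2) (hc : ¬ ℓ ∣ c) : par ℓ D = 0 := by
  obtain ⟨r, t, ⟨X, hX⟩, hN, hr, rfl⟩ := h
  have hD : (2 * r + 2 : ℚ) = ((X + 2 : ℤ) : ℚ) := by push_cast; rw [hX]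
  have hD' : (2 * r - 2 : ℚ) = ((X - 2 : ℤ) : ℚ) := by push_cast; rw [hX]
  by_cases hdvd : (ℓ : ℤ) ∣ X + 2
  -- The factors of `(X + 2)(X - 2) = c(2t)²` differ by 4, so an odd prime divides at most one of
  -- them.
  · have hnd : ¬ (ℓ : ℤ) ∣ X - 2 := by
      intro hd
      have h4 : (ℓ : ℤ) ∣ 4 := by
        have := dvd_sub hdvd hd
        ring_nf at this
        exact this
      have h4' : ℓ ∣ 2 ^ 2 := by exact_mod_cast h4
      exact h2 ((Nat.prime_dvd_prime_iff_eq hℓ.out Nat.prime_two).mp (hℓ.out.dvd_of_dvd_pow h4'))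
    have hp0 : (2 * r - 2 : ℚ) ≠ 0 := by
      rw [hD']; intro h0
      have : X - 2 = 0 := by exact_mod_cast h0
      rw [this] at hnd
      exact hnd (dvd_zero _)
    have hq0 : (2 * r + 2 : ℚ) ≠ 0 := by linarith
    have hprod : (2 * r + 2) * (2 * r - 2) = c * (2 * t) ^ 2 := by linear_combination 4 * hN
    have hcT : (c : ℚ) * (2 * t) ^ 2 ≠ 0 := by rw [← hprod]; exact mul_ne_zero hq0 hp0
    have h1 := congrArg (par ℓ) hprod
    rw [par_mul hq0 hp0, par_mul (left_ne_zero_of_mul hcT) (right_ne_zero_of_mul hcT), par_sq,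
      par_nat_of_not_dvd hc, hD', par_int_of_not_dvd hnd] at h1
    simpa using h1
  · rw [hD, par_int_of_not_dvd hdvd]

/-- If `X = 2r` is odd, so is `D`. Otherwise congruences modulo 4 give `D = 4F` with `F(F - 1) =
cT²`, and of two consecutive integers only one is even. -/
theorem IsUnitClass.par_two_eq_zero {c : ℕ} {D : ℚ} (h : IsUnitClass c D)
    (hc : c % 4 = 1) (hc' : Squarefree c) : par 2 D = 0 := by
  obtain ⟨r, t, ⟨X, hX⟩, hN, hr, rfl⟩ := h
  have hD : (2 * r + 2 : ℚ) = ((X + 2 : ℤ) : ℚ) := by push_cast; rw [hX]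
  have hprod : (c : ℚ) * (2 * t) ^ 2 = (((X + 2) * (X - 2) : ℤ) : ℚ) := by
    push_cast; rw [← hX]; linear_combination (-4) * hN
  obtain ⟨T, hT⟩ := exists_int_of_squarefree hc' hprod
  rw [hT] at hprod
  have hZ : (c : ℤ) * T ^ 2 = (X + 2) * (X - 2) := by exact_mod_cast hprod
  have hXpos : 0 < X := by
    have : (0 : ℚ) < X := by rw [← hX]; linarith
    exact_mod_cast this
  by_cases hodd : X % 2 = 1
  · rw [hD]
    apply par_int_of_not_dvd
    intro hd
    push_cast at hd
    omega
  · obtain ⟨E, rfl⟩ : ∃ E, X = 2 * E := ⟨X / 2, by omega⟩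
    obtain ⟨c', hc'⟩ : ∃ c' : ℤ, (c : ℤ) = 4 * c' + 1 := ⟨(c : ℤ) / 4, by omega⟩
    have hTe : T % 2 = 0 := by
      rcases Int.emod_two_eq_zero_or_one T with h | h
      · exact h
      · exfalso
        obtain ⟨j, rfl⟩ : ∃ j, T = 2 * j + 1 := ⟨T / 2, by omega⟩
        rw [hc'] at hZ
        have : 2 * (8 * c' * j ^ 2 + 8 * c' * j + 2 * c' + 2 * j ^ 2 + 2 * j - 2 * E ^ 2 + 2) = -1 := by
          linear_combination hZ
        omega
    obtain ⟨T, rfl⟩ : ∃ j, T = 2 * j := ⟨T / 2, by omega⟩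
    have hZ2 : (c : ℤ) * T ^ 2 = (E + 1) * (E - 1) := by
      have : 4 * ((c : ℤ) * T ^ 2) = 4 * ((E + 1) * (E - 1)) := by linear_combination hZ
      omega
    have hEo : E % 2 = 1 := by
      rcases Int.emod_two_eq_zero_or_one E with h | h
      · exfalso
        obtain ⟨F, rfl⟩ : ∃ j, E = 2 * j := ⟨E / 2, by omega⟩
        rw [hc'] at hZ2
        rcases Int.emod_two_eq_zero_or_one T with h' | h'
        · obtain ⟨j, rfl⟩ : ∃ j, T = 2 * j := ⟨T / 2, by omega⟩
          have : 4 * (4 * c' * j ^ 2 + j ^ 2 - F ^ 2) = -1 := by linear_combination hZ2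
          omega
        · obtain ⟨j, rfl⟩ : ∃ j, T = 2 * j + 1 := ⟨T / 2, by omega⟩
          have : 4 * (4 * c' * j ^ 2 + 4 * c' * j + c' + j ^ 2 + j - F ^ 2) = -2 := by
            linear_combination hZ2
          omega
      · exact h
    obtain ⟨F, rfl⟩ : ∃ F, E = 2 * F - 1 := ⟨(E + 1) / 2, by omega⟩
    have hD4 : (2 * r + 2 : ℚ) = (2 : ℚ) ^ 2 * (F : ℤ) := by rw [hD]; push_cast; ring
    have hTe : T % 2 = 0 := by
      rcases Int.emod_two_eq_zero_or_one T with h | h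
      · exact h
      · exfalso
        obtain ⟨j, rfl⟩ : ∃ j, T = 2 * j + 1 := ⟨T / 2, by omega⟩
        rw [hc'] at hZ2
        have : 2 * (8 * c' * j ^ 2 + 8 * c' * j + 2 * c' + 2 * j ^ 2 + 2 * j - 2 * F ^ 2 + 2 * F) = -1 := by
          linear_combination hZ2
        omega
    obtain ⟨T, rfl⟩ : ∃ j, T = 2 * j := ⟨T / 2, by omega⟩
    have hZ3 : (F : ℤ) * (F - 1) = c * T ^ 2 := by
      have : 4 * ((c : ℤ) * T ^ 2) = 4 * (F * (F - 1)) := by linear_combination hZ2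
      omega
    have hF0 : (F : ℚ) ≠ 0 := by
      have : F ≠ 0 := by omega
      exact_mod_cast this
    rw [hD4, par_mul (by norm_num) hF0, par_sq, zero_add]
    by_cases hFe : F % 2 = 0
    · have hF1 : (F : ℤ) - 1 ≠ 0 := by omega
      have hF1' : ((F - 1 : ℤ) : ℚ) ≠ 0 := by exact_mod_cast hF1
      have hq : (F : ℚ) * ((F - 1 : ℤ) : ℚ) = ((c : ℕ) : ℚ) * (T : ℚ) ^ 2 := by exact_mod_cast hZ3
      have hne : ((c : ℕ) : ℚ) * (T : ℚ) ^ 2 ≠ 0 := by rw [← hq]; exact mul_ne_zero hF0 hF1'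
      have h1 := congrArg (par 2) hq
      rw [par_mul hF0 hF1', par_mul (left_ne_zero_of_mul hne) (right_ne_zero_of_mul hne), par_sq,
        par_nat_of_not_dvd (by omega), par_int_of_not_dvd (z := F - 1) (by push_cast; omega)] at h1
      simpa using h1
    · exact par_int_of_not_dvd (by push_cast; omega)

/-! ### Units of real quadratic fields in coordinates. -/

section RealQuadratic

variable {c : ℕ}

theorem sqrt_natCast_sq (c : ℕ) : (√(c : ℝ)) ^ 2 = c := Real.sq_sqrt (Nat.cast_nonneg c)

theorem coords_unique (hc : ¬ IsSquare c) {A B A' B' : ℚ}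
    (h : (A : ℝ) + B * √(c : ℝ) = A' + B' * √(c : ℝ)) : A = A' ∧ B = B' := by
  have hirr : Irrational √(c : ℝ) := irrational_sqrt_natCast_iff.mpr hc
  by_cases hB : B = B'
  · refine ⟨?_, hB⟩
    rw [hB] at h
    exact_mod_cast add_right_cancel h
  · exfalso
    have hB' : (B : ℝ) - B' ≠ 0 := by
      intro h0
      exact hB (by exact_mod_cast sub_eq_zero.mp h0)
    apply hirr
    refine ⟨(A' - A) / (B - B'), ?_⟩
    push_cast
    rw [div_eq_iff hB']
    linear_combination -h

theorem exists_coords_of_mem (hc : ¬ IsSquare c) {w : ℝ} (hw : w ∈ realQuadratic c) :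
    ∃ A B : ℚ, w = A + B * √(c : ℝ) := by
  have hs := sqrt_natCast_sq c
  induction hw using IntermediateField.adjoin_induction with
  | mem x hx =>
    rw [Set.mem_singleton_iff] at hx
    exact ⟨0, 1, by rw [hx]; simp⟩
  | algebraMap r => exact ⟨r, 0, by simp⟩
  | add x y _ _ hx hy =>
    obtain ⟨A, B, rfl⟩ := hx
    obtain ⟨A', B', rfl⟩ := hy
    exact ⟨A + A', B + B', by push_cast; ring⟩
  | inv x _ hx =>
    obtain ⟨A, B, rfl⟩ := hx
    refine ⟨A / (A ^ 2 - c * B ^ 2), -B / (A ^ 2 - c * B ^ 2), ?_⟩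
    by_cases h0 : (A : ℝ) + B * √(c : ℝ) = 0
    · have := coords_unique hc (A := A) (B := B) (A' := 0) (B' := 0) (by rw [h0]; simp)
      rw [h0, this.1, this.2]; simp
    · have h1 : (A : ℝ) - B * √(c : ℝ) ≠ 0 := by
        intro h1
        have := coords_unique hc (A := A) (B := -B) (A' := 0) (B' := 0) (by
          push_cast; linear_combination h1)
        apply h0
        rw [this.1, neg_eq_zero.mp this.2]; simp
      have h2 : ((A : ℝ) ^ 2 - c * B ^ 2) ≠ 0 := by
        have : (A : ℝ) ^ 2 - c * B ^ 2 = (A + B * √(c : ℝ)) * (A - B * √(c : ℝ)) := by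
          linear_combination (B : ℝ) ^ 2 * hs
        rw [this]; exact mul_ne_zero h0 h1
      push_cast
      apply inv_eq_of_mul_eq_one_right
      have e : ((A : ℝ) + B * √(c : ℝ)) * (A / (A ^ 2 - c * B ^ 2) +
          -B / (A ^ 2 - c * B ^ 2) * √(c : ℝ)) =
          (A ^ 2 - √(c : ℝ) ^ 2 * B ^ 2) / (A ^ 2 - c * B ^ 2) := by ring
      rw [e, hs, div_self h2]
  | mul x y _ _ hx hy =>
    obtain ⟨A, B, rfl⟩ := hx
    obtain ⟨A', B', rfl⟩ := hy
    refine ⟨A * A' + c * B * B', A * B' + A' * B, ?_⟩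
    push_cast
    linear_combination (B : ℝ) * B' * hs

theorem coords_mem (c : ℕ) (A B : ℚ) : (A : ℝ) + B * √(c : ℝ) ∈ realQuadratic c := by
  have h1 : √(c : ℝ) ∈ realQuadratic c := IntermediateField.mem_adjoin_simple_self ℚ _
  have h2 : ∀ r : ℚ, (r : ℝ) ∈ realQuadratic c := fun r => by
    simp
  exact add_mem (h2 A) (mul_mem (h2 B) h1)

/-- A rational number that is a square in `ℚ(√c)` is a square in `ℚ`, up to a factor `c`. -/
theorem isSquare_of_mem (hc : ¬ IsSquare c) {r : ℚ} {w : ℝ} (hw : w ∈ realQuadratic c)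
    (h : (r : ℝ) = w ^ 2) : IsSquare r ∨ IsSquare (r * c) := by
  obtain ⟨A, B, rfl⟩ := exists_coords_of_mem hc hw
  have hs := sqrt_natCast_sq c
  have := coords_unique hc (A := r) (B := 0) (A' := A ^ 2 + c * B ^ 2) (B' := 2 * A * B) (by
    push_cast
    rw [h]; linear_combination (B : ℝ) ^ 2 * hs)
  obtain ⟨h1, h2⟩ := this
  rcases mul_eq_zero.mp h2.symm with h3 | h3
  · have hA : A = 0 := by linarith
    right
    exact ⟨B * c, by rw [h1, hA]; ring⟩
  · left
    exact ⟨A, by rw [h1, h3]; ring⟩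

/-- An integer polynomial takes values `P + Q√c` and `P - Q√c` at conjugate arguments, so an
integral equation for one argument holds for the other. -/
theorem isAlgUnit_conj (hc : ¬ IsSquare c) {A B : ℚ}
    (h : IsAlgUnit ((A : ℝ) + B * √(c : ℝ))) : IsAlgUnit ((A : ℝ) - B * √(c : ℝ)) := by
  have hs := sqrt_natCast_sq c
  have key : ∀ A B : ℚ, IsIntegral ℤ ((A : ℝ) + B * √(c : ℝ)) →
      IsIntegral ℤ ((A : ℝ) - B * √(c : ℝ)) := by
    rintro A B ⟨p, hp, hpe⟩
    refine ⟨p, hp, ?_⟩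
    have hev : ∀ p : Polynomial ℤ, ∃ P Q : ℚ,
        Polynomial.eval₂ (algebraMap ℤ ℝ) ((A : ℝ) + B * √(c : ℝ)) p = P + Q * √(c : ℝ) ∧
        Polynomial.eval₂ (algebraMap ℤ ℝ) ((A : ℝ) - B * √(c : ℝ)) p = P - Q * √(c : ℝ) := by
      intro p
      induction p using Polynomial.induction_on with
      | C z => exact ⟨z, 0, by rw [Polynomial.eval₂_C]; simp, by rw [Polynomial.eval₂_C]; simp⟩
      | add p p' h h' =>
        obtain ⟨P, Q, h1, h2⟩ := h
        obtain ⟨P', Q', h1', h2'⟩ := h'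
        refine ⟨P + P', Q + Q', ?_, ?_⟩
        · rw [Polynomial.eval₂_add, h1, h1']; push_cast; ring
        · rw [Polynomial.eval₂_add, h2, h2']; push_cast; ring
      | monomial k z h =>
        obtain ⟨P, Q, h1, h2⟩ := h
        refine ⟨P * A + c * Q * B, P * B + Q * A, ?_, ?_⟩
        · rw [pow_succ, ← mul_assoc, Polynomial.eval₂_mul, h1, Polynomial.eval₂_X]; push_cast
          linear_combination (Q : ℝ) * B * hs
        · rw [pow_succ, ← mul_assoc, Polynomial.eval₂_mul, h2, Polynomial.eval₂_X]; push_cast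
          linear_combination (Q : ℝ) * B * hs
    obtain ⟨P, Q, h1, h2⟩ := hev p
    have := coords_unique hc (A := P) (B := Q) (A' := 0) (B' := 0) (by rw [← h1, hpe]; simp)
    rw [h2, this.1, this.2]; simp
  have h0 : (A : ℝ) - B * √(c : ℝ) ≠ 0 := by
    intro h1
    have := coords_unique hc (A := A) (B := -B) (A' := 0) (B' := 0) (by
      push_cast; linear_combination h1)
    apply h.ne_zero
    rw [this.1, neg_eq_zero.mp this.2]; simp
  refine ⟨h0, key A B h.isIntegral, ?_⟩
  obtain ⟨A', B', hA⟩ := exists_coords_of_mem hc ((realQuadratic c).inv_mem (coords_mem c A B))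
  have hi := h.isIntegral_inv
  rw [hA] at hi
  have h1 : ((A : ℝ) + B * √(c : ℝ)) * (A' + B' * √(c : ℝ)) = 1 := by
    rw [← hA, mul_inv_cancel₀ h.ne_zero]
  have := coords_unique hc (A := A * A' + c * B * B') (B := A * B' + A' * B) (A' := 1) (B' := 0) (by
    push_cast
    linear_combination h1 - (B : ℝ) * B' * hs)
  have h2 : ((A * A' + c * B * B' : ℚ) : ℝ) = 1 := by rw [this.1]; simp
  have h3 : ((A * B' + A' * B : ℚ) : ℝ) = 0 := by rw [this.2]; simp
  push_cast at h2 h3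
  have h4 : ((A : ℝ) - B * √(c : ℝ))⁻¹ = A' - B' * √(c : ℝ) := by
    apply inv_eq_of_mul_eq_one_right
    linear_combination h2 - √(c : ℝ) * h3 + (B : ℝ) * B' * hs
  rw [h4]
  exact key A' B' hi

/-- `x + y√c > 1` generates the units of `ℚ(√c)` up to sign. -/
structure FundCoords (c : ℕ) (x y : ℚ) : Prop where
  unit : UnitCoords c x y
  one_lt : 1 < (x : ℝ) + y * √(c : ℝ)
  gen : ∀ r t, UnitCoords c r t → ∃ j : ℤ, (r + t * √(c : ℝ) : ℝ) = (x + y * √(c : ℝ)) ^ j ∨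
    (r + t * √(c : ℝ) : ℝ) = -(x + y * √(c : ℝ)) ^ j

instance (c : ℕ) : FiniteDimensional ℚ (realQuadratic c) :=
  IntermediateField.adjoin.finiteDimensional (IsIntegral.of_pow two_pos (by
    rw [sqrt_natCast_sq]
    have := isIntegral_algebraMap (R := ℚ) (A := ℝ) (x := (c : ℚ))
    rwa [map_natCast] at this))

instance (c : ℕ) : NumberField (realQuadratic c) where
  to_charZero := inferInstance
  to_finiteDimensional := inferInstance

theorem IsFundamentalUnit.fundCoords (hc : ¬ IsSquare c) {ε : (𝓞 (realQuadratic c))ˣ}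
    (hε : IsFundamentalUnit ε) {x y : ℚ} (hxy : HasCoords ε x y) : FundCoords c x y := by
  have hs := sqrt_natCast_sq c
  have hu : IsAlgUnit ((x : ℝ) + y * √(c : ℝ)) := by
    rw [← hxy]
    exact (IsAlgUnit.unit_coe ε).map (realQuadratic c).val.toRingHom
  refine ⟨UnitCoords.of_conj hs hu (isAlgUnit_conj hc hu), by rw [← hxy]; exact hε.1, ?_⟩
  intro r t hrt
  have hv : IsAlgUnit (⟨_, coords_mem c r t⟩ : realQuadratic c) :=
    IsAlgUnit.of_map (realQuadratic c).val.toRingHom (hrt.isAlgUnit hs)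
  obtain ⟨u, hu⟩ := hv.exists_unit
  have hu' : (((u : 𝓞 (realQuadratic c)) : realQuadratic c) : ℝ) = r + t * √(c : ℝ) := by rw [hu]
  have hpow : ∀ j : ℤ, ((((ε ^ j : (𝓞 (realQuadratic c))ˣ) : 𝓞 (realQuadratic c)) :
      realQuadratic c) : ℝ) = (x + y * √(c : ℝ)) ^ j := by
    intro j
    rw [← hxy]
    let f : 𝓞 (realQuadratic c) →* ℝ :=
      ((realQuadratic c).val.toRingHom.comp (algebraMap (𝓞 (realQuadratic c)) _) : _ →+* ℝ)
    have := Units.val_zpow_eq_zpow_val (Units.map f ε) j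
    rw [← map_zpow] at this
    exact this
  obtain ⟨j, hj | hj⟩ := hε.2 u
  · exact ⟨j, Or.inl (by rw [← hu', ← hpow, hj])⟩
  · refine ⟨j, Or.inr ?_⟩
    rw [← hu', ← hpow, hj]
    simp

theorem exists_hasCoords (hc : ¬ IsSquare c) (ε : (𝓞 (realQuadratic c))ˣ) :
    ∃ x y : ℚ, HasCoords ε x y := exists_coords_of_mem hc (Subtype.property _)

theorem rat_int_of_sq {r : ℚ} {Z : ℤ} (h : r ^ 2 = Z) : ∃ X : ℤ, r = X :=
  exists_int_of_squarefree (c := 1) squarefree_one (T := r) (Z := Z) (by simpa using h)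

namespace FundCoords

variable {x y : ℚ}

theorem pos (h : FundCoords c x y) (hN : x ^ 2 - c * y ^ 2 = 1) : 0 < x := by
  have hs := sqrt_natCast_sq c
  have hNR : (x : ℝ) ^ 2 - c * y ^ 2 = 1 := by exact_mod_cast hN
  have h1 := h.one_lt
  have h2 : ((x : ℝ) + y * √(c : ℝ)) * (x - y * √(c : ℝ)) = 1 := by
    linear_combination hNR - (y : ℝ) ^ 2 * hs
  have h3 : 0 < (x : ℝ) - y * √(c : ℝ) := by
    by_contra h3
    nlinarith
  have : (0 : ℝ) < x := by linarith
  exact_mod_cast this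

theorem ne_sq (h : FundCoords c x y) {r t : ℚ} (hrt : UnitCoords c r t) :
    ((r : ℝ) + t * √(c : ℝ)) ^ 2 ≠ x + y * √(c : ℝ) := by
  intro h2
  have h0 : (0 : ℝ) < x + y * √(c : ℝ) := zero_lt_one.trans h.one_lt
  have : ∃ j : ℤ, ((x : ℝ) + y * √(c : ℝ)) ^ (j * 2) = (x + y * √(c : ℝ)) ^ (1 : ℤ) := by
    obtain ⟨j, hj | hj⟩ := h.gen r t hrt
    · refine ⟨j, ?_⟩
      rw [zpow_mul, ← hj, zpow_one, ← h2]; norm_cast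
    · refine ⟨j, ?_⟩
      have hj' : (x + y * √(c : ℝ)) ^ j = -((r : ℝ) + t * √(c : ℝ)) := by rw [hj]; ring
      rw [zpow_mul, hj', zpow_one, ← h2]
      exact neg_sq _
  obtain ⟨j, hj⟩ := this
  have := zpow_right_injective₀ h0 h.one_lt.ne' hj
  omega

/-- By `(2x + 2)ε = (1 + ε)²`, either alternative would make the fundamental unit a square in
`ℚ(√c)`. -/
theorem not_isSquare (h : FundCoords c x y) (hN : x ^ 2 - c * y ^ 2 = 1) :
    ¬ (IsSquare (2 * x + 2) ∨ IsSquare ((2 * x + 2) * c)) := by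
  have hx := h.pos hN
  obtain ⟨X, hX⟩ := h.unit.1
  have hs := sqrt_natCast_sq c
  have hsq : ((2 * x + 2 : ℚ) : ℝ) * (x + y * √(c : ℝ)) = (1 + (x + y * √(c : ℝ))) ^ 2 :=
    mul_eq_sq_of_norm_one hs hN
  rintro (⟨s, hD⟩ | ⟨s, hD⟩)
  · have hs0 : s ≠ 0 := by rintro rfl; linarith
    have hsR : (s : ℝ) ≠ 0 := by exact_mod_cast hs0
    apply h.ne_sq (r := (1 + x) / s) (t := y / s)
    · refine ⟨rat_int_of_sq (Z := X + 2) ?_, Or.inl ?_⟩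
      · push_cast; rw [← hX]; field_simp; linear_combination (x + 1) * hD
      · field_simp; linear_combination hD + hN
    · have : ((2 * x + 2 : ℚ) : ℝ) = s * s := by rw [hD]; push_cast; rfl
      rw [this] at hsq
      push_cast
      field_simp
      linear_combination -hsq
  · have hs0 : s ≠ 0 := by
      rintro rfl
      have hc0 : (c : ℚ) ≠ 0 := by
        intro hc0
        have h1 := h.one_lt
        have : c = 0 := by exact_mod_cast hc0
        subst this
        simp at hN h1
        rcases hN with rfl | rfl
        · simp at h1
        · linarith
      rcases mul_eq_zero.mp (hD.trans (mul_zero 0)) with h | h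
      · linarith
      · exact hc0 h
    have hsR : (s : ℝ) ≠ 0 := by exact_mod_cast hs0
    -- These are the coordinates of `√c (1 + ε) / s`, a square root of `ε` of norm `-1`.
    apply h.ne_sq (r := c * y / s) (t := (1 + x) / s)
    · refine ⟨rat_int_of_sq (Z := X - 2) ?_, Or.inr ?_⟩
      · push_cast; rw [← hX]; field_simp; linear_combination (x - 1) * hD - 2 * c * hN
      · field_simp; linear_combination (-1) * hD - c * hN
    · have : ((2 * x + 2 : ℚ) : ℝ) * c = s * s := by exact_mod_cast hD
      push_cast
      field_simp
      linear_combination (-(c : ℝ)) * hsq + (x + y * √(c : ℝ)) * this +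
        ((1 + (x : ℝ)) ^ 2 - c * y ^ 2) * hs

theorem exists_zpow (h : FundCoords c x y) {r t : ℚ} (hX : ∃ X : ℤ, 2 * r = X)
    (hN : r ^ 2 - c * t ^ 2 = 1) (hr : 0 < r) :
    ∃ j : ℤ, (r + t * √(c : ℝ) : ℝ) = (x + y * √(c : ℝ)) ^ j := by
  obtain ⟨j, hj | hj⟩ := h.gen r t ⟨hX, Or.inl hN⟩
  · exact ⟨j, hj⟩
  · exfalso
    have h0 : (0 : ℝ) < (x + y * √(c : ℝ)) ^ j := zpow_pos (zero_lt_one.trans h.one_lt) j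
    have hs := sqrt_natCast_sq c
    have hNR : (r : ℝ) ^ 2 - c * t ^ 2 = 1 := by exact_mod_cast hN
    have h2 : ((r : ℝ) + t * √(c : ℝ)) * (r - t * √(c : ℝ)) = 1 := by
      linear_combination hNR - (t : ℝ) ^ 2 * hs
    have hr' : (0 : ℝ) < r := by exact_mod_cast hr
    nlinarith

/-- The classes of units of norm one are generated by the class of the fundamental unit. -/
theorem isUnitClass_cases (hc : ¬ IsSquare c) (h : FundCoords c x y) (hN : x ^ 2 - c * y ^ 2 = 1)
    {D : ℚ} (hD : IsUnitClass c D) :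
    (IsSquare D ∨ IsSquare (D * c)) ∨
      (IsSquare (D * (2 * x + 2)) ∨ IsSquare (D * (2 * x + 2) * c)) := by
  obtain ⟨r, t, hX, hNr, hr, rfl⟩ := hD
  have hs := sqrt_natCast_sq c
  have hε := zero_lt_one.trans h.one_lt
  have hsq := mul_eq_sq_of_norm_one hs hN
  have hsq' := mul_eq_sq_of_norm_one hs hNr
  have hm1 := coords_mem c x y
  have hm2 := coords_mem c r t
  obtain ⟨j, hj⟩ := h.exists_zpow hX hNr hr
  rw [hj] at hsq' hm2
  generalize ((x : ℝ) + y * √(c : ℝ)) = E at *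
  have h1 := (realQuadratic c).one_mem
  -- Modulo squares only the parity of the exponent counts: an even power has trivial class, an odd
  -- power that of `ε`.
  rcases Int.even_or_odd' j with ⟨i, rfl | rfl⟩
  · left
    refine isSquare_of_mem hc (w := (1 + E ^ (2 * i)) / E ^ i)
      (div_mem (add_mem h1 hm2) (zpow_mem hm1 i)) ?_
    rw [div_pow, ← hsq', ← zpow_natCast (E ^ i), ← zpow_mul, mul_comm i]
    have := zpow_pos hε (2 * i)
    field_simp
    norm_cast
  · right
    refine isSquare_of_mem hc (w := (1 + E ^ (2 * i + 1)) * (1 + E) / E ^ (i + 1))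
      (div_mem (mul_mem (add_mem h1 hm2) (add_mem h1 hm1)) (zpow_mem hm1 _)) ?_
    rw [div_pow, mul_pow, ← hsq', ← hsq, ← zpow_natCast (E ^ (i + 1)), ← zpow_mul]
    have h3 : E ^ ((i + 1) * ((2 : ℕ) : ℤ)) = E ^ (2 * i + 1) * E := by
      rw [← zpow_add_one₀ hε.ne']; congr 1; push_cast; ring
    rw [h3, eq_div_iff (mul_pos (zpow_pos hε _) hε).ne', Rat.cast_mul]
    ring

/-- If the fundamental unit has norm `-1`, the classes of units of norm one are trivial. -/
theorem isUnitClass_of_neg (hc : ¬ IsSquare c) (h : FundCoords c x y)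
    (hN : x ^ 2 - c * y ^ 2 = -1) {D : ℚ} (hD : IsUnitClass c D) :
    IsSquare D ∨ IsSquare (D * c) := by
  have hD0 := hD.pos
  obtain ⟨r, t, hX, hNr, hr, rfl⟩ := hD
  have hs := sqrt_natCast_sq c
  have hε := zero_lt_one.trans h.one_lt
  have hsq' := mul_eq_sq_of_norm_one hs hNr
  have hm1 := coords_mem c x y
  have hm2 := coords_mem c r t
  obtain ⟨j, hj⟩ := h.exists_zpow hX hNr hr
  rw [hj] at hsq' hm2
  have h1 := (realQuadratic c).one_mem
  rcases Int.even_or_odd' j with ⟨i, rfl | rfl⟩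
  · generalize ((x : ℝ) + y * √(c : ℝ)) = E at *
    refine isSquare_of_mem hc (w := (1 + E ^ (2 * i)) / E ^ i)
      (div_mem (add_mem h1 hm2) (zpow_mem hm1 i)) ?_
    rw [div_pow, ← hsq', ← zpow_natCast (E ^ i), ← zpow_mul, mul_comm i]
    have := zpow_pos hε (2 * i)
    field_simp
    norm_cast
  -- An odd power would make `(2r + 2)ε` a square in `ℚ(√c)`. Its norm `-(2r + 2)²` would then be a
  -- rational square.
  · exfalso
    obtain ⟨A, B, hAB⟩ := exists_coords_of_mem hc
      (div_mem (add_mem h1 hm2) (zpow_mem hm1 i))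
    have h2 : ((2 * r + 2 : ℚ) : ℝ) * (x + y * √(c : ℝ)) = (A + B * √(c : ℝ)) ^ 2 := by
      rw [← hAB, div_pow, ← hsq', ← zpow_natCast ((x + y * √(c : ℝ)) ^ i), ← zpow_mul, mul_comm i,
        zpow_add_one₀ hε.ne']
      have := zpow_pos hε (2 * i)
      field_simp
      norm_cast
    have h3 := coords_unique hc (A := (2 * r + 2) * x) (B := (2 * r + 2) * y)
      (A' := A ^ 2 + c * B ^ 2) (B' := 2 * A * B) (by
        push_cast at h2 ⊢
        linear_combination h2 + (B : ℝ) ^ 2 * hs)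
    have h4 : (A ^ 2 - c * B ^ 2) ^ 2 = -(2 * r + 2) ^ 2 := by
      have e1 := h3.1
      have e2 := h3.2
      have : (A ^ 2 - c * B ^ 2) ^ 2 = (A ^ 2 + c * B ^ 2) ^ 2 - c * (2 * A * B) ^ 2 := by ring
      rw [this, ← e1, ← e2]
      linear_combination (2 * r + 2) ^ 2 * hN
    nlinarith [sq_nonneg (A ^ 2 - c * B ^ 2), pow_pos hD0 2]

/-- The fundamental property, transported to a field containing a square root of `c`. -/
theorem gen_of_ringHom (h : FundCoords c x y) {F : Type*} [Field F] [CharZero F] {z : F}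
    (f : F →+* ℂ) (hz : f z = ((√(c : ℝ) : ℝ) : ℂ)) (r t : ℚ) (hrt : UnitCoords c r t) :
    ∃ j : ℤ, (r + t * z : F) = (x + y * z) ^ j ∨ (r + t * z : F) = -(x + y * z) ^ j := by
  obtain ⟨j, hj⟩ := h.gen r t hrt
  refine ⟨j, hj.imp (fun hj => f.injective ?_) (fun hj => f.injective ?_)⟩
  · have := congrArg (fun u : ℝ => (u : ℂ)) hj
    push_cast at this
    simpa [hz] using this
  · have := congrArg (fun u : ℝ => (u : ℂ)) hj
    push_cast at this
    simpa [hz] using this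

end FundCoords

theorem norm_of_hasCoords (hc : ¬ IsSquare c) {ε : (𝓞 (realQuadratic c))ˣ} {x y : ℚ}
    (hxy : HasCoords ε x y) :
    Algebra.norm ℚ ((ε : 𝓞 (realQuadratic c)) : realQuadratic c) = x ^ 2 - c * y ^ 2 := by
  have hs := sqrt_natCast_sq c
  let z : realQuadratic c := ⟨√(c : ℝ), IntermediateField.mem_adjoin_simple_self ℚ _⟩
  have hz : z * z = (c : ℚ) • 1 := by
    apply Subtype.ext
    simp [z, Algebra.smul_def]
  have hli : LinearIndependent ℚ ![(1 : realQuadratic c), z] := by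
    rw [LinearIndependent.pair_iff]
    intro A B h
    have h' := congrArg (fun w : realQuadratic c => (w : ℝ)) h
    exact coords_unique hc (A := A) (B := B) (A' := 0) (B' := 0) (by
      simpa [z, Algebra.smul_def] using h')
  have hsp : ⊤ ≤ Submodule.span ℚ (Set.range ![(1 : realQuadratic c), z]) := by
    rintro w -
    obtain ⟨A, B, hw⟩ := exists_coords_of_mem hc w.2
    have : w = A • 1 + B • z := by
      apply Subtype.ext
      rw [hw]; simp [z, Algebra.smul_def]
    rw [this]
    exact add_mem (Submodule.smul_mem _ _ (Submodule.subset_span ⟨0, rfl⟩))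
      (Submodule.smul_mem _ _ (Submodule.subset_span ⟨1, rfl⟩))
  let β := Module.Basis.mk hli hsp
  have hβ0 : β 0 = 1 := by simp [β]
  have hβ1 : β 1 = z := by simp [β]
  have hε : ((ε : 𝓞 (realQuadratic c)) : realQuadratic c) = x • β 0 + y • β 1 := by
    apply Subtype.ext
    rw [hβ0, hβ1]
    rw [show (((ε : 𝓞 (realQuadratic c)) : realQuadratic c) : ℝ) = _ from hxy]
    simp [z, Algebra.smul_def]
  have e0 : (x • β 0 + y • β 1) * β 0 = x • β 0 + y • β 1 := by
    rw [hβ0, mul_one]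
  have e1 : (x • β 0 + y • β 1) * β 1 = (c * y) • β 0 + x • β 1 := by
    rw [hβ0, hβ1, add_mul, smul_mul_assoc, smul_mul_assoc, one_mul, hz, smul_smul, add_comm,
      mul_comm (c : ℚ)]
  rw [hε, Algebra.norm_eq_matrix_det β, Matrix.det_fin_two]
  simp only [Algebra.leftMulMatrix_eq_repr_mul, e0, e1]
  simp
  ring

end RealQuadratic

/-! ### Pell's equation for `q`, and the conditions on `c(x ± 1)` as square classes. -/

theorem isUnitClass_four (c : ℕ) : IsUnitClass c 4 :=
  ⟨1, 0, ⟨2, by norm_num⟩, by norm_num, one_pos, by norm_num⟩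

/-- For a prime `q ≡ 3` modulo `4`, the fundamental solution `x` of Pell's equation has the
valuation of `2x + 2` at `2` odd. -/
theorem exists_isUnitClass_par_two {q : ℕ} (hq : q.Prime) (hq4 : q % 4 = 3) :
    ∃ D, IsUnitClass q D ∧ par 2 D = 1 := by
  have hsq : ¬ IsSquare (q : ℤ) := by
    rw [Int.isSquare_natCast_iff]
    exact hq.prime.not_isSquare
  have : Fact q.Prime := ⟨hq⟩
  obtain ⟨a, ha⟩ := Pell.IsFundamental.exists_of_not_isSquare (d := (q : ℤ)) (by
    exact_mod_cast hq.pos) hsq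
  have hx1 := ha.1
  have hN : (a.x : ℚ) ^ 2 - q * a.y ^ 2 = 1 := by exact_mod_cast a.prop
  have hxQ : (1 : ℚ) < a.x := by exact_mod_cast hx1
  have hq0 : (0 : ℚ) < q := by exact_mod_cast hq.pos
  have hcl : IsUnitClass q (2 * a.x + 2) :=
    ⟨a.x, a.y, ⟨2 * a.x, by push_cast; rfl⟩, hN, by linarith, rfl⟩
  refine ⟨_, hcl, ?_⟩
  by_contra hne
  have h2 : par 2 (2 * a.x + 2 : ℚ) = 0 := by
    generalize par 2 (2 * a.x + 2 : ℚ) = α at hne ⊢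
    revert α; decide
  have hcases : IsSquare (2 * a.x + 2 : ℚ) ∨ IsSquare ((2 * a.x + 2 : ℚ) * q) := by
    have hD0 := hcl.pos
    have hpq : par q (2 * a.x + 2 : ℚ) = 0 ∨ par q (2 * a.x + 2 : ℚ) = 1 := by
      generalize par q (2 * a.x + 2 : ℚ) = α
      revert α; decide
    refine hpq.imp (fun h => (isSquare_iff_par hD0).mpr ?_)
      (fun h => (isSquare_iff_par (mul_pos hD0 hq0)).mpr ?_)
    · intro ℓ hℓ
      have : Fact ℓ.Prime := ⟨hℓ⟩
      by_cases hℓ2 : ℓ = 2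
      · rw [hℓ2, h2]
      by_cases hℓq : ℓ = q
      · rw [hℓq, h]
      exact hcl.par_eq_zero hℓ2 fun hd => hℓq ((Nat.prime_dvd_prime_iff_eq hℓ hq).mp hd)
    · intro ℓ hℓ
      have : Fact ℓ.Prime := ⟨hℓ⟩
      rw [par_mul hD0.ne' hq0.ne']
      by_cases hℓ2 : ℓ = 2
      · rw [hℓ2, h2, par_nat_of_not_dvd (by omega), add_zero]
      by_cases hℓq : ℓ = q
      · rw [hℓq, h, par_self]; decide
      rw [hcl.par_eq_zero hℓ2 fun hd => hℓq ((Nat.prime_dvd_prime_iff_eq hℓ hq).mp hd),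
        par_prime_of_ne hq hℓq, add_zero]
  rcases hcases with ⟨s, hs⟩ | ⟨s, hs⟩
  -- If `2x + 2` is a square, then `x = 2u² - 1` for a Pell solution with first coordinate `|u| <
  -- x`, against minimality.
  · obtain ⟨S, rfl⟩ := rat_int_of_sq (r := s) (Z := 2 * a.x + 2) (by push_cast; rw [hs]; ring)
    have hsZ : 2 * a.x + 2 = S * S := by exact_mod_cast hs
    obtain ⟨u, hu⟩ : (2 : ℤ) ∣ S := by
      have : (2 : ℤ) ∣ S * S := ⟨a.x + 1, by rw [← hsZ]; ring⟩
      exact (Int.prime_two.dvd_or_dvd this).elim id id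
    have hux : a.x + 1 = 2 * u ^ 2 := by rw [hu] at hsZ; linarith
    have huxQ : (a.x : ℚ) + 1 = 2 * u ^ 2 := by exact_mod_cast hux
    have hu0 : (u : ℚ) ≠ 0 := by
      intro h0
      rw [h0] at huxQ
      linarith
    have hw : (q : ℚ) * (a.y / (2 * u)) ^ 2 = ((u ^ 2 - 1 : ℤ) : ℚ) := by
      push_cast
      field_simp
      linear_combination (-1) * hN + (a.x - 1 : ℚ) * huxQ + 2 * (u : ℚ) ^ 2 * huxQ
    obtain ⟨w, hw'⟩ := exists_int_of_squarefree hq.prime.squarefree hw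
    rw [hw'] at hw
    have hwZ : (q : ℤ) * w ^ 2 = u ^ 2 - 1 := by exact_mod_cast hw
    have hu1 : 1 < |u| := by
      by_contra hle
      have h1 : |u| ≤ 1 := not_lt.mp hle
      have h3 : u ^ 2 ≤ 1 := by
        rw [← sq_abs]
        nlinarith [abs_nonneg u]
      omega
    have hmin := ha.x_le_x (a := Pell.Solution₁.mk |u| w (by rw [sq_abs]; linarith))
      (by rw [Pell.Solution₁.x_mk]; exact hu1)
    rw [Pell.Solution₁.x_mk] at hmin
    rw [← sq_abs] at hux
    nlinarith
  · have hs0 : s ≠ 0 := by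
      rintro rfl
      have := mul_pos hcl.pos hq0
      linarith
    have hy : (q : ℚ) * a.y ^ 2 = (a.x - 1) * (a.x + 1) := by linear_combination (-1) * hN
    have e1 : (q * a.y / s : ℚ) ^ 2 = (a.x - 1) / 2 := by
      rw [div_pow, div_eq_div_iff (pow_ne_zero 2 hs0) two_ne_zero]
      linear_combination (a.x - 1 : ℚ) * hs + 2 * q * hy
    have e2 : (q : ℚ) * (s / (2 * q)) ^ 2 = (a.x + 1) / 2 := by
      field_simp
      linear_combination (-1) * hs
    -- If `q(2x + 2) = s²`, the fundamental solution is the square of this unit of norm `-1`, which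
    -- `q ≡ 3` modulo 4 forbids.
    have hbad : UnitCoords q (q * a.y / s) (s / (2 * q)) := by
      refine ⟨rat_int_of_sq (Z := 2 * a.x - 2) ?_, Or.inr ?_⟩
      · push_cast
        field_simp
        linear_combination (a.x - 1 : ℚ) * hs - 2 * q * hN
      · rw [e1, e2]; ring
    have h1 := hbad.norm_eq_one hq.prime.squarefree hq4
    rw [e1, e2] at h1
    linarith

theorem isNatSquare_iff {r : ℚ} {Z : ℤ} (hr : r = Z) : IsNatSquare r ↔ IsSquare r := by
  constructor
  · rintro ⟨n, rfl⟩
    exact ⟨n, pow_two _⟩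
  · rintro ⟨s, hs⟩
    obtain ⟨S, rfl⟩ := rat_int_of_sq (r := s) (Z := Z) (by rw [← hr, hs]; ring)
    refine ⟨S.natAbs, ?_⟩
    rw [hs, Nat.cast_natAbs, ← pow_two]
    norm_cast
    rw [sq_abs]

theorem isSquare_mul_sq_iff {r s : ℚ} (hs : s ≠ 0) : IsSquare (r * s ^ 2) ↔ IsSquare r := by
  constructor
  · rintro ⟨u, hu⟩
    exact ⟨u / s, by field_simp; linear_combination hu⟩
  · rintro ⟨u, rfl⟩
    exact ⟨u * s, by ring⟩

/-- As `c ≡ 3` modulo 4, `x` is an integer, so rational squares suffice. Since `(x + 1)(x - 1) =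
cy²` with `y ≠ 0`, replacing `x + 1` by `x - 1` costs exactly a factor `c` up to squares. -/
theorem FundCoords.pmSquare_iff {c : ℕ} {x y : ℚ} (h : FundCoords c x y) (hc : Squarefree c)
    (hc4 : c % 4 = 3) {k : ℕ} (hk : 0 < k) :
    PMSquare k x ↔ IsSquare (k * (2 * (2 * x + 2))) ∨ IsSquare (k * (2 * (2 * x + 2)) * c) := by
  have hN := h.unit.norm_eq_one hc hc4
  have hx := h.pos hN
  obtain ⟨X, hX⟩ := h.unit.1
  have hk0 : (k : ℚ) ≠ 0 := by exact_mod_cast hk.ne'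
  have hc0 : (c : ℚ) ≠ 0 := by exact_mod_cast hc.ne_zero
  have hy : y ≠ 0 := by
    rintro rfl
    have h1 := h.one_lt
    have h2 : (x - 1) * (x + 1) = 0 := by linear_combination hN
    have h3 : x = 1 := by
      rcases mul_eq_zero.mp h2 with h | h <;> linarith
    rw [h3] at h1
    simp at h1
  obtain ⟨E, hE⟩ : ∃ E : ℤ, x = E := by
    have h1 : (c : ℚ) * (2 * y) ^ 2 = ((X ^ 2 - 4 : ℤ) : ℚ) := by
      push_cast
      rw [← hX]
      linear_combination (-4) * hN
    obtain ⟨Y, hY⟩ := exists_int_of_squarefree hc h1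
    rw [hY] at h1
    have h2 : (c : ℤ) * Y ^ 2 = X ^ 2 - 4 := by exact_mod_cast h1
    have hev : X % 2 = 0 := by
      have key : ∀ c X Y : ZMod 4, c = 3 → c * Y ^ 2 = X ^ 2 - 4 → X = 0 ∨ X = 2 := by decide
      have h3 := congrArg (fun z : ℤ => (z : ZMod 4)) h2
      push_cast at h3
      have h4 := key (c : ZMod 4) X Y (by rw [← ZMod.natCast_mod c 4, hc4]; rfl) h3
      rcases h4 with h4 | h4
      · have := (ZMod.intCast_zmod_eq_zero_iff_dvd X 4).mp h4
        omega
      · have h5 : ((X - 2 : ℤ) : ZMod 4) = 0 := by push_cast; rw [h4]; decide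
        have := (ZMod.intCast_zmod_eq_zero_iff_dvd _ 4).mp h5
        omega
    refine ⟨X / 2, ?_⟩
    have h3 : (X : ℚ) = 2 * (X / 2 : ℤ) := by exact_mod_cast (by omega : X = 2 * (X / 2))
    rw [h3] at hX
    linarith
  rw [PMSquare, isNatSquare_iff (Z := k * (E + 1)) (by rw [hE]; push_cast; ring),
    isNatSquare_iff (Z := k * (E - 1)) (by rw [hE]; push_cast; ring)]
  have e1 : (k * (2 * (2 * x + 2)) : ℚ) = k * (x + 1) * 2 ^ 2 := by ring
  have hx1 : x + 1 ≠ 0 := by linarith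
  rw [e1, isSquare_mul_sq_iff two_ne_zero]
  have e2 : (k * (x + 1) * 2 ^ 2 * c : ℚ) = k * (x - 1) * (2 * (x + 1) / y) ^ 2 := by
    field_simp
    linear_combination (-1) * hN
  rw [e2, isSquare_mul_sq_iff (div_ne_zero (mul_ne_zero two_ne_zero hx1) hy)]

/-! ### Parities at `2`, `p₁`, `p₂`, `q` and the case analysis. -/

/-- Two distinct primes congruent to `1` and a prime congruent to `3` modulo `4`. -/
structure PrimeTriple (p₁ p₂ q : ℕ) : Prop where
  prime₁ : p₁.Prime
  prime₂ : p₂.Prime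
  prime_q : q.Prime
  mod₁ : p₁ % 4 = 1
  mod₂ : p₂ % 4 = 1
  mod_q : q % 4 = 3
  ne : p₁ ≠ p₂

namespace PrimeTriple

variable {p₁ p₂ q : ℕ}

theorem swap (P : PrimeTriple p₁ p₂ q) : PrimeTriple p₂ p₁ q :=
  ⟨P.2, P.1, P.3, P.5, P.4, P.6, P.7.symm⟩

theorem ne₁ (P : PrimeTriple p₁ p₂ q) : p₁ ≠ q := by
  have := P.mod₁; have := P.mod_q; omega

theorem ne₂ (P : PrimeTriple p₁ p₂ q) : p₂ ≠ q := P.swap.ne₁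

theorem coprime₁₂ (P : PrimeTriple p₁ p₂ q) : p₁.Coprime p₂ :=
  (Nat.coprime_primes P.prime₁ P.prime₂).mpr P.ne

theorem coprime₁q (P : PrimeTriple p₁ p₂ q) : p₁.Coprime q :=
  (Nat.coprime_primes P.prime₁ P.prime_q).mpr P.ne₁

theorem coprime₂q (P : PrimeTriple p₁ p₂ q) : p₂.Coprime q := P.swap.coprime₁q

theorem squarefree₁₂ (P : PrimeTriple p₁ p₂ q) : Squarefree (p₁ * p₂) :=
  (Nat.squarefree_mul P.coprime₁₂).mpr ⟨P.prime₁.prime.squarefree, P.prime₂.prime.squarefree⟩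

theorem squarefree₂q (P : PrimeTriple p₁ p₂ q) : Squarefree (p₂ * q) :=
  (Nat.squarefree_mul P.coprime₂q).mpr ⟨P.prime₂.prime.squarefree, P.prime_q.prime.squarefree⟩

theorem squarefree (P : PrimeTriple p₁ p₂ q) : Squarefree (p₁ * p₂ * q) :=
  (Nat.squarefree_mul (Nat.Coprime.mul_left P.coprime₁q P.coprime₂q)).mpr
    ⟨P.squarefree₁₂, P.prime_q.prime.squarefree⟩

theorem mod₁₂ (P : PrimeTriple p₁ p₂ q) : p₁ * p₂ % 4 = 1 := by
  rw [Nat.mul_mod, P.mod₁, P.mod₂]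

theorem mod₂q (P : PrimeTriple p₁ p₂ q) : p₂ * q % 4 = 3 := by
  rw [Nat.mul_mod, P.mod₂, P.mod_q]

theorem mod (P : PrimeTriple p₁ p₂ q) : p₁ * p₂ * q % 4 = 3 := by
  rw [Nat.mul_mod, P.mod₁₂, P.mod_q]

theorem not_isSquare_of_mod {c : ℕ} (hc : c % 4 = 3) : ¬ IsSquare c := by
  rintro ⟨s, rfl⟩
  have h2 : s % 4 = 0 ∨ s % 4 = 1 ∨ s % 4 = 2 ∨ s % 4 = 3 := by omega
  rcases h2 with h | h | h | h <;> rw [Nat.mul_mod, h] at hc <;> omega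

theorem not_isSquare_of_squarefree {c : ℕ} (hc : Squarefree c) (h1 : c ≠ 1) : ¬ IsSquare c := by
  rintro ⟨s, rfl⟩
  have := Nat.isUnit_iff.mp (hc s dvd_rfl)
  exact h1 (by rw [this])

theorem not_isSquare₁₂ (P : PrimeTriple p₁ p₂ q) : ¬ IsSquare (p₁ * p₂) :=
  not_isSquare_of_squarefree P.squarefree₁₂ fun h =>
    P.prime₁.one_lt.ne' (Nat.eq_one_of_mul_eq_one_right h)

end PrimeTriple

/-- The positive rational number `r` has valuations of parities `α`, `β`, `γ`, `δ` at `2`, `p₁`,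
`p₂`, `q`, and of even parity at all other primes. -/
structure HasParities (p₁ p₂ q : ℕ) (r : ℚ) (α β γ δ : ZMod 2) : Prop where
  pos : 0 < r
  par_two : par 2 r = α
  par₁ : par p₁ r = β
  par₂ : par p₂ r = γ
  par_q : par q r = δ
  par_other : ∀ ℓ : ℕ, ℓ.Prime → ℓ ≠ 2 → ℓ ≠ p₁ → ℓ ≠ p₂ → ℓ ≠ q → par ℓ r = 0

section

variable {p₁ p₂ q : ℕ}

theorem zmod_two_cases (z : ZMod 2) : z = 0 ∨ z = 1 := by revert z; decide

theorem HasParities.mul (P : PrimeTriple p₁ p₂ q) {r s : ℚ} {α β γ δ α' β' γ' δ' : ZMod 2}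
    (hr : HasParities p₁ p₂ q r α β γ δ) (hs : HasParities p₁ p₂ q s α' β' γ' δ') :
    HasParities p₁ p₂ q (r * s) (α + α') (β + β') (γ + γ') (δ + δ') := by
  have h₁ : Fact p₁.Prime := ⟨P.prime₁⟩
  have h₂ : Fact p₂.Prime := ⟨P.prime₂⟩
  have hq : Fact q.Prime := ⟨P.prime_q⟩
  have hr0 := hr.pos.ne'
  have hs0 := hs.pos.ne'
  refine ⟨mul_pos hr.pos hs.pos, ?_, ?_, ?_, ?_, ?_⟩
  · rw [par_mul hr0 hs0, hr.par_two, hs.par_two]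
  · rw [par_mul hr0 hs0, hr.par₁, hs.par₁]
  · rw [par_mul hr0 hs0, hr.par₂, hs.par₂]
  · rw [par_mul hr0 hs0, hr.par_q, hs.par_q]
  · intro ℓ hℓ a b c d
    have : Fact ℓ.Prime := ⟨hℓ⟩
    rw [par_mul hr0 hs0, hr.par_other ℓ hℓ a b c d, hs.par_other ℓ hℓ a b c d, add_zero]

theorem hasParities_one : HasParities p₁ p₂ q 1 0 0 0 0 := by
  have h : ∀ ℓ : ℕ, par ℓ 1 = 0 := fun ℓ => by simp [par]
  exact ⟨one_pos, h _, h _, h _, h _, fun ℓ _ _ _ _ _ => h ℓ⟩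

theorem HasParities.isSquare_iff {r : ℚ} {α β γ δ : ZMod 2}
    (P : PrimeTriple p₁ p₂ q) (hr : HasParities p₁ p₂ q r α β γ δ) :
    IsSquare r ↔ α = 0 ∧ β = 0 ∧ γ = 0 ∧ δ = 0 := by
  rw [isSquare_iff_par hr.pos, ← hr.par_two, ← hr.par₁, ← hr.par₂, ← hr.par_q]
  constructor
  · intro h
    exact ⟨h _ Nat.prime_two, h _ P.prime₁, h _ P.prime₂, h _ P.prime_q⟩
  · rintro ⟨h2, h₁, h₂, hq⟩ ℓ hℓ
    by_cases e2 : ℓ = 2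
    · rw [e2, h2]
    by_cases e₁ : ℓ = p₁
    · rw [e₁, h₁]
    by_cases e₂ : ℓ = p₂
    · rw [e₂, h₂]
    by_cases eq : ℓ = q
    · rw [eq, hq]
    exact hr.par_other ℓ hℓ e2 e₁ e₂ eq

namespace PrimeTriple

theorem hasParities_two (P : PrimeTriple p₁ p₂ q) : HasParities p₁ p₂ q 2 1 0 0 0 := by
  have h₁ : Fact p₁.Prime := ⟨P.prime₁⟩
  have h₂ : Fact p₂.Prime := ⟨P.prime₂⟩
  have hq : Fact q.Prime := ⟨P.prime_q⟩
  have m1 := P.mod₁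
  have m2 := P.mod₂
  have m3 := P.mod_q
  have key : ∀ ℓ : ℕ, ℓ.Prime → ℓ ≠ 2 → par ℓ 2 = 0 := fun ℓ hℓ h => by
    have : Fact ℓ.Prime := ⟨hℓ⟩
    simpa using par_prime_of_ne (ℓ := ℓ) Nat.prime_two h
  refine ⟨two_pos, by simpa using par_self (ℓ := 2), key _ P.prime₁ (by omega),
    key _ P.prime₂ (by omega), key _ P.prime_q (by omega), fun ℓ hℓ h _ _ _ => key ℓ hℓ h⟩

theorem hasParities₁ (P : PrimeTriple p₁ p₂ q) : HasParities p₁ p₂ q p₁ 0 1 0 0 := by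
  have h₁ : Fact p₁.Prime := ⟨P.prime₁⟩
  have h₂ : Fact p₂.Prime := ⟨P.prime₂⟩
  have hq : Fact q.Prime := ⟨P.prime_q⟩
  have m1 := P.mod₁
  refine ⟨by exact_mod_cast P.prime₁.pos, par_prime_of_ne P.prime₁ (by omega), par_self,
    par_prime_of_ne P.prime₁ P.ne.symm, par_prime_of_ne P.prime₁ P.ne₁.symm, ?_⟩
  intro ℓ hℓ _ h _ _
  have : Fact ℓ.Prime := ⟨hℓ⟩
  exact par_prime_of_ne P.prime₁ h

theorem hasParities₂ (P : PrimeTriple p₁ p₂ q) : HasParities p₁ p₂ q p₂ 0 0 1 0 := by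
  have h := P.swap.hasParities₁
  exact ⟨h.pos, h.par_two, h.par₂, h.par₁, h.par_q, fun ℓ hℓ a b c d => h.par_other ℓ hℓ a c b d⟩

theorem hasParities_q (P : PrimeTriple p₁ p₂ q) : HasParities p₁ p₂ q q 0 0 0 1 := by
  have h₁ : Fact p₁.Prime := ⟨P.prime₁⟩
  have h₂ : Fact p₂.Prime := ⟨P.prime₂⟩
  have hq : Fact q.Prime := ⟨P.prime_q⟩
  have m1 := P.mod_q
  refine ⟨by exact_mod_cast P.prime_q.pos, par_prime_of_ne P.prime_q (by omega),
    par_prime_of_ne P.prime_q P.ne₁, par_prime_of_ne P.prime_q P.ne₂, par_self, ?_⟩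
  intro ℓ hℓ _ _ _ h
  have : Fact ℓ.Prime := ⟨hℓ⟩
  exact par_prime_of_ne P.prime_q h

end PrimeTriple

theorem IsUnitClass.hasParities (P : PrimeTriple p₁ p₂ q) {c : ℕ} (hc : c ∣ p₁ * p₂ * q) {D : ℚ}
    (hD : IsUnitClass c D) :
    HasParities p₁ p₂ q D (par 2 D) (par p₁ D) (par p₂ D) (par q D) := by
  refine ⟨hD.pos, rfl, rfl, rfl, rfl, fun ℓ hℓ h2 h₁ h₂ hq => ?_⟩
  have : Fact ℓ.Prime := ⟨hℓ⟩
  refine hD.par_eq_zero h2 fun hd => ?_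
  rcases hℓ.dvd_mul.mp (hd.trans hc) with h | h
  · rcases hℓ.dvd_mul.mp h with h | h
    · exact h₁ ((Nat.prime_dvd_prime_iff_eq hℓ P.prime₁).mp h)
    · exact h₂ ((Nat.prime_dvd_prime_iff_eq hℓ P.prime₂).mp h)
  · exact hq ((Nat.prime_dvd_prime_iff_eq hℓ P.prime_q).mp h)

theorem IsUnitClass.par_eq_zero_of_ne {p p' ℓ : ℕ} (hp : p.Prime) (hp' : p'.Prime) (hℓ : ℓ.Prime)
    (h2 : ℓ ≠ 2) (h : ℓ ≠ p) (h' : ℓ ≠ p') {D : ℚ} (hD : IsUnitClass (p * p') D) : par ℓ D = 0 := by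
  have : Fact ℓ.Prime := ⟨hℓ⟩
  refine hD.par_eq_zero h2 fun hd => ?_
  rcases hℓ.dvd_mul.mp hd with hd | hd
  · exact h ((Nat.prime_dvd_prime_iff_eq hℓ hp).mp hd)
  · exact h' ((Nat.prime_dvd_prime_iff_eq hℓ hp').mp hd)

/-- How the order `C` of the capitulation kernel depends on the classes of `2` and of the
fundamental unit. -/
def CaseSplit (m n : ℕ) (x : ℚ) (C : ℕ) : Prop :=
  let sq := IsSquare (2 * (2 * x + 2)) ∨ IsSquare (2 * (2 * x + 2) * (m * n : ℕ))
  (IsAllowed m n (2 * x + 2) 1 0 → IsAllowed m n (2 * x + 2) 0 1 → ¬ sq → C = 2) ∧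
  (IsAllowed m n (2 * x + 2) 1 0 → sq → C = 4) ∧
  (¬ IsAllowed m n (2 * x + 2) 1 0 → sq → C = 8) ∧
  ((IsAllowed m n (2 * x + 2) 1 0 ∨ IsAllowed m n (2 * x + 2) 0 1 ∨
      IsAllowed m n (2 * x + 2) 1 1) →
    ¬ (IsAllowed m n (2 * x + 2) 1 0 ∧ IsAllowed m n (2 * x + 2) 0 1) → ¬ sq → C = 4)

theorem FundCoords.isUnitClass {c : ℕ} {x y : ℚ} (h : FundCoords c x y)
    (hN : x ^ 2 - c * y ^ 2 = 1) : IsUnitClass c (2 * x + 2) :=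
  ⟨x, y, h.unit.1, hN, h.pos hN, rfl⟩

theorem HasParities.pow (P : PrimeTriple p₁ p₂ q) {r : ℚ} {α β γ δ : ZMod 2}
    (hr : HasParities p₁ p₂ q r α β γ δ) {e : ℕ} :
    HasParities p₁ p₂ q (r ^ e) (e * α) (e * β) (e * γ) (e * δ) := by
  induction e with
  | zero => simpa using hasParities_one
  | succ e ih =>
    rw [pow_succ]
    convert ih.mul P hr using 1 <;> push_cast <;> ring

theorem PrimeTriple.hasParities (P : PrimeTriple p₁ p₂ q) :
    HasParities p₁ p₂ q (p₁ * p₂ * q : ℕ) 0 1 1 1 := by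
  push_cast
  exact (P.hasParities₁.mul P P.hasParities₂).mul P P.hasParities_q

theorem PrimeTriple.hasParities₂q (P : PrimeTriple p₁ p₂ q) :
    HasParities p₁ p₂ q (p₂ * q : ℕ) 0 0 1 1 := by
  push_cast
  exact P.hasParities₂.mul P P.hasParities_q

theorem PrimeTriple.hasParities₁₂ (P : PrimeTriple p₁ p₂ q) :
    HasParities p₁ p₂ q (p₁ * p₂ : ℕ) 0 1 1 0 := by
  push_cast
  exact P.hasParities₁.mul P P.hasParities₂

theorem PrimeTriple.hasParities_four (P : PrimeTriple p₁ p₂ q) :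
    HasParities p₁ p₂ q 4 0 0 0 0 := by
  have h := P.hasParities_two.mul P P.hasParities_two
  norm_num at h
  exact h

/-- The factor `p₁` makes the parity at `p₁` irrelevant, while `p₂q` shifts those at `p₂` and `q`
together, leaving only their difference. -/
theorem PrimeTriple.isSquareUpTo₁ (P : PrimeTriple p₁ p₂ q) {r : ℚ} {α β γ δ : ZMod 2}
    (hr : HasParities p₁ p₂ q r α β γ δ) : IsSquareUpTo p₁ (p₂ * q) r ↔ α = 0 ∧ γ = δ := by
  rw [IsSquareUpTo, ← mul_assoc, hr.isSquare_iff P, (hr.mul P P.hasParities₁).isSquare_iff P,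
    (hr.mul P P.hasParities₂q).isSquare_iff P, (hr.mul P P.hasParities).isSquare_iff P]
  clear hr
  revert α β γ δ
  decide

theorem PrimeTriple.isSquareUpTo_q (P : PrimeTriple p₁ p₂ q) {r : ℚ} {α β γ δ : ZMod 2}
    (hr : HasParities p₁ p₂ q r α β γ δ) : IsSquareUpTo (p₁ * p₂) q r ↔ α = 0 ∧ β = γ := by
  rw [IsSquareUpTo, hr.isSquare_iff P, (hr.mul P P.hasParities_q).isSquare_iff P,
    (hr.mul P P.hasParities₁₂).isSquare_iff P, (hr.mul P P.hasParities).isSquare_iff P]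
  clear hr
  revert α β γ δ
  decide

theorem PrimeTriple.isSquare_or (P : PrimeTriple p₁ p₂ q) {r : ℚ} {α β γ δ : ZMod 2}
    (hr : HasParities p₁ p₂ q r α β γ δ) :
    IsSquare r ∨ IsSquare (r * (p₁ * p₂ * q : ℕ)) ↔ α = 0 ∧ β = γ ∧ γ = δ := by
  rw [hr.isSquare_iff P, (hr.mul P P.hasParities).isSquare_iff P]
  clear hr
  revert α β γ δ
  decide

theorem PrimeTriple.isSquare_or₂q (P : PrimeTriple p₁ p₂ q) {r : ℚ} {α γ δ : ZMod 2}
    (hr : HasParities p₁ p₂ q r α 0 γ δ) :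
    IsSquare r ∨ IsSquare (r * (p₂ * q : ℕ)) ↔ α = 0 ∧ γ = δ := by
  rw [hr.isSquare_iff P, (hr.mul P P.hasParities₂q).isSquare_iff P]
  clear hr
  revert α γ δ
  decide

theorem PrimeTriple.isSquare_or₁₂ (P : PrimeTriple p₁ p₂ q) {r : ℚ} {β γ : ZMod 2}
    (hr : HasParities p₁ p₂ q r 0 β γ 0) :
    IsSquare r ∨ IsSquare (r * (p₁ * p₂ : ℕ)) ↔ β = γ := by
  rw [hr.isSquare_iff P, (hr.mul P P.hasParities₁₂).isSquare_iff P]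
  clear hr
  revert β γ
  decide

theorem PrimeTriple.pmSquare_iff (P : PrimeTriple p₁ p₂ q) {x y : ℚ}
    (hε : FundCoords (p₁ * p₂ * q) x y) {k : ℕ} {α β γ δ κ κ₁ κ₂ κq : ZMod 2}
    (hD : HasParities p₁ p₂ q (2 * x + 2) α β γ δ) (hk : HasParities p₁ p₂ q k κ κ₁ κ₂ κq) :
    PMSquare k x ↔ κ + (1 + α) = 0 ∧ κ₁ + β = κ₂ + γ ∧ κ₂ + γ = κq + δ := by
  rw [hε.pmSquare_iff P.squarefree P.mod (k := k) (by exact_mod_cast hk.pos),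
    P.isSquare_or (hk.mul P (P.hasParities_two.mul P hD)), zero_add, zero_add, zero_add]

/-- The order of the capitulation kernel for `k(√p₁)`. -/
theorem PrimeTriple.card_cases₁ (P : PrimeTriple p₁ p₂ q) {x y a b : ℚ}
    (hε : FundCoords (p₁ * p₂ * q) x y) (hη : FundCoords (p₂ * q) a b) {C : ℕ}
    (hC : CaseSplit p₁ (p₂ * q) x C) :
    ((PMSquare 1 x ∧ ¬ PMSquare 1 a) → C = 8) ∧
    ((PMSquare 1 a ∧ (PMSquare p₁ x ∨ PMSquare (2 * p₁) x)) → C = 2) ∧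
    ((¬ (PMSquare 1 x ∧ ¬ PMSquare 1 a) ∧
      ¬ (PMSquare 1 a ∧ (PMSquare p₁ x ∨ PMSquare (2 * p₁) x))) → C = 4) := by
  have hNε := hε.unit.norm_eq_one P.squarefree P.mod
  have hNη := hη.unit.norm_eq_one P.squarefree₂q P.mod₂q
  have m1 := P.mod₁
  have m2 := P.mod₂
  have m3 := P.mod_q
  have hndvd : p₂ * q ∣ p₁ * p₂ * q := ⟨p₁, by ring⟩
  have hcl (D : ℚ) (hD : IsUnitClass (p₂ * q) D) :
      HasParities p₁ p₂ q D (par 2 D) 0 (par p₂ D) (par q D) := by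
    have h := hD.hasParities P hndvd
    rwa [hD.par_eq_zero_of_ne P.prime₂ P.prime_q P.prime₁ (by omega) P.ne P.ne₁] at h
  have hcl₁ (D : ℚ) (hD : IsUnitClass p₁ D) : HasParities p₁ p₂ q D 0 (par p₁ D) 0 0 := by
    have h := hD.hasParities P ⟨p₂ * q, by ring⟩
    have h₂ : Fact p₂.Prime := ⟨P.prime₂⟩
    have hq : Fact q.Prime := ⟨P.prime_q⟩
    rwa [hD.par_two_eq_zero P.mod₁ P.prime₁.prime.squarefree,
      hD.par_eq_zero (ℓ := p₂) (by omega)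
        fun h => P.ne ((Nat.prime_dvd_prime_iff_eq P.prime₂ P.prime₁).mp h).symm,
      hD.par_eq_zero (ℓ := q) (by omega)
        fun h => P.ne₁ ((Nat.prime_dvd_prime_iff_eq P.prime_q P.prime₁).mp h).symm] at h
  have hDε := (hε.isUnitClass hNε).hasParities P dvd_rfl
  have hclη := hη.isUnitClass hNη
  have hDη := hcl _ hclη
  have hεns := hε.not_isSquare hNε
  have hηns := hη.not_isSquare hNη
  rw [P.isSquare_or hDε] at hεns
  rw [P.isSquare_or₂q hDη] at hηns
  have h1 : HasParities p₁ p₂ q (1 : ℕ) 0 0 0 0 := by simpa using hasParities_one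
  have h2p : HasParities p₁ p₂ q (2 * p₁ : ℕ) 1 1 0 0 := by
    push_cast
    exact P.hasParities_two.mul P P.hasParities₁
  have hPM1 := P.pmSquare_iff hε hDε h1
  have hPMp := P.pmSquare_iff hε hDε P.hasParities₁
  have hPM2p := P.pmSquare_iff hε hDε h2p
  have hPMa := hη.pmSquare_iff P.squarefree₂q P.mod₂q (k := 1) one_pos
  rw [Nat.cast_one, one_mul, P.isSquare_or₂q (P.hasParities_two.mul P hDη), zero_add,
    zero_add] at hPMa
  have hsq : (IsSquare (2 * (2 * x + 2)) ∨ IsSquare (2 * (2 * x + 2) * (p₁ * (p₂ * q) : ℕ))) ↔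
      PMSquare 1 x := by
    rw [hε.pmSquare_iff P.squarefree P.mod one_pos, ← mul_assoc p₁, Nat.cast_one, one_mul]
  -- Units of `ℚ(√p₁)` only affect the irrelevant parity at `p₁`. So the test needs only the trivial
  -- class, represented by 4, and the class of the fundamental unit of `ℚ(√(p₂q))`.
  have hA (e t : ℕ) : IsAllowed p₁ (p₂ * q) (2 * x + 2) e t ↔
      ((e : ZMod 2) + t * par 2 (2 * x + 2) = 0 ∧
        t * par p₂ (2 * x + 2) = (t : ZMod 2) * par q (2 * x + 2)) ∨
      ((e : ZMod 2) + t * par 2 (2 * x + 2) + par 2 (2 * a + 2) = 0 ∧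
        t * par p₂ (2 * x + 2) + par p₂ (2 * a + 2) =
          t * par q (2 * x + 2) + par q (2 * a + 2)) := by
    constructor
    · rintro ⟨D₁, D₂, hD₁, hD₂, hsq⟩
      have hs := hη.isUnitClass_cases (PrimeTriple.not_isSquare_of_mod P.mod₂q) hNη hD₂
      have s₂ := hcl _ hD₂
      have s₁ := hcl₁ _ hD₁
      rw [P.isSquare_or₂q s₂, P.isSquare_or₂q (s₂.mul P hDη)] at hs
      rw [P.isSquareUpTo₁ ((((P.hasParities_two.pow P).mul P (hDε.pow P)).mul P s₁).mul P s₂),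
        mul_one, mul_zero, add_zero, zero_add, add_zero, zero_add, add_zero] at hsq
      refine hs.imp (fun h => ?_) (fun h => ?_)
      · rw [h.1, h.2, add_zero, add_left_inj] at hsq
        exact hsq
      · exact ⟨by linear_combination hsq.1 - h.1 + CharTwo.two_eq_zero (R := ZMod 2) * par 2 (2 * a + 2),
          by linear_combination hsq.2 - h.2 + CharTwo.two_eq_zero (R := ZMod 2) *
            (par p₂ (2 * a + 2) - par q (2 * a + 2))⟩
    · rintro (h | h)
      · refine ⟨4, 4, isUnitClass_four _, isUnitClass_four _, ?_⟩
        rw [P.isSquareUpTo₁ ((((P.hasParities_two.pow P).mul P (hDε.pow P)).mul P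
          P.hasParities_four).mul P P.hasParities_four)]
        simpa using h
      · refine ⟨4, 2 * a + 2, isUnitClass_four _, hclη, ?_⟩
        rw [P.isSquareUpTo₁ ((((P.hasParities_two.pow P).mul P (hDε.pow P)).mul P
          P.hasParities_four).mul P hDη)]
        simpa using h
  have h10 := hA 1 0
  have h01 := hA 0 1
  have h11 := hA 1 1
  have hC' := hC
  simp only [CaseSplit, hsq] at hC'
  clear hA hsq hC
  simp only [Nat.cast_one, Nat.cast_zero, zero_mul, one_mul, zero_add, add_zero] at *
  clear hDε hclη hDη
  generalize par 2 (2 * x + 2) = α, par p₁ (2 * x + 2) = β,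
    par p₂ (2 * x + 2) = γ, par q (2 * x + 2) = δ, par 2 (2 * a + 2) = α',
    par p₂ (2 * a + 2) = γ', par q (2 * a + 2) = δ' at *
  have f1 : IsAllowed p₁ (p₂ * q) (2 * x + 2) 1 0 ↔ PMSquare 1 a := by
    rw [h10, hPMa]
    clear * -
    revert α' γ' δ'
    decide
  -- Here the class of `2` is available, so `ε` is a norm exactly when `γ = δ`. The case `β = γ = δ`
  -- is ruled out by `hεns` if `α = 0` and by the failure of `PMSquare 1 x` if `α = 1`; what remains
  -- is `β ≠ γ = δ`.
  have f2 : PMSquare 1 a → (IsAllowed p₁ (p₂ * q) (2 * x + 2) 0 1 ∧ ¬ PMSquare 1 x ↔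
      PMSquare p₁ x ∨ PMSquare (2 * p₁) x) := by
    rw [h01, hPM1, hPMp, hPM2p, hPMa]
    clear * - hεns
    revert α β γ δ α' γ' δ'
    decide +kernel
  -- Now `γ' ≠ δ'`, so the class of `2a + 2` can equalise the parities of `2x + 2` at `p₂` and `q`.
  -- A leftover parity at 2 is absorbed by the factor `i`.
  have f3 : ¬ PMSquare 1 a → IsAllowed p₁ (p₂ * q) (2 * x + 2) 0 1 ∨
      IsAllowed p₁ (p₂ * q) (2 * x + 2) 1 1 := by
    rw [h01, h11, hPMa]
    clear * - hηns
    revert α γ δ α' γ' δ'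
    set_option synthInstance.maxSize 1024 in
    set_option synthInstance.maxHeartbeats 200000 in
    decide +kernel
  clear * - hC' f1 f2 f3
  rw [f1] at hC'
  obtain ⟨c1, c2, c3, c4⟩ := hC'
  refine ⟨fun h => c3 h.2 h.1, fun h => ?_, fun h => ?_⟩
  · obtain ⟨h01, hx⟩ := (f2 h.1).mpr h.2
    exact c1 h.1 h01 hx
  · by_cases ha : PMSquare 1 a
    · by_cases hx : PMSquare 1 x
      · exact c2 ha hx
      · exact c4 (Or.inl ha) (fun h' => h.2 ⟨ha, (f2 ha).mp ⟨h'.2, hx⟩⟩) hx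
    · exact c4 (Or.inr (f3 ha)) (fun h' => ha h'.1) (fun hx => h.1 ⟨hx, ha⟩)

theorem PrimeTriple.hasParities_of_isUnitClass_q (P : PrimeTriple p₁ p₂ q) {D : ℚ}
    (hD : IsUnitClass q D) : HasParities p₁ p₂ q D (par 2 D) 0 0 (par q D) := by
  have m1 := P.mod₁
  have m2 := P.mod₂
  have h := hD.hasParities P ⟨p₁ * p₂, by ring⟩
  have h₁ : Fact p₁.Prime := ⟨P.prime₁⟩
  have h₂ : Fact p₂.Prime := ⟨P.prime₂⟩
  rwa [hD.par_eq_zero (ℓ := p₁) (by omega)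
      fun h => P.ne₁ ((Nat.prime_dvd_prime_iff_eq P.prime₁ P.prime_q).mp h),
    hD.par_eq_zero (ℓ := p₂) (by omega)
      fun h => P.ne₂ ((Nat.prime_dvd_prime_iff_eq P.prime₂ P.prime_q).mp h)] at h

theorem PrimeTriple.hasParities_of_isUnitClass₁₂ (P : PrimeTriple p₁ p₂ q) {D : ℚ}
    (hD : IsUnitClass (p₁ * p₂) D) : HasParities p₁ p₂ q D 0 (par p₁ D) (par p₂ D) 0 := by
  have m3 := P.mod_q
  have h := hD.hasParities P ⟨q, rfl⟩
  rwa [hD.par_two_eq_zero P.mod₁₂ P.squarefree₁₂,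
    hD.par_eq_zero_of_ne P.prime₁ P.prime₂ P.prime_q (by omega) P.ne₁.symm P.ne₂.symm] at h

/-- A unit class of `ℚ(√q)` has odd valuation at 2, so `i` is always a norm from `k(√q)`; hence
order 8 never occurs there. -/
theorem PrimeTriple.isAllowed_one_zero (P : PrimeTriple p₁ p₂ q) {D : ℚ} :
    IsAllowed (p₁ * p₂) q D 1 0 := by
  obtain ⟨D₂, hD₂, hpar⟩ := exists_isUnitClass_par_two P.prime_q P.mod_q
  have s₂ := P.hasParities_of_isUnitClass_q hD₂
  rw [hpar] at s₂
  refine ⟨4, D₂, isUnitClass_four _, hD₂, ?_⟩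
  rw [pow_zero, pow_one, mul_one,
    P.isSquareUpTo_q ((P.hasParities_two.mul P P.hasParities_four).mul P s₂)]
  decide

/-- The order of the capitulation kernel for `k(√q)`, when the fundamental unit of `ℚ(√(p₁p₂))`
has norm `1`. -/
theorem PrimeTriple.card_cases_q (P : PrimeTriple p₁ p₂ q) {x y a b : ℚ}
    (hε : FundCoords (p₁ * p₂ * q) x y) (hη : FundCoords (p₁ * p₂) a b)
    (hN : a ^ 2 - (p₁ * p₂ : ℕ) * b ^ 2 = 1) {C : ℕ} (hC : CaseSplit (p₁ * p₂) q x C) :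
    (PMSquare 1 x → C = 4) ∧ (¬ PMSquare 1 x → C = 2) := by
  obtain ⟨D₂, hD₂, hpar⟩ := exists_isUnitClass_par_two P.prime_q P.mod_q
  have s₂ := P.hasParities_of_isUnitClass_q hD₂
  rw [hpar] at s₂
  have hNε := hε.unit.norm_eq_one P.squarefree P.mod
  have hDε := (hε.isUnitClass hNε).hasParities P dvd_rfl
  have hsq := (hε.pmSquare_iff P.squarefree P.mod one_pos).symm
  rw [Nat.cast_one, one_mul] at hsq
  have hA10 : IsAllowed (p₁ * p₂) q (2 * x + 2) 1 0 := P.isAllowed_one_zero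
  have hclη := hη.isUnitClass hN
  have hDη := P.hasParities_of_isUnitClass₁₂ hclη
  have hηns := hη.not_isSquare hN
  rw [P.isSquare_or₁₂ hDη] at hηns
  -- The class of a fundamental unit of norm 1 in `ℚ(√(p₁p₂))` has different parities at `p₁` and
  -- `p₂`, so it can equalise those of `2x + 2`; the parity at 2 is corrected by a unit of `ℚ(√q)`.
  have hA01 : IsAllowed (p₁ * p₂) q (2 * x + 2) 0 1 := by
    obtain ⟨D₁, β, γ, hD₁, s₁, h₁⟩ : ∃ D₁ β γ, IsUnitClass (p₁ * p₂) D₁ ∧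
        HasParities p₁ p₂ q D₁ 0 β γ 0 ∧ par p₁ (2 * x + 2) + β = par p₂ (2 * x + 2) + γ := by
      by_cases h : par p₁ (2 * x + 2) = par p₂ (2 * x + 2)
      · exact ⟨4, 0, 0, isUnitClass_four _, P.hasParities_four, by rw [h]⟩
      · refine ⟨_, _, _, hclη, hDη, ?_⟩
        clear * - h hηns
        generalize par p₁ (2 * x + 2) = β, par p₂ (2 * x + 2) = γ, par p₁ (2 * a + 2) = β',
          par p₂ (2 * a + 2) = γ' at *
        revert β γ β' γ'
        decide
    obtain ⟨D₂, α, δ, hD₂, s₂, h₂⟩ : ∃ D₂ α δ, IsUnitClass q D₂ ∧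
        HasParities p₁ p₂ q D₂ α 0 0 δ ∧ par 2 (2 * x + 2) + α = 0 := by
      rcases zmod_two_cases (par 2 (2 * x + 2)) with h | h
      · exact ⟨4, 0, 0, isUnitClass_four _, P.hasParities_four, by rw [h, add_zero]⟩
      · exact ⟨_, _, _, hD₂, s₂, by rw [h]; decide⟩
    refine ⟨D₁, D₂, hD₁, hD₂, ?_⟩
    rw [pow_zero, pow_one, one_mul, P.isSquareUpTo_q ((hDε.mul P s₁).mul P s₂)]
    simpa [h₁] using h₂
  obtain ⟨c1, c2, -, -⟩ := hC
  rw [hsq] at c1 c2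
  exact ⟨c2 hA10, c1 hA10 hA01⟩

/-- The order of the capitulation kernel for `k(√q)`, when the fundamental unit of `ℚ(√(p₁p₂))`
has norm `-1`. -/
theorem PrimeTriple.card_cases_q_of_neg (P : PrimeTriple p₁ p₂ q) {x y a b : ℚ}
    (hε : FundCoords (p₁ * p₂ * q) x y) (hη : FundCoords (p₁ * p₂) a b)
    (hN : a ^ 2 - (p₁ * p₂ : ℕ) * b ^ 2 = -1) {C : ℕ} (hC : CaseSplit (p₁ * p₂) q x C) :
    (PMSquare q x ∨ PMSquare (2 * q) x → C = 2) ∧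
      (¬ (PMSquare q x ∨ PMSquare (2 * q) x) → C = 4) := by
  have hNε := hε.unit.norm_eq_one P.squarefree P.mod
  have hDε := (hε.isUnitClass hNε).hasParities P dvd_rfl
  have hεns := hε.not_isSquare hNε
  rw [P.isSquare_or hDε] at hεns
  have hsq := (hε.pmSquare_iff P.squarefree P.mod one_pos).symm
  rw [Nat.cast_one, one_mul] at hsq
  have hA10 : IsAllowed (p₁ * p₂) q (2 * x + 2) 1 0 := P.isAllowed_one_zero
  -- With norm `-1`, units of `ℚ(√(p₁p₂))` have trivial class, so unequal parities at `p₁` and `p₂`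
  -- cannot be repaired.
  have hA01 : IsAllowed (p₁ * p₂) q (2 * x + 2) 0 1 ↔
      par p₁ (2 * x + 2) = par p₂ (2 * x + 2) := by
    constructor
    · rintro ⟨D₁, D₂, hD₁, hD₂, h⟩
      have s₁ := P.hasParities_of_isUnitClass₁₂ hD₁
      have s₂ := P.hasParities_of_isUnitClass_q hD₂
      have h₁ := hη.isUnitClass_of_neg P.not_isSquare₁₂ hN hD₁
      rw [P.isSquare_or₁₂ s₁] at h₁
      rw [pow_zero, pow_one, one_mul, P.isSquareUpTo_q ((hDε.mul P s₁).mul P s₂), h₁] at h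
      simpa using h.2
    · intro h
      obtain ⟨D₂, hD₂, hpar⟩ := exists_isUnitClass_par_two P.prime_q P.mod_q
      have s₂ := P.hasParities_of_isUnitClass_q hD₂
      rw [hpar] at s₂
      rcases zmod_two_cases (par 2 (2 * x + 2)) with h2 | h2
      · refine ⟨4, 4, isUnitClass_four _, isUnitClass_four _, ?_⟩
        rw [pow_zero, pow_one, one_mul,
          P.isSquareUpTo_q ((hDε.mul P P.hasParities_four).mul P P.hasParities_four), h, h2]
        exact ⟨by decide, rfl⟩
      · refine ⟨4, D₂, isUnitClass_four _, hD₂, ?_⟩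
        rw [pow_zero, pow_one, one_mul,
          P.isSquareUpTo_q ((hDε.mul P P.hasParities_four).mul P s₂), h, h2]
        exact ⟨by decide, rfl⟩
  have h1 : HasParities p₁ p₂ q (1 : ℕ) 0 0 0 0 := by simpa using hasParities_one
  have h2q : HasParities p₁ p₂ q (2 * q : ℕ) 1 0 0 1 := by
    push_cast
    exact P.hasParities_two.mul P P.hasParities_q
  have hPM1 := P.pmSquare_iff hε hDε h1
  have hPMq := P.pmSquare_iff hε hDε P.hasParities_q
  have hPM2q := P.pmSquare_iff hε hDε h2q
  have f : (PMSquare q x ∨ PMSquare (2 * q) x) ↔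
      (IsAllowed (p₁ * p₂) q (2 * x + 2) 0 1 ∧ ¬ PMSquare 1 x) := by
    rw [hPMq, hPM2q, hA01, hPM1]
    clear * - hεns
    generalize par 2 (2 * x + 2) = α, par p₁ (2 * x + 2) = β,
      par p₂ (2 * x + 2) = γ, par q (2 * x + 2) = δ at *
    revert α β γ δ
    decide
  obtain ⟨c1, c2, -, c4⟩ := hC
  rw [hsq] at c1 c2 c4
  rw [f]
  refine ⟨fun h => c1 hA10 h.1 h.2, fun h => ?_⟩
  by_cases hx : PMSquare 1 x
  · exact c2 hA10 hx
  · exact c4 (Or.inl hA10) (fun h' => h ⟨h'.2, hx⟩) hx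

end

/-! ### Realisation by subfields of the complex numbers. -/

section SimpleQuadratic

variable {F E : Type*} [Field F] [Field E] [Algebra F E] {z : E} {c : F}

theorem isIntegral_of_sq_eq (hz : z ^ 2 = algebraMap F E c) : IsIntegral F z :=
  IsIntegral.of_pow two_pos (hz ▸ isIntegral_algebraMap)

theorem finrank_adjoin_sqrt (hz : z ^ 2 = algebraMap F E c)
    (hnot : z ∉ Set.range (algebraMap F E)) :
    Module.finrank F (IntermediateField.adjoin F {z}) = 2 := by
  have h_int := isIntegral_of_sq_eq hz
  rw [IntermediateField.adjoin.finrank h_int]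
  apply le_antisymm
  · have hdvd : minpoly F z ∣ Polynomial.X ^ 2 - Polynomial.C c := minpoly.dvd F z (by simp [hz])
    have := Polynomial.natDegree_le_of_dvd hdvd (Polynomial.X_pow_sub_C_ne_zero two_pos c)
    rwa [Polynomial.natDegree_X_pow_sub_C] at this
  · exact (minpoly.two_le_natDegree_iff h_int).mpr hnot

theorem exists_coords_adjoin_sqrt (hz : z ^ 2 = algebraMap F E c) {w : E}
    (hw : w ∈ IntermediateField.adjoin F {z}) :
    ∃ u v : F, w = algebraMap F E u + algebraMap F E v * z := by
  have h_int := isIntegral_of_sq_eq hz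
  replace hw : w ∈ Algebra.adjoin F {z} := by
    rw [← IntermediateField.adjoin_simple_toSubalgebra_of_isAlgebraic h_int.isAlgebraic]
    exact hw
  induction hw using Algebra.adjoin_induction with
  | mem x hx => exact ⟨0, 1, by rw [Set.mem_singleton_iff.mp hx]; simp⟩
  | algebraMap r => exact ⟨r, 0, by simp⟩
  | add x y _ _ hx hy =>
    obtain ⟨u, v, rfl⟩ := hx
    obtain ⟨u', v', rfl⟩ := hy
    exact ⟨u + u', v + v', by simp only [map_add]; ring⟩
  | mul x y _ _ hx hy =>
    obtain ⟨u, v, rfl⟩ := hx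
    obtain ⟨u', v', rfl⟩ := hy
    refine ⟨u * u' + c * v * v', u * v' + u' * v, ?_⟩
    simp only [map_add, map_mul]
    linear_combination algebraMap F E v * algebraMap F E v' * hz

end SimpleQuadratic

section ConcreteFields

theorem ofReal_sqrt_sq (c : ℕ) : ((√(c : ℝ) : ℝ) : ℂ) ^ 2 = c := by
  rw [← Complex.ofReal_pow, sqrt_natCast_sq, Complex.ofReal_natCast]

variable {d p : ℕ}

/-- Taking real parts reduces the question whether the real number `√p` lies in `k` to the same
question for `ℚ(√d)`. -/
theorem re_im_mem_of_mem {z : ℂ} (hz : z ∈ baseField d) :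
    z.re ∈ realQuadratic d ∧ z.im ∈ realQuadratic d := by
  induction hz using IntermediateField.adjoin_induction with
  | mem x hx =>
    rcases hx with rfl | rfl
    · exact ⟨IntermediateField.mem_adjoin_simple_self ℚ _, by simp⟩
    · simp
  | algebraMap r => simp
  | add x y _ _ hx hy => exact ⟨add_mem hx.1 hy.1, add_mem hx.2 hy.2⟩
  | inv x _ hx =>
    rw [Complex.inv_re, Complex.inv_im, Complex.normSq_apply]
    have h := add_mem (mul_mem hx.1 hx.1) (mul_mem hx.2 hx.2)
    exact ⟨div_mem hx.1 h, div_mem (neg_mem hx.2) h⟩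
  | mul x y _ _ hx hy =>
    rw [Complex.mul_re, Complex.mul_im]
    exact ⟨sub_mem (mul_mem hx.1 hy.1) (mul_mem hx.2 hy.2),
      add_mem (mul_mem hx.1 hy.2) (mul_mem hx.2 hy.1)⟩

theorem finrank_baseField (hd : ¬ IsSquare d) : Module.finrank ℚ (baseField d) = 4 := by
  have h1 : Module.finrank ℚ (IntermediateField.adjoin ℚ {((√(d : ℝ) : ℝ) : ℂ)}) = 2 := by
    refine finrank_adjoin_sqrt (c := (d : ℚ)) (by simp [ofReal_sqrt_sq]) ?_
    rintro ⟨r, hr⟩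
    apply irrational_sqrt_natCast_iff.mpr hd
    refine ⟨r, ?_⟩
    have := congrArg Complex.re hr
    simpa using this
  have h2 : Module.finrank (IntermediateField.adjoin ℚ {((√(d : ℝ) : ℝ) : ℂ)})
      (IntermediateField.adjoin (IntermediateField.adjoin ℚ {((√(d : ℝ) : ℝ) : ℂ)})
        {Complex.I}) = 2 := by
    refine finrank_adjoin_sqrt (c := -1) (by simp) ?_
    rintro ⟨⟨r, hr⟩, hrI⟩
    have hr' : r = Complex.I := hrI
    have key : ∀ z ∈ IntermediateField.adjoin ℚ {((√(d : ℝ) : ℝ) : ℂ)}, z.im = 0 := by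
      intro z hz
      obtain ⟨u, v, rfl⟩ := exists_coords_adjoin_sqrt (c := (d : ℚ)) (by simp [ofReal_sqrt_sq]) hz
      simp
    have := key r hr
    rw [hr'] at this
    simp at this
  have h3 := Module.finrank_mul_finrank ℚ (IntermediateField.adjoin ℚ {((√(d : ℝ) : ℝ) : ℂ)})
    (IntermediateField.adjoin (IntermediateField.adjoin ℚ {((√(d : ℝ) : ℝ) : ℂ)}) {Complex.I})
  rw [h1, h2] at h3
  rw [baseField, ← IntermediateField.adjoin_simple_adjoin_simple]
  exact h3.symm

instance (d : ℕ) : FiniteDimensional ℚ (baseField d) :=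
  IntermediateField.finiteDimensional_adjoin (by
    rintro x (rfl | rfl)
    · exact isIntegral_of_sq_eq (c := (d : ℚ)) (by simp [ofReal_sqrt_sq])
    · exact isIntegral_of_sq_eq (c := (-1 : ℚ)) (by simp))

instance (d : ℕ) : NumberField (baseField d) where
  to_charZero := inferInstance
  to_finiteDimensional := inferInstance

instance (d p : ℕ) : FiniteDimensional (baseField d) (extField d p) :=
  IntermediateField.adjoin.finiteDimensional
    (isIntegral_of_sq_eq (c := (p : baseField d)) (by simp [ofReal_sqrt_sq]))

instance (d p : ℕ) : NumberField (extField d p) :=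
  NumberField.of_module_finite (baseField d) _

theorem finrank_extField (hd : ¬ IsSquare d) (hp : ¬ IsSquare p) (hpd : ¬ IsSquare (p * d)) :
    Module.finrank (baseField d) (extField d p) = 2 := by
  refine finrank_adjoin_sqrt (c := (p : baseField d)) (by simp [ofReal_sqrt_sq]) ?_
  rintro ⟨⟨r, hr⟩, hrp⟩
  have hr' : r = ((√(p : ℝ) : ℝ) : ℂ) := hrp
  have h1 := (re_im_mem_of_mem hr).1
  rw [hr', Complex.ofReal_re] at h1
  rcases isSquare_of_mem hd (r := p) h1 (by rw [sqrt_natCast_sq]; simp) with h | h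
  · exact hp (Rat.isSquare_natCast_iff.mp h)
  · exact hpd (Rat.isSquare_natCast_iff.mp (by push_cast; exact h))

theorem mem_subfield_of_generators (S : Subfield (baseField d))
    (h₁ : (⟨((√(d : ℝ) : ℝ) : ℂ), IntermediateField.subset_adjoin _ _ (by simp)⟩ : baseField d) ∈ S)
    (h₂ : (⟨Complex.I, IntermediateField.subset_adjoin _ _ (by simp)⟩ : baseField d) ∈ S)
    (w : baseField d) : w ∈ S := by
  obtain ⟨w, hw⟩ := w
  induction hw using IntermediateField.adjoin_induction with
  | mem x hx =>
    rcases hx with rfl | rfl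
    · exact h₁
    · exact h₂
  | algebraMap r =>
    have : (⟨algebraMap ℚ ℂ r, IntermediateField.algebraMap_mem _ r⟩ : baseField d) =
      algebraMap ℚ (baseField d) r := rfl
    rw [this, eq_ratCast]
    exact SubfieldClass.ratCast_mem S r
  | add x y hx hy ihx ihy => exact add_mem ihx ihy
  | inv x hx ihx => exact inv_mem ihx
  | mul x y hx hy ihx ihy => exact mul_mem ihx ihy

end ConcreteFields

section Abstract

variable {k K : Type*} [Field k] [NumberField k] [Field K] [NumberField K] [Algebra k K]

theorem finrank_rat_mul_finrank :
    Module.finrank ℚ k * Module.finrank k K = Module.finrank ℚ K :=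
  Module.finrank_mul_finrank ℚ k K

/-- `card_capitulationKernel_cases` for `k = ℚ(I, ab)` and `K = k(c)`, where `c` is `a` or `b`. -/
theorem caseSplit_of_generators {m n d : ℕ} (hd : d = m * n) (hm : m % 4 = 1)
    (hn : n % 4 = 3) (hn' : Squarefree n) (hmn : m.Coprime n) {x y : ℚ} (hε : FundCoords d x y)
    (hN : x ^ 2 - d * y ^ 2 = 1) {I a b c : K} {J e : k} (hJ : algebraMap k K J = I)
    (he : algebraMap k K e = a * b) (hI : I ^ 2 = -1) (ha : a ^ 2 = m) (hb : b ^ 2 = n)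
    (hc : c = a ∨ c = b) (hk : ∀ S : Subfield k, e ∈ S → J ∈ S → ∀ w, w ∈ S)
    (hK : ∀ w : K, ∃ u v : k, w = algebraMap k K u + algebraMap k K v * c)
    (hk4 : Module.finrank ℚ k = 4) (hK2 : Module.finrank k K = 2) (f : K →+* ℂ)
    (hf : f (a * b) = ((√(d : ℝ) : ℝ) : ℂ)) :
    CaseSplit m n x (Nat.card (capitulationKernel k K)) := by
  have hm0 : 0 < m := by omega
  have hn0 : 0 < n := by omega
  have h : IsTriquadratic K m n I a b := by
    refine ⟨hI, ha, hb, hm0, hn0, ?_, by rw [← finrank_rat_mul_finrank (k := k), hk4, hK2]⟩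
    rw [eq_top_iff]
    rintro w -
    set S := IntermediateField.adjoin ℚ {I, a, b}
    have hIS : I ∈ S := IntermediateField.subset_adjoin _ _ (by simp)
    have haS : a ∈ S := IntermediateField.subset_adjoin _ _ (by simp)
    have hbS : b ∈ S := IntermediateField.subset_adjoin _ _ (by simp)
    have hcS : c ∈ S := by rcases hc with rfl | rfl <;> assumption
    have key : ∀ u : k, algebraMap k K u ∈ S := by
      refine hk (S.toSubfield.comap (algebraMap k K)) ?_ ?_
      · rw [Subfield.mem_comap, he]
        exact mul_mem haS hbS
      · rw [Subfield.mem_comap, hJ]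
        exact hIS
    obtain ⟨u, v, rfl⟩ := hK w
    exact add_mem (key u) (mul_mem (key v) hcS)
  obtain ⟨s⟩ := h.nonempty_signs
  -- Since `s₂s₃` negates both `a` and `b`, it fixes the generators `ab` and `I` of `k`, while it
  -- negates `c`; so its fixed field is `k`.
  have hσk : ∀ u : k, s.s₂ (s.s₃ (algebraMap k K u)) = algebraMap k K u := by
    refine hk (RingHom.eqLocusField
      (((s.s₃.trans s.s₂ : K ≃ₐ[ℚ] K) : K →+* K).comp (algebraMap k K)) (algebraMap k K)) ?_ ?_
    · change s.s₂ (s.s₃ (algebraMap k K e)) = algebraMap k K e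
      rw [he, map_mul, map_mul, s.s₃a, s.s₃b, s.s₂a, map_neg, s.s₂b]
      ring
    · change s.s₂ (s.s₃ (algebraMap k K J)) = algebraMap k K J
      rw [hJ, s.s₃I, s.s₂I]
  have hσc : s.s₂ (s.s₃ c) = -c := by
    rcases hc with rfl | rfl
    · rw [s.s₃a, s.s₂a]
    · rw [s.s₃b, map_neg, s.s₂b]
  have hc0 : c ≠ 0 := by
    rintro rfl
    rcases hc with rfl | rfl
    · exact hm0.ne' (by exact_mod_cast ha.symm.trans (zero_pow two_ne_zero))
    · exact hn0.ne' (by exact_mod_cast hb.symm.trans (zero_pow two_ne_zero))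
  have hfix : ∀ w, s.s₂ (s.s₃ w) = w ↔ w ∈ Set.range (algebraMap k K) := by
    intro w
    constructor
    · intro hw
      obtain ⟨u, v, rfl⟩ := hK w
      rw [map_add, map_add, map_mul, map_mul, hσk, hσk, hσc] at hw
      have h0 : algebraMap k K v * c = 0 := by linear_combination (-1 / 2 : K) * hw
      exact ⟨u, by rw [h0, add_zero]⟩
    · rintro ⟨u, rfl⟩
      exact hσk u
  subst hd
  have hab : (a * b) ^ 2 = ((m * n : ℕ) : K) := by rw [mul_pow, ha, hb, Nat.cast_mul]
  exact card_capitulationKernel_cases h s hfix hk4 hm hn hn' hmn hN (hε.unit.isAlgUnit hab)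
    (hε.gen_of_ringHom f hf) (hε.pos hN) (hε.not_isSquare hN)

end Abstract

/-- As `√m √n = √d` lies in `k`, adjoining either root gives the same field. Allowing `p = n` is
what covers `k(√q)`, where `m = p₁p₂` is not prime. -/
theorem caseSplit_extField {m n d p : ℕ} (hd : d = m * n) (hp : p = m ∨ p = n) (hm : m % 4 = 1)
    (hn : n % 4 = 3) (hm' : Squarefree m) (hn' : Squarefree n) (hm1 : m ≠ 1)
    (hmn : m.Coprime n) {x y : ℚ} (hε : FundCoords d x y) :
    CaseSplit m n x (Nat.card (capitulationKernel (baseField d) (extField d p))) := by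
  have hm0 : 0 < m := by omega
  have hn0 : 0 < n := by omega
  have hd4 : d % 4 = 3 := by rw [hd, Nat.mul_mod, hm, hn]
  have hdsq : Squarefree d := hd ▸ (Nat.squarefree_mul hmn).mpr ⟨hm', hn'⟩
  have hdn : ¬ IsSquare d := PrimeTriple.not_isSquare_of_mod hd4
  have hN := hε.unit.norm_eq_one hdsq hd4
  have hmns : ¬ IsSquare m := PrimeTriple.not_isSquare_of_squarefree hm' hm1
  have hnns : ¬ IsSquare n := PrimeTriple.not_isSquare_of_mod hn
  have hcancel : ∀ s t : ℕ, 0 < s → IsSquare (s * (s * t)) → IsSquare t := by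
    rintro s t hs ⟨r, hr⟩
    have hdvd : s ∣ r := by
      rw [← Nat.pow_dvd_pow_iff two_ne_zero, pow_two, pow_two, ← hr]
      exact ⟨t, by ring⟩
    obtain ⟨r', rfl⟩ := hdvd
    refine ⟨r', Nat.eq_of_mul_eq_mul_left (Nat.mul_pos hs hs) ?_⟩
    linarith
  have hpn : ¬ IsSquare p := by rcases hp with rfl | rfl <;> assumption
  have hpd : ¬ IsSquare (p * d) := by
    rcases hp with rfl | rfl
    · rw [hd]; exact fun h => hnns (hcancel _ _ hm0 h)
    · rw [hd, mul_comm m]; exact fun h => hmns (hcancel _ _ hn0 h)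
  have hsqrt : ((√(d : ℝ) : ℝ) : ℂ) = ((√(m : ℝ) : ℝ) : ℂ) * ((√(n : ℝ) : ℝ) : ℂ) := by
    rw [hd, Nat.cast_mul, Real.sqrt_mul (Nat.cast_nonneg m), Complex.ofReal_mul]
  have hmC : ((√(m : ℝ) : ℝ) : ℂ) ≠ 0 := by
    rw [Ne, Complex.ofReal_eq_zero, Real.sqrt_eq_zero (Nat.cast_nonneg m)]
    exact_mod_cast hm0.ne'
  have hnC : ((√(n : ℝ) : ℝ) : ℂ) ≠ 0 := by
    rw [Ne, Complex.ofReal_eq_zero, Real.sqrt_eq_zero (Nat.cast_nonneg n)]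
    exact_mod_cast hn0.ne'
  have hdk : ((√(d : ℝ) : ℝ) : ℂ) ∈ baseField d := IntermediateField.subset_adjoin _ _ (by simp)
  have hIk : Complex.I ∈ baseField d := IntermediateField.subset_adjoin _ _ (by simp)
  have hkK : ∀ w ∈ baseField d, w ∈ extField d p := fun w hw =>
    (extField d p).algebraMap_mem ⟨w, hw⟩
  have hpK : ((√(p : ℝ) : ℝ) : ℂ) ∈ extField d p := IntermediateField.subset_adjoin _ _ (by simp)
  have hmK : ((√(m : ℝ) : ℝ) : ℂ) ∈ extField d p := by
    rcases hp with rfl | rfl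
    · exact hpK
    · rw [eq_div_of_mul_eq hnC hsqrt.symm]
      exact div_mem (hkK _ hdk) hpK
  have hnK : ((√(n : ℝ) : ℝ) : ℂ) ∈ extField d p := by
    rcases hp with rfl | rfl
    · rw [eq_div_of_mul_eq hmC ((mul_comm _ _).trans hsqrt.symm)]
      exact div_mem (hkK _ hdk) hpK
    · exact hpK
  refine caseSplit_of_generators hd hm hn hn' hmn hε hN
    (I := ⟨Complex.I, hkK _ hIk⟩) (a := ⟨_, hmK⟩) (b := ⟨_, hnK⟩) (c := ⟨_, hpK⟩)
    (J := ⟨_, hIk⟩) (e := ⟨_, hdk⟩) rfl (Subtype.ext hsqrt) (Subtype.ext (by simp))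
    (Subtype.ext (by simp [ofReal_sqrt_sq])) (Subtype.ext (by simp [ofReal_sqrt_sq])) ?_
    (fun S h₁ h₂ => mem_subfield_of_generators S h₁ h₂) ?_ ?_ (finrank_extField hdn hpn hpd)
    (algebraMap (extField d p) ℂ) hsqrt.symm
  · rcases hp with rfl | rfl
    · exact Or.inl rfl
    · exact Or.inr rfl
  · rintro ⟨w, hw⟩
    obtain ⟨u, v, huv⟩ := exists_coords_adjoin_sqrt (c := (p : baseField d))
      (by simp [ofReal_sqrt_sq]) hw
    exact ⟨u, v, Subtype.ext huv⟩
  · convert finrank_baseField hdn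

end Capitulation

open Capitulation in
theorem theorem5p2 (p₁ p₂ q : ℕ) (hp₁ : p₁.Prime) (hp₂ : p₂.Prime) (hq : q.Prime)
    (hp₁4 : p₁ % 4 = 1) (hp₂4 : p₂ % 4 = 1) (hq4 : q % 4 = 3) (hne : p₁ ≠ p₂)
    (ε : (𝓞 (realQuadratic (p₁ * p₂ * q)))ˣ) (hε : IsFundamentalUnit ε)
    (x y : ℚ) (hxy : HasCoords ε x y) :
    -- the extension `K₁ = k(√p₁)`
    (∀ η : (𝓞 (realQuadratic (p₂ * q)))ˣ, IsFundamentalUnit η →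
      ∀ a b : ℚ, HasCoords η a b →
        ((PMSquare 1 x ∧ ¬ PMSquare 1 a) →
          Nat.card (capitulationKernel (baseField (p₁ * p₂ * q))
            (extField (p₁ * p₂ * q) p₁)) = 8) ∧
        ((PMSquare 1 a ∧ (PMSquare p₁ x ∨ PMSquare (2 * p₁) x)) →
          Nat.card (capitulationKernel (baseField (p₁ * p₂ * q))
            (extField (p₁ * p₂ * q) p₁)) = 2) ∧
        ((¬ (PMSquare 1 x ∧ ¬ PMSquare 1 a) ∧
            ¬ (PMSquare 1 a ∧ (PMSquare p₁ x ∨ PMSquare (2 * p₁) x))) →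
          Nat.card (capitulationKernel (baseField (p₁ * p₂ * q))
            (extField (p₁ * p₂ * q) p₁)) = 4)) ∧
    -- the extension `K₂ = k(√p₂)`
    (∀ η : (𝓞 (realQuadratic (p₁ * q)))ˣ, IsFundamentalUnit η →
      ∀ a b : ℚ, HasCoords η a b →
        ((PMSquare 1 x ∧ ¬ PMSquare 1 a) →
          Nat.card (capitulationKernel (baseField (p₁ * p₂ * q))
            (extField (p₁ * p₂ * q) p₂)) = 8) ∧
        ((PMSquare 1 a ∧ (PMSquare p₂ x ∨ PMSquare (2 * p₂) x)) →
          Nat.card (capitulationKernel (baseField (p₁ * p₂ * q))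
            (extField (p₁ * p₂ * q) p₂)) = 2) ∧
        ((¬ (PMSquare 1 x ∧ ¬ PMSquare 1 a) ∧
            ¬ (PMSquare 1 a ∧ (PMSquare p₂ x ∨ PMSquare (2 * p₂) x))) →
          Nat.card (capitulationKernel (baseField (p₁ * p₂ * q))
            (extField (p₁ * p₂ * q) p₂)) = 4)) ∧
    -- the extension `K₃ = k(√q)`
    (∀ η : (𝓞 (realQuadratic (p₁ * p₂)))ˣ, IsFundamentalUnit η →
        (Algebra.norm ℚ ((η : 𝓞 (realQuadratic (p₁ * p₂))) : realQuadratic (p₁ * p₂)) = 1 →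
          (PMSquare 1 x →
            Nat.card (capitulationKernel (baseField (p₁ * p₂ * q))
              (extField (p₁ * p₂ * q) q)) = 4) ∧
          (¬ PMSquare 1 x →
            Nat.card (capitulationKernel (baseField (p₁ * p₂ * q))
              (extField (p₁ * p₂ * q) q)) = 2)) ∧
        (Algebra.norm ℚ ((η : 𝓞 (realQuadratic (p₁ * p₂))) : realQuadratic (p₁ * p₂)) = -1 →
          (PMSquare q x ∨ PMSquare (2 * q) x →
            Nat.card (capitulationKernel (baseField (p₁ * p₂ * q))
              (extField (p₁ * p₂ * q) q)) = 2) ∧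
          (¬ (PMSquare q x ∨ PMSquare (2 * q) x) →
            Nat.card (capitulationKernel (baseField (p₁ * p₂ * q))
              (extField (p₁ * p₂ * q) q)) = 4))) := by
  have P : PrimeTriple p₁ p₂ q := ⟨hp₁, hp₂, hq, hp₁4, hp₂4, hq4, hne⟩
  have hd : ¬ IsSquare (p₁ * p₂ * q) := PrimeTriple.not_isSquare_of_mod P.mod
  have hε' := hε.fundCoords hd hxy
  refine ⟨fun η hη a b hab => ?_, fun η hη a b hab => ?_, fun η hη => ?_⟩
  · refine P.card_cases₁ hε' (hη.fundCoords (PrimeTriple.not_isSquare_of_mod P.mod₂q) hab) ?_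
    exact caseSplit_extField (mul_assoc _ _ _) (Or.inl rfl) P.mod₁ P.mod₂q
      P.prime₁.prime.squarefree P.squarefree₂q P.prime₁.ne_one
      (Nat.Coprime.mul_right P.coprime₁₂ P.coprime₁q) hε'
  · have hcomm : p₁ * p₂ * q = p₂ * p₁ * q := by rw [mul_comm p₁]
    refine P.swap.card_cases₁ (hcomm ▸ hε')
      (hη.fundCoords (PrimeTriple.not_isSquare_of_mod P.swap.mod₂q) hab) ?_
    exact caseSplit_extField (hcomm.trans (mul_assoc _ _ _)) (Or.inl rfl) P.mod₂ P.swap.mod₂q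
      P.prime₂.prime.squarefree P.swap.squarefree₂q P.prime₂.ne_one
      (Nat.Coprime.mul_right P.swap.coprime₁₂ P.coprime₂q) hε'
  · obtain ⟨a, b, hab⟩ := exists_hasCoords P.not_isSquare₁₂ η
    have hη' := hη.fundCoords P.not_isSquare₁₂ hab
    rw [norm_of_hasCoords P.not_isSquare₁₂ hab]
    have hC := caseSplit_extField rfl (Or.inr rfl) P.mod₁₂ hq4 P.squarefree₁₂
      hq.prime.squarefree
      (fun h => hp₁.one_lt.ne' (Nat.eq_one_of_mul_eq_one_right h))
      (Nat.Coprime.mul_left P.coprime₁q P.coprime₂q) hε'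
    exact ⟨fun hN => P.card_cases_q hε' hη' hN hC, fun hN => P.card_cases_q_of_neg hε' hη' hN hC⟩
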